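/- **Proposition 5.6.** Let $k$ be an algebraically closed field, $g\ge 2$ an integer, and let $f=f_{2g+1}$ be a binary form of degree $2g+1$ over $k$ such that $f(X^2,Y)\in k[X,Y]$ has no multiple factors. Let $$R=k[X,Y,Z]/(Z^2+f(X^2,Y)),\qquad \deg(X,Y,Z)=(1,2,2g+1),$$ and for $d\ge 1$ let $R^{(d)}=\bigoplus_{n\ge 0}R_{dn}$ be the $d$-th Veronese subring. For a Cohen–Macaulay graded ring $S=\bigoplus_{n\ge0}S_n$, finitely generated over $S_0=k$, of dimension $\delta$ and with $\mathfrak m=\bigoplus_{n>0}S_n$, let $K_S=[H^{\delta}_{\mathfrak m}(S)]^*$ (graded $k$-dual) be its canonical module and $a(S)=-\min\{n : [K_S]_n\neq 0\}$; $S$ is Gorenstein if $K_S\cong S$ as $S$-modules (with no condition on degrees), and *nearly Gorenstein* if the trace ideal $\mathrm{Tr}_S(K_S)=\sum_{\varphi\in \mathrm{Hom}_S(K_S,S)}\varphi(K_S)$ contains $\mathfrak m$. Then $a(R)=2g-2$, and for $d\ge 1$ the ring $R^{(d)}$ is Gorenstein if and only if $d\mid 2g-2$. Moreover: 1. $R^{(3)}$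 and $R^{(4)}$ are nearly Gorenstein for every $g\ge 2$. 2. If $6\nmid 2g-2$, then $R^{(6)}$ is nearly Gorenstein if and only if $g\not\equiv 2 \pmod 3$. 3. If $d\nmid 2g-2$ and $d\ge 4g-1$, then $R^{(d)}$ is nearly Gorenstein. 4. Let $d\ge 5$ and $d\nmid 2g-2$. - (a) If $g=2$, then $R^{(d)}$ is nearly Gorenstein if and only if $d\ge 7$. - (b) If $g=3$, then $R^{(d)}$ is nearly Gorenstein if and only if $d=5$, $d=6$ or $d\ge 11$. - (c) If $g=4$, then $R^{(d)}$ is nearly Gorenstein if and only if $d=5$, $d=7$, $d=8$ or $d\ge 15$. - (d) If $g=5$, then $R^{(d)}$ is nearly Gorenstein if and only if ($d\le 10$ and $d\ne 6$) or $d\ge 19$. -/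

import Mathlib

noncomputable section

namespace NearlyGor

open MvPolynomial

/-! ### Graded algebras, top local cohomology, canonical module

In this part `S = ⨁ₙ 𝒜 n` is an `ℕ`-graded algebra over a field `k`. The rings that occur have
`𝒜 0 = k` and are finitely generated over `k`. -/

section Graded

variable {k S : Type*} [Field k] [CommRing S] [Algebra k S]
variable (𝒜 : ℕ → Submodule k S)

/-- `x 1, …, x n` is a homogeneous system of parameters of `S`: homogeneous elements of positive
degrees `e 1, …, e n`, as many as the Krull dimension of `S`, which generate the
irrelevant ideal `𝔪 = ⨁_{m > 0} 𝒜 m` up to radical. -/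
structure IsHomogeneousSOP [GradedAlgebra 𝒜] {n : ℕ} (x : Fin n → S) (e : Fin n → ℕ) : Prop where
  degree_pos : ∀ i, 0 < e i
  mem : ∀ i, x i ∈ 𝒜 (e i)
  card_eq : ringKrullDim S = n
  radical_eq : (Ideal.span (Set.range x)).radical = (HomogeneousIdeal.irrelevant 𝒜).toIdeal

/-- A graded ring (with `𝒜 0` a field) is Cohen–Macaulay iff some homogeneous system
of parameters is a regular sequence. -/
def IsGradedCohenMacaulay [GradedAlgebra 𝒜] : Prop :=
  ∃ (n : ℕ) (x : Fin n → S) (e : Fin n → ℕ),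
    IsHomogeneousSOP 𝒜 x e ∧ RingTheory.Sequence.IsRegular S (List.ofFn x)

/-- The last term `S_{x₁⋯xₙ}` of the Čech complex of `S` with respect to `x₁, …, xₙ`. -/
abbrev CechTop {n : ℕ} (x : Fin n → S) : Type _ := Localization.Away (∏ i, x i)

/-- The coboundaries in `S_{x₁⋯xₙ}`: the sum over `i` of the images of the localizations
`S_{x₁⋯x̂ᵢ⋯xₙ}`. The image of such a localization consists of the `a` for which
`(x₁⋯x̂ᵢ⋯xₙ)ᵗ a` comes from `S` for some `t`. -/
def cechCoboundaries {n : ℕ} (x : Fin n → S) : Submodule S (CechTop x) :=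
  ⨆ i, Submodule.span S {a | ∃ (t : ℕ) (s : S),
    (∏ j ∈ Finset.univ.erase i, x j) ^ t • a = algebraMap S (CechTop x) s}

/-- `Hⁿ(x₁, …, xₙ; S)`, the top cohomology of the Čech complex. If `x` is a homogeneous system of
parameters this is the top local cohomology `Hⁿ_𝔪(S)`, `n = dim S`. -/
abbrev TopLocalCohomology {n : ℕ} (x : Fin n → S) : Type _ :=
  CechTop x ⧸ cechCoboundaries x

/-- The homogeneous component of degree `m ∈ ℤ` of `Hⁿ_𝔪(S)`: it consists of the classes of the
fractions `s / (x₁⋯xₙ)ᵗ` with `s` homogeneous of degree `m + t (e₁ + ⋯ + eₙ)`,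
where `eᵢ = deg xᵢ`. -/
def topLocalCohomologyGrading {n : ℕ} (x : Fin n → S) (e : Fin n → ℕ) (m : ℤ) :
    Submodule k (TopLocalCohomology x) :=
  Submodule.span k {h | ∃ (a : CechTop x) (t l : ℕ) (s : S),
    s ∈ 𝒜 l ∧ (∏ i, x i) ^ t • a = algebraMap S (CechTop x) s ∧
    (l : ℤ) = m + t * ∑ i, (e i : ℤ) ∧ h = (cechCoboundaries x).mkQ a}

lemma smul_mem_topLocalCohomologyGrading [GradedAlgebra 𝒜] {n : ℕ} (x : Fin n → S)
    (e : Fin n → ℕ) {i : ℕ} {s : S} (hs : s ∈ 𝒜 i) {m : ℤ} {h : TopLocalCohomology x}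
    (hh : h ∈ topLocalCohomologyGrading 𝒜 x e m) :
    s • h ∈ topLocalCohomologyGrading 𝒜 x e (m + i) := by
  induction hh using Submodule.span_induction with
  | mem h hh =>
    obtain ⟨a, t, l, r, hr, ha, hl, rfl⟩ := hh
    refine Submodule.subset_span ⟨s • a, t, i + l, s * r, SetLike.mul_mem_graded hs hr, ?_, ?_, ?_⟩
    · rw [smul_comm, ha, map_mul, Algebra.smul_def]
    · push_cast; rw [hl]; ring
    · simp
  | zero => simp
  | add u v _ _ hu hv => rw [smul_add]; exact add_mem hu hv
  | smul c u _ hu => rw [smul_comm]; exact Submodule.smul_mem _ _ hu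

/-- `a(S) = a`: the largest degree in which `Hⁿ_𝔪(S)` is nonzero is `a`. Since
`K_S = [Hⁿ_𝔪(S)]^*`, this is `-min {m | [K_S]ₘ ≠ 0}`. -/
def HasAInvariant [GradedAlgebra 𝒜] (a : ℤ) : Prop :=
  ∃ (n : ℕ) (x : Fin n → S) (e : Fin n → ℕ), IsHomogeneousSOP 𝒜 x e ∧
    IsGreatest {m : ℤ | topLocalCohomologyGrading 𝒜 x e m ≠ ⊥} a

/-- The graded `k`-dual `⨁ₘ Hom_k([Hⁿ_𝔪(S)]₋ₘ, k)` of `Hⁿ_𝔪(S)`: the `k`-linear functionals that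
vanish on all but finitely many homogeneous components. -/
def gradedDual {n : ℕ} (x : Fin n → S) (e : Fin n → ℕ) :
    Submodule k (Module.Dual k (TopLocalCohomology x)) where
  carrier := {φ | {m : ℤ | ∃ h ∈ topLocalCohomologyGrading 𝒜 x e m, φ h ≠ 0}.Finite}
  zero_mem' := by simp
  add_mem' := by
    intro φ ψ hφ hψ
    refine (hφ.union hψ).subset ?_
    rintro m ⟨h, hh, hne⟩
    by_cases h0 : φ h = 0
    · exact Or.inr ⟨h, hh, by simpa [h0] using hne⟩
    · exact Or.inl ⟨h, hh, h0⟩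
  smul_mem' := by
    intro c φ hφ
    refine hφ.subset ?_
    rintro m ⟨h, hh, hne⟩
    exact ⟨h, hh, fun h0 => hne (by simp [h0])⟩

/-- The canonical module `K_S = [Hⁿ_𝔪(S)]^*`, computed with the homogeneous system of
parameters `x` (different choices of `x` give isomorphic modules). -/
def CanonicalModule {n : ℕ} (x : Fin n → S) (e : Fin n → ℕ) : Type _ :=
  gradedDual 𝒜 x e

instance {n : ℕ} (x : Fin n → S) (e : Fin n → ℕ) : AddCommGroup (CanonicalModule 𝒜 x e) :=
  inferInstanceAs (AddCommGroup (gradedDual 𝒜 x e))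

lemma comp_smul_mem_gradedDual [GradedAlgebra 𝒜] {n : ℕ} (x : Fin n → S) (e : Fin n → ℕ) (s : S)
    {φ : Module.Dual k (TopLocalCohomology x)} (hφ : φ ∈ gradedDual 𝒜 x e) :
    φ ∘ₗ Algebra.lsmul k k (TopLocalCohomology x) s ∈ gradedDual 𝒜 x e := by
  induction s using DirectSum.Decomposition.inductionOn 𝒜 with
  | zero => simp
  | @homogeneous i s =>
    have hinj : Set.InjOn (fun m : ℤ => m + (i : ℤ)) ((fun m : ℤ => m + (i : ℤ)) ⁻¹'
        {m : ℤ | ∃ h ∈ topLocalCohomologyGrading 𝒜 x e m, φ h ≠ 0}) :=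
      (add_left_injective (i : ℤ)).injOn
    refine (Set.Finite.preimage hinj hφ).subset ?_
    rintro m ⟨h, hh, hne⟩
    exact ⟨(s : S) • h, smul_mem_topLocalCohomologyGrading 𝒜 x e s.2 hh, hne⟩
  | add a b ha hb => rw [map_add, LinearMap.comp_add]; exact add_mem ha hb

/-- `S` acts on `K_S` by `(s φ)(h) = φ (s h)`. -/
instance [GradedAlgebra 𝒜] {n : ℕ} (x : Fin n → S) (e : Fin n → ℕ) :
    Module S (CanonicalModule 𝒜 x e) where
  smul s φ := ⟨φ.1 ∘ₗ Algebra.lsmul k k (TopLocalCohomology x) s,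
    comp_smul_mem_gradedDual 𝒜 x e s φ.2⟩
  one_smul φ := Subtype.ext (LinearMap.ext fun h => congrArg φ.1 (one_smul S h))
  mul_smul a b φ := Subtype.ext (LinearMap.ext fun h => congrArg φ.1
    (show (a * b) • h = b • a • h by rw [mul_comm, mul_smul]))
  smul_zero a := Subtype.ext (LinearMap.ext fun h => rfl)
  smul_add a φ ψ := Subtype.ext (LinearMap.ext fun h => rfl)
  add_smul a b φ := Subtype.ext (LinearMap.ext fun h =>
    (congrArg φ.1 (add_smul a b h)).trans (map_add φ.1 _ _))
  zero_smul φ := Subtype.ext (LinearMap.ext fun h =>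
    (congrArg φ.1 (zero_smul S h)).trans (map_zero φ.1))

/-- The trace ideal `Tr_S(M)`, generated by all `f m` with `f ∈ Hom_S(M, S)` and `m ∈ M`. -/
def traceIdeal (S M : Type*) [CommRing S] [AddCommGroup M] [Module S M] : Ideal S :=
  Ideal.span {s | ∃ (f : M →ₗ[S] S) (m : M), f m = s}

/-- `S` is nearly Gorenstein: it is Cohen–Macaulay and `Tr_S(K_S) ⊇ 𝔪`. -/
def IsNearlyGorenstein [GradedAlgebra 𝒜] : Prop :=
  IsGradedCohenMacaulay 𝒜 ∧
  ∃ (n : ℕ) (x : Fin n → S) (e : Fin n → ℕ), IsHomogeneousSOP 𝒜 x e ∧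
    (HomogeneousIdeal.irrelevant 𝒜).toIdeal ≤ traceIdeal S (CanonicalModule 𝒜 x e)

/-- `S` is Gorenstein: it is Cohen–Macaulay and `K_S` is free of rank one. -/
def IsGradedGorenstein [GradedAlgebra 𝒜] : Prop :=
  IsGradedCohenMacaulay 𝒜 ∧
  ∃ (n : ℕ) (x : Fin n → S) (e : Fin n → ℕ), IsHomogeneousSOP 𝒜 x e ∧
    Nonempty (CanonicalModule 𝒜 x e ≃ₗ[S] S)

/-! ### Veronese subrings -/

/-- The Veronese subring `S^{(d)} = ⨁ₙ 𝒜 (d n)` of `S`. -/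
def veronese [GradedAlgebra 𝒜] (d : ℕ) : Subalgebra k S :=
  (⨆ n, 𝒜 (d * n)).toSubalgebra
    (Submodule.mem_iSup_of_mem 0 (by simpa using SetLike.one_mem_graded 𝒜))
    (by
      intro a b ha hb
      induction ha using Submodule.iSup_induction' with
      | mem i a ha =>
        induction hb using Submodule.iSup_induction' with
        | mem j b hb =>
          refine Submodule.mem_iSup_of_mem (i + j) ?_
          rw [mul_add]
          exact SetLike.mul_mem_graded ha hb
        | zero => simp
        | add u v _ _ hu hv => rw [mul_add]; exact add_mem hu hv
      | zero => simp
      | add u v _ _ hu hv => rw [add_mul]; exact add_mem hu hv)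

/-- The grading of the Veronese subring: `[S^{(d)}]ₙ = 𝒜 (d n)`. -/
def veroneseGrading [GradedAlgebra 𝒜] (d n : ℕ) : Submodule k (veronese 𝒜 d) :=
  (𝒜 (d * n)).comap (veronese 𝒜 d).val.toLinearMap

instance veroneseGrading.gradedAlgebra [GradedAlgebra 𝒜] (d : ℕ) [NeZero d] :
    GradedAlgebra (veroneseGrading 𝒜 d) :=
  have key : DirectSum.IsInternal (veroneseGrading 𝒜 d) := by
    have hle : ∀ n, (veroneseGrading 𝒜 d n).map (veronese 𝒜 d).val.toLinearMap ≤ 𝒜 (d * n) :=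
      fun n => Submodule.map_comap_le _ _
    rw [DirectSum.isInternal_submodule_iff_iSupIndep_and_iSup_eq_top]
    constructor
    · have hind : iSupIndep fun n => 𝒜 (d * n) :=
        (DirectSum.Decomposition.isInternal 𝒜).submodule_iSupIndep.comp
          (f := fun n => d * n) fun a b h => Nat.eq_of_mul_eq_mul_left (NeZero.pos d) h
      intro i
      rw [Submodule.disjoint_def]
      intro z hz hz'
      refine Subtype.ext (Submodule.disjoint_def.mp (hind i) z hz ?_)
      have h2 := Submodule.mem_map_of_mem (f := (veronese 𝒜 d).val.toLinearMap) hz'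
      simp only [Submodule.map_iSup] at h2
      exact (iSup₂_mono fun j _ => hle j) h2
    · rw [eq_top_iff]
      rintro ⟨z, hz⟩ -
      have hz' : z ∈ (⨆ n, veroneseGrading 𝒜 d n).map (veronese 𝒜 d).val.toLinearMap := by
        rw [Submodule.map_iSup]
        have hmono : (⨆ n, 𝒜 (d * n)) ≤
            ⨆ n, (veroneseGrading 𝒜 d n).map (veronese 𝒜 d).val.toLinearMap :=
          iSup_mono fun n w hw => ⟨⟨w, Submodule.mem_iSup_of_mem n hw⟩, hw, rfl⟩
        exact hmono hz
      obtain ⟨w, hw, hwz⟩ := hz'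
      have : w = ⟨z, hz⟩ := Subtype.ext hwz
      exact this ▸ hw
  { key.chooseDecomposition with
    one_mem := by
      change (1 : S) ∈ 𝒜 (d * 0)
      simpa using SetLike.one_mem_graded 𝒜
    mul_mem := by
      intro i j a b ha hb
      change (a : S) * b ∈ 𝒜 (d * (i + j))
      rw [mul_add]
      exact SetLike.mul_mem_graded ha hb }

end Graded

/-! ### The hyperelliptic cone -/

section Hyperelliptic

variable {k : Type*} [Field k]

/-- The binary form `f` with `X²` and `Y` substituted: `f(X², Y) ∈ k[X, Y]`. -/
def substSq (f : MvPolynomial (Fin 2) k) : MvPolynomial (Fin 2) k :=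
  aeval ![X 0 ^ 2, X 1] f

/-- `Z² + f(X², Y) ∈ k[X, Y, Z]`, with `X, Y, Z` the variables number `0, 1, 2`. -/
def hyperellipticEquation (f : MvPolynomial (Fin 2) k) : MvPolynomial (Fin 3) k :=
  X 2 ^ 2 + aeval ![X 0 ^ 2, X 1] f

/-- `R = k[X, Y, Z] / (Z² + f(X², Y))`. -/
abbrev HyperellipticRing (f : MvPolynomial (Fin 2) k) : Type _ :=
  MvPolynomial (Fin 3) k ⧸ Ideal.span {hyperellipticEquation f}

/-- The degrees `deg (X, Y, Z) = (1, 2, 2g+1)`. -/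
def hyperellipticWeight (g : ℕ) : Fin 3 → ℕ := ![1, 2, 2 * g + 1]

/-- The homogeneous component `Rₙ` for `deg (X, Y, Z) = (1, 2, 2g+1)`, where `f` is
a binary form of degree `2g+1`. -/
def hyperellipticGrading (g : ℕ) (f : homogeneousSubmodule (Fin 2) k (2 * g + 1)) (n : ℕ) :
    Submodule k (HyperellipticRing f.1) :=
  (weightedHomogeneousSubmodule k (hyperellipticWeight g) n).map
    (Ideal.Quotient.mkₐ k (Ideal.span {hyperellipticEquation f.1})).toLinearMap

lemma isWeightedHomogeneous_hyperellipticEquation (g : ℕ)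
    (f : homogeneousSubmodule (Fin 2) k (2 * g + 1)) :
    IsWeightedHomogeneous (hyperellipticWeight g) (hyperellipticEquation f.1)
      (2 * (2 * g + 1)) := by
  refine IsWeightedHomogeneous.add ?_ ?_
  · have := (isWeightedHomogeneous_X k (hyperellipticWeight g) 2).pow 2
    simpa [hyperellipticWeight] using this
  · obtain ⟨f, hf⟩ := f
    rw [mem_homogeneousSubmodule] at hf
    simp only
    rw [aeval_def, eval₂_eq']
    refine IsWeightedHomogeneous.sum _ _ _ fun m hm => ?_
    have hdeg := hf (mem_support_iff.mp hm)
    rw [algebraMap_eq]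
    refine IsWeightedHomogeneous.C_mul ?_ _
    have h0 := ((isWeightedHomogeneous_X k (hyperellipticWeight g) 0).pow 2).pow (m 0)
    have h1 := (isWeightedHomogeneous_X k (hyperellipticWeight g) 1).pow (m 1)
    have h01 := h0.mul h1
    have hsum : m 0 + m 1 = 2 * g + 1 := by
      rw [← hdeg, Finsupp.weight_apply, Finsupp.sum_fintype _ _ (by simp)]
      simp
    have hw : m 0 • 2 • hyperellipticWeight g 0 + m 1 • hyperellipticWeight g 1
        = 2 * (2 * g + 1) := by
      simp [hyperellipticWeight]; omega
    rw [hw] at h01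
    simpa [Fin.prod_univ_two] using h01

instance hyperellipticGrading.gradedMonoid (g : ℕ)
    (f : homogeneousSubmodule (Fin 2) k (2 * g + 1)) :
    SetLike.GradedMonoid (hyperellipticGrading g f) where
  one_mem := ⟨1, isWeightedHomogeneous_one k _, by simp⟩
  mul_mem := by
    rintro i j _ _ ⟨a, ha, rfl⟩ ⟨b, hb, rfl⟩
    exact ⟨a * b, IsWeightedHomogeneous.mul ha hb, by simp⟩

/-- The algebra map `k[X, Y, Z] → ⨁ₙ Rₙ` sending each variable to its class. -/
def hyperellipticLift (g : ℕ) (f : homogeneousSubmodule (Fin 2) k (2 * g + 1)) :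
    MvPolynomial (Fin 3) k →ₐ[k] DirectSum ℕ fun n => hyperellipticGrading g f n :=
  aeval fun i => DirectSum.of (fun n => hyperellipticGrading g f n) (hyperellipticWeight g i)
    ⟨Ideal.Quotient.mkₐ k _ (X i), X i, isWeightedHomogeneous_X k _ i, rfl⟩

/-- Auxiliary: the lift sends `p` to its class placed in degree `n`. -/
def LiftsTo (g : ℕ) (f : homogeneousSubmodule (Fin 2) k (2 * g + 1))
    (p : MvPolynomial (Fin 3) k) (n : ℕ) : Prop :=
  ∃ h : Ideal.Quotient.mkₐ k (Ideal.span {hyperellipticEquation f.1}) p ∈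
      hyperellipticGrading g f n,
    hyperellipticLift g f p = DirectSum.of (fun n => hyperellipticGrading g f n) n
      ⟨Ideal.Quotient.mkₐ k _ p, h⟩

lemma LiftsTo.mul {g : ℕ} {f : homogeneousSubmodule (Fin 2) k (2 * g + 1)}
    {p q : MvPolynomial (Fin 3) k} {m n : ℕ} (hp : LiftsTo g f p m) (hq : LiftsTo g f q n) :
    LiftsTo g f (p * q) (m + n) := by
  obtain ⟨hp, hp'⟩ := hp
  obtain ⟨hq, hq'⟩ := hq
  refine ⟨by rw [map_mul]; exact SetLike.mul_mem_graded hp hq, ?_⟩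
  rw [map_mul, hp', hq', DirectSum.of_mul_of]
  exact congrArg _ (Subtype.ext (map_mul _ p q).symm)

lemma LiftsTo.C (g : ℕ) (f : homogeneousSubmodule (Fin 2) k (2 * g + 1)) (r : k) :
    LiftsTo g f (MvPolynomial.C r) 0 := by
  refine ⟨⟨MvPolynomial.C r, isWeightedHomogeneous_C _ r, rfl⟩, ?_⟩
  rw [hyperellipticLift, aeval_C]
  rfl

lemma LiftsTo.pow {g : ℕ} {f : homogeneousSubmodule (Fin 2) k (2 * g + 1)}
    {p : MvPolynomial (Fin 3) k} {m : ℕ} (hp : LiftsTo g f p m) (t : ℕ) :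
    LiftsTo g f (p ^ t) (t * m) := by
  induction t with
  | zero => simpa using LiftsTo.C g f 1
  | succ t ih => rw [pow_succ, add_mul, one_mul]; exact ih.mul hp

lemma LiftsTo.X (g : ℕ) (f : homogeneousSubmodule (Fin 2) k (2 * g + 1)) (i : Fin 3) :
    LiftsTo g f (MvPolynomial.X i) (hyperellipticWeight g i) :=
  ⟨⟨MvPolynomial.X i, isWeightedHomogeneous_X k _ i, rfl⟩, by rw [hyperellipticLift, aeval_X]⟩

lemma hyperellipticLift_apply (g : ℕ) (f : homogeneousSubmodule (Fin 2) k (2 * g + 1)) {n : ℕ}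
    {p : MvPolynomial (Fin 3) k} (hp : IsWeightedHomogeneous (hyperellipticWeight g) p n) :
    hyperellipticLift g f p = DirectSum.of (fun n => hyperellipticGrading g f n) n
      ⟨Ideal.Quotient.mkₐ k _ p, p, hp, rfl⟩ := by
  suffices h : LiftsTo g f p n from h.2
  induction hp using IsWeightedHomogeneous.induction_on with
  | zero =>
    refine ⟨by rw [map_zero]; exact zero_mem _, ?_⟩
    rw [map_zero, ← map_zero (DirectSum.of (fun n => hyperellipticGrading g f n) n)]
    exact congrArg _ (Subtype.ext (map_zero (Ideal.Quotient.mkₐ k _)).symm)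
  | add p q _ _ hp hq =>
    obtain ⟨hp, hp'⟩ := hp
    obtain ⟨hq, hq'⟩ := hq
    refine ⟨by rw [map_add]; exact add_mem hp hq, ?_⟩
    rw [map_add, hp', hq', ← map_add]
    exact congrArg _ (Subtype.ext (map_add _ p q).symm)
  | monomial d r hr =>
    have h := (LiftsTo.C g f r).mul (((LiftsTo.X g f 0).pow (d 0)).mul
      (((LiftsTo.X g f 1).pow (d 1)).mul ((LiftsTo.X g f 2).pow (d 2))))
    have hn : 0 + (d 0 * hyperellipticWeight g 0 + (d 1 * hyperellipticWeight g 1 +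
        d 2 * hyperellipticWeight g 2)) = n := by
      rw [← hr, Finsupp.weight_apply, Finsupp.sum_fintype _ _ (by simp), Fin.sum_univ_three]
      simp [add_assoc]
    have hm : monomial d r = MvPolynomial.C r * (MvPolynomial.X 0 ^ d 0 *
        (MvPolynomial.X 1 ^ d 1 * MvPolynomial.X 2 ^ d 2)) := by
      rw [monomial_eq, Finsupp.prod_fintype _ _ (by simp), Fin.prod_univ_three, mul_assoc]
    rw [hm, ← hn]
    exact h

instance hyperellipticGrading.gradedAlgebra (g : ℕ)
    (f : homogeneousSubmodule (Fin 2) k (2 * g + 1)) :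
    GradedAlgebra (hyperellipticGrading g f) :=
  GradedAlgebra.ofAlgHom _
    (Ideal.Quotient.liftₐ _ (hyperellipticLift g f) (by
      intro a ha
      obtain ⟨b, rfl⟩ := Ideal.mem_span_singleton.mp ha
      rw [map_mul, hyperellipticLift_apply g f (isWeightedHomogeneous_hyperellipticEquation g f)]
      have : (⟨Ideal.Quotient.mkₐ k _ (hyperellipticEquation f.1), hyperellipticEquation f.1,
          isWeightedHomogeneous_hyperellipticEquation g f, rfl⟩ :
          hyperellipticGrading g f (2 * (2 * g + 1))) = 0 :=
        Subtype.ext (Ideal.Quotient.eq_zero_iff_mem.mpr (Ideal.mem_span_singleton_self _))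
      rw [this, map_zero, zero_mul]))
    (by
      refine Ideal.Quotient.algHom_ext _ (MvPolynomial.algHom_ext fun i => ?_)
      change DirectSum.coeAlgHom _ (hyperellipticLift g f (X i)) = Ideal.Quotient.mkₐ k _ (X i)
      rw [hyperellipticLift_apply g f (isWeightedHomogeneous_X k _ i)]
      exact DirectSum.coeAlgHom_of _ _ _)
    (by
      rintro i ⟨_, p, hp, rfl⟩
      exact hyperellipticLift_apply g f hp)

end Hyperelliptic

end NearlyGor

end

/-! Write `S = R^{(d)}`. The ring `R` is free over `k[X, Y]` with basis `1, Z`, so its Hilbert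
function `h` is explicit, and it satisfies the symmetry `h(n) - h(a - n) = n + 1 - g` with `a = 2g -
2`. This numerical Riemann–Roch formula replaces geometry throughout.

For a homogeneous regular pair in `R`, the Koszul relation and this symmetry show that `s ↦ s /
(x₀x₁)ᵗ` has image of dimension `h(a - m)` in degree `m` of the top Čech cohomology, once `t` is
large. So nothing survives above degree `a`, something survives in degree `a`, and there is a
functional `φ` supported in degree `a`. The pairing `(r, s) ↦ φ(rs / (x₀x₁)ᵗ)` is nondegenerate in
`r` because the cohomology is divisible by nonzero homogeneous elements; comparing dimensions then
makes it perfect (`IsHomogeneousPair.exists_eq_residue`). Restricted to `S`, this identifies the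
canonical module with the elements of `R` whose degrees are congruent to `2g - 2` modulo `d`, for
every homogeneous system of parameters (`nonempty_canonicalModule_equiv`).

Every homomorphism from this module to `S` is multiplication by an element of `R` with degrees in
the opposite class (`IsHyperellipticCone.exists_eq_mul`). Hence the trace is generated by products
`m q` of homogeneous elements with `deg m ≡ 2g - 2` and `deg q ≡ -(2g - 2)`. It contains `1` only if
`d ∣ 2g - 2`. For the nearly Gorenstein property the question is which monomials `X^i Y^j` and `X^i
Y^j Z` of degree `dm` split in this way. The obstruction is that elements of degree below `2g + 1`
lie in `k[X, Y]`, so `X^i Z` needs a factor of degree at least `2g + 1`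
(`exists_of_isNearlyGorenstein`). Conversely, an even splitting degree leaving room for `Z`, or in a
few cases a splitting off of degree `1`, suffices (`isNearlyGorenstein_veronese_of_even`). What
remains is arithmetic in `g` and `d`. -/

noncomputable section

namespace NearlyGor

/-! ### Top Čech cohomology of two elements, via fractions -/

section Cech

variable {k S : Type*} [Field k] [CommRing S] [Algebra k S]

/-- The class of `s / (x₀ x₁)ᵗ` in the top Čech cohomology. -/
def frac (x : Fin 2 → S) (s : S) (t : ℕ) : TopLocalCohomology x :=
  (cechCoboundaries x).mkQ
    (IsLocalization.mk' (CechTop x) s (⟨(∏ i, x i) ^ t, t, rfl⟩ : Submonoid.powers (∏ i, x i)))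

lemma frac_eq_mkQ (x : Fin 2 → S) (s : S) (t : ℕ) (a : CechTop x)
    (h : (∏ i, x i) ^ t • a = algebraMap S (CechTop x) s) :
    (cechCoboundaries x).mkQ a = frac x s t := by
  rw [frac]
  congr 1
  rw [IsLocalization.eq_mk'_iff_mul_eq, ← h, Algebra.smul_def, mul_comm]

lemma pow_smul_mk' (x : Fin 2 → S) (s : S) (t : ℕ) :
    (∏ i, x i) ^ t • (IsLocalization.mk' (CechTop x) s
      (⟨(∏ i, x i) ^ t, t, rfl⟩ : Submonoid.powers (∏ i, x i))) = algebraMap S (CechTop x) s := by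
  rw [Algebra.smul_def, mul_comm]
  exact IsLocalization.mk'_spec _ s (⟨(∏ i, x i) ^ t, t, rfl⟩ : Submonoid.powers (∏ i, x i))

lemma exists_eq_frac (x : Fin 2 → S) (h : TopLocalCohomology x) : ∃ s t, h = frac x s t := by
  obtain ⟨a, rfl⟩ := Submodule.mkQ_surjective _ h
  obtain ⟨s, ⟨_, t, rfl⟩, rfl⟩ := IsLocalization.exists_mk'_eq (Submonoid.powers (∏ i, x i)) a
  exact ⟨s, t, rfl⟩

lemma frac_add (x : Fin 2 → S) (s s' : S) (t : ℕ) :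
    frac x (s + s') t = frac x s t + frac x s' t := by
  rw [← frac_eq_mkQ x (s + s') t (_ + _), map_add]
  · rfl
  · rw [smul_add, pow_smul_mk', pow_smul_mk', map_add]

lemma smul_frac (x : Fin 2 → S) (u s : S) (t : ℕ) : u • frac x s t = frac x (u * s) t := by
  rw [← frac_eq_mkQ x (u * s) t (u • _), map_smul]
  · rfl
  · rw [smul_comm, pow_smul_mk', map_mul, Algebra.smul_def]

lemma smul_frac' (x : Fin 2 → S) (u : k) (s : S) (t : ℕ) : u • frac x s t = frac x (u • s) t := by
  rw [← algebraMap_smul S u, smul_frac, Algebra.smul_def]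

lemma frac_raise (x : Fin 2 → S) (s : S) (t u : ℕ) :
    frac x s t = frac x ((x 0 * x 1) ^ u * s) (t + u) := by
  rw [frac]
  refine frac_eq_mkQ x _ _ _ ?_
  rw [add_comm, pow_add, mul_smul, pow_smul_mk', map_mul, Algebra.smul_def,
    ← Fin.prod_univ_two x]

lemma erase_prod (x : Fin 2 → S) :
    ∏ j ∈ Finset.univ.erase 0, x j = x 1 ∧ ∏ j ∈ Finset.univ.erase 1, x j = x 0 := by
  have h0 : (Finset.univ.erase 0 : Finset (Fin 2)) = {1} := by decide
  have h1 : (Finset.univ.erase 1 : Finset (Fin 2)) = {0} := by decide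
  simp [h0, h1]

lemma frac_zero_left (x : Fin 2 → S) (b : S) (t : ℕ) : frac x (x 0 ^ t * b) t = 0 := by
  rw [frac, Submodule.mkQ_apply, Submodule.Quotient.mk_eq_zero]
  refine Submodule.mem_iSup_of_mem 0 (Submodule.subset_span ⟨t, b, ?_⟩)
  rw [(erase_prod x).1, Algebra.smul_def, IsLocalization.mul_mk'_eq_mk'_of_mul]
  rw [IsLocalization.mk'_eq_iff_eq_mul, ← map_mul]
  congr 1
  change _ = b * (∏ i, x i) ^ t
  rw [Fin.prod_univ_two]
  ring

lemma frac_zero_right (x : Fin 2 → S) (b : S) (t : ℕ) : frac x (x 1 ^ t * b) t = 0 := by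
  rw [frac, Submodule.mkQ_apply, Submodule.Quotient.mk_eq_zero]
  refine Submodule.mem_iSup_of_mem 1 (Submodule.subset_span ⟨t, b, ?_⟩)
  rw [(erase_prod x).2, Algebra.smul_def, IsLocalization.mul_mk'_eq_mk'_of_mul]
  rw [IsLocalization.mk'_eq_iff_eq_mul, ← map_mul]
  congr 1
  change _ = b * (∏ i, x i) ^ t
  rw [Fin.prod_univ_two]
  ring

/-- Raising to a common exponent shows that the fractions with this property form a submodule; it
contains the image of each one-variable localization, hence all coboundaries. -/
lemma exists_of_mem_cechCoboundaries (x : Fin 2 → S) {a : CechTop x}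
    (ha : a ∈ cechCoboundaries x) : ∃ (T : ℕ) (b c : S),
      (x 0 * x 1) ^ T • a = algebraMap S (CechTop x) (x 0 ^ T * b + x 1 ^ T * c) := by
  let N : Submodule S (CechTop x) :=
    { carrier := {a | ∃ (T : ℕ) (b c : S),
        (x 0 * x 1) ^ T • a = algebraMap S (CechTop x) (x 0 ^ T * b + x 1 ^ T * c)}
      zero_mem' := ⟨0, 0, 0, by simp⟩
      add_mem' := by
        rintro a a' ⟨T, b, c, h⟩ ⟨T', b', c', h'⟩
        refine ⟨T + T', x 1 ^ T' * b + x 1 ^ T * b', x 0 ^ T' * c + x 0 ^ T * c', ?_⟩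
        have e : (x 0 * x 1) ^ (T + T') • (a + a') =
            (x 0 * x 1) ^ T' • ((x 0 * x 1) ^ T • a) +
            (x 0 * x 1) ^ T • ((x 0 * x 1) ^ T' • a') := by
          simp only [smul_add, ← mul_smul, ← pow_add]
          rw [add_comm T' T]
        rw [e, h, h', Algebra.smul_def, Algebra.smul_def, ← map_mul, ← map_mul, ← map_add]
        congr 1
        ring
      smul_mem' := by
        rintro r a ⟨T, b, c, h⟩
        refine ⟨T, r * b, r * c, ?_⟩
        rw [smul_comm, h, Algebra.smul_def, ← map_mul]
        congr 1
        ring }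
  have hle : cechCoboundaries x ≤ N := by
    refine iSup_le fun i => Submodule.span_le.mpr ?_
    rintro a ⟨t, s, h⟩
    fin_cases i
    · refine ⟨t, s, 0, ?_⟩
      have h' : x 1 ^ t • a = algebraMap S (CechTop x) s := by
        have := (erase_prod x).1
        simp only [Fin.zero_eta] at h
        rwa [this] at h
      rw [mul_pow, mul_smul, h', mul_zero, add_zero, map_mul, Algebra.smul_def]
    · refine ⟨t, 0, s, ?_⟩
      have h' : x 0 ^ t • a = algebraMap S (CechTop x) s := by
        have := (erase_prod x).2
        simp only [Fin.mk_one] at h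
        rwa [this] at h
      rw [mul_comm, mul_pow, mul_smul, h', mul_zero, zero_add, map_mul, Algebra.smul_def]
  exact hle ha

lemma exists_of_frac_eq_zero (x : Fin 2 → S) {s : S} {t : ℕ} (h : frac x s t = 0) :
    ∃ (u : ℕ) (b c : S), (x 0 * x 1) ^ u * s = x 0 ^ (t + u) * b + x 1 ^ (t + u) * c := by
  rw [frac, Submodule.mkQ_apply, Submodule.Quotient.mk_eq_zero] at h
  obtain ⟨T, b, c, h⟩ := exists_of_mem_cechCoboundaries x h
  have h2 := congrArg (fun z => (∏ i, x i) ^ t • z) h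
  rw [smul_comm, pow_smul_mk', Algebra.smul_def, Algebra.smul_def, ← map_mul, ← map_mul,
    IsLocalization.eq_iff_exists (Submonoid.powers (∏ i, x i))] at h2
  obtain ⟨⟨_, v, rfl⟩, h2⟩ := h2
  simp only [Fin.prod_univ_two] at h2
  refine ⟨T + v, x 1 ^ (t + v) * b, x 0 ^ (t + v) * c, ?_⟩
  calc _ = (x 0 * x 1) ^ v * ((x 0 * x 1) ^ T * s) := by ring
    _ = _ := h2
    _ = _ := by ring

/-- A compatible family of linear maps on numerators that kills the coboundaries. -/
structure IsTower {V : Type*} [AddCommGroup V] [Module k V] (x : Fin 2 → S)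
    (l : ℕ → S →ₗ[k] V) : Prop where
  raise : ∀ t s, l (t + 1) (x 0 * x 1 * s) = l t s
  left : ∀ t s, l t (x 0 ^ t * s) = 0
  right : ∀ t s, l t (x 1 ^ t * s) = 0

variable {V : Type*} [AddCommGroup V] [Module k V]

lemma IsTower.raise_pow {x : Fin 2 → S} {l : ℕ → S →ₗ[k] V} (hl : IsTower x l) (t u : ℕ) (s : S) :
    l (t + u) ((x 0 * x 1) ^ u * s) = l t s := by
  induction u with
  | zero => simp
  | succ u ih => rw [← ih, ← add_assoc, pow_succ', mul_assoc, hl.raise]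

lemma IsTower.eq_of_frac_eq {x : Fin 2 → S} {l : ℕ → S →ₗ[k] V} (hl : IsTower x l) {s s' : S}
    {t t' : ℕ} (h : frac x s t = frac x s' t') : l t s = l t' s' := by
  have key : frac x ((x 0 * x 1) ^ t' * s - (x 0 * x 1) ^ t * s') (t + t') = 0 := by
    have h2 := frac_add x ((x 0 * x 1) ^ t' * s - (x 0 * x 1) ^ t * s')
      ((x 0 * x 1) ^ t * s') (t + t')
    rw [sub_add_cancel, ← frac_raise, add_comm t t', ← frac_raise, h, add_comm t' t] at h2
    simpa using h2
  obtain ⟨u, b, c, e⟩ := exists_of_frac_eq_zero x key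
  have h3 := hl.raise_pow (t + t') u ((x 0 * x 1) ^ t' * s - (x 0 * x 1) ^ t * s')
  rw [e, map_add, hl.left, hl.right, add_zero, map_sub, hl.raise_pow, add_comm t t',
    hl.raise_pow] at h3
  exact (sub_eq_zero.mp h3.symm)

/-- The cohomology is the direct limit of the quotients `S / (x₀ᵗ, x₁ᵗ)` under multiplication by
`x₀x₁`. This is its universal property; all maps out of the cohomology are built with it. -/
theorem IsTower.exists_linearMap {x : Fin 2 → S} {l : ℕ → S →ₗ[k] V} (hl : IsTower x l) :
    ∃ φ : TopLocalCohomology x →ₗ[k] V, ∀ s t, φ (frac x s t) = l t s := by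
  choose sec lev hsec using exists_eq_frac x
  have hφ : ∀ s t, l (lev (frac x s t)) (sec (frac x s t)) = l t s :=
    fun s t => hl.eq_of_frac_eq (hsec _).symm
  refine ⟨{ toFun := fun h => l (lev h) (sec h), map_add' := ?_, map_smul' := ?_ }, hφ⟩
  · intro h h'
    obtain ⟨s, t, rfl⟩ := exists_eq_frac x h
    obtain ⟨s', t', rfl⟩ := exists_eq_frac x h'
    rw [hφ, hφ, frac_raise x s t t', frac_raise x s' t' t, add_comm t' t, ← frac_add, hφ,
      map_add, hl.raise_pow, add_comm t t', hl.raise_pow]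
  · intro c h
    obtain ⟨s, t, rfl⟩ := exists_eq_frac x h
    rw [smul_frac', hφ, hφ, map_smul, RingHom.id_apply]

lemma isTower_frac (x : Fin 2 → S) (φ : TopLocalCohomology x →ₗ[k] V) :
    ∃ l : ℕ → S →ₗ[k] V, IsTower x l ∧ ∀ s t, l t s = φ (frac x s t) := by
  refine ⟨fun t => φ ∘ₗ ⟨⟨fun s => frac x s t, fun s s' => frac_add x s s' t⟩,
    fun c s => (smul_frac' x c s t).symm⟩, ⟨fun t s => ?_, fun t s => ?_, fun t s => ?_⟩,
    fun _ _ => rfl⟩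
  · change φ (frac x _ _) = φ (frac x _ _)
    rw [frac_raise x s t 1, pow_one]
  · change φ (frac x _ _) = 0
    rw [frac_zero_left, map_zero]
  · change φ (frac x _ _) = 0
    rw [frac_zero_right, map_zero]

lemma frac_mem_grading (𝒜 : ℕ → Submodule k S) (x : Fin 2 → S) (e : Fin 2 → ℕ) {s : S} {l : ℕ}
    (hs : s ∈ 𝒜 l) {m : ℤ} {t : ℕ} (h : (l : ℤ) = m + t * (e 0 + e 1)) :
    frac x s t ∈ topLocalCohomologyGrading 𝒜 x e m :=
  Submodule.subset_span ⟨_, t, l, s, hs, pow_smul_mk' x s t, by rw [Fin.sum_univ_two, h], rfl⟩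

lemma grading_le (𝒜 : ℕ → Submodule k S) (x : Fin 2 → S) (e : Fin 2 → ℕ) (m : ℤ)
    (N : Submodule k (TopLocalCohomology x))
    (H : ∀ (s : S) (l t : ℕ), s ∈ 𝒜 l → (l : ℤ) = m + t * (e 0 + e 1) → frac x s t ∈ N) :
    topLocalCohomologyGrading 𝒜 x e m ≤ N := by
  refine Submodule.span_le.mpr ?_
  rintro _ ⟨a, t, l, s, hs, ha, hl, rfl⟩
  rw [frac_eq_mkQ x s t a ha]
  exact H s l t hs (by rw [hl, Fin.sum_univ_two])

end Cech

/-! ### Regular sequences of length two in a domain -/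

section RegularPairs

variable {R : Type*} [CommRing R]

/-- `v` is a nonzerodivisor modulo `u`. -/
def IsRegularPair (u v : R) : Prop := ∀ r, u ∣ v * r → u ∣ r

lemma IsRegularPair.symm [IsDomain R] {u v : R} (hu : u ≠ 0) (h : IsRegularPair u v) :
    IsRegularPair v u := by
  rintro r ⟨s, hs⟩
  obtain ⟨s', rfl⟩ := h s ⟨r, hs.symm⟩
  exact ⟨s', mul_left_cancel₀ hu (by rw [hs]; ring)⟩

lemma IsRegularPair.pow_right {u v : R} (h : IsRegularPair u v) (n : ℕ) :
    IsRegularPair u (v ^ n) := by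
  induction n with
  | zero => intro r hr; simpa using hr
  | succ n ih => intro r hr; exact ih r (h _ (by rwa [pow_succ', mul_assoc] at hr))

lemma IsRegularPair.mul_right {u v w : R} (h : IsRegularPair u v) (h' : IsRegularPair u w) :
    IsRegularPair u (v * w) := fun r hr => h' r (h _ (by rwa [mul_assoc] at hr))

lemma IsRegularPair.pow [IsDomain R] {u v : R} (hu : u ≠ 0) (hv : v ≠ 0) (h : IsRegularPair u v)
    (m n : ℕ) : IsRegularPair (u ^ m) (v ^ n) :=
  IsRegularPair.symm (pow_ne_zero n hv)
    (IsRegularPair.pow_right (IsRegularPair.symm hu (h.pow_right n)) m)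

/-- If `(u, v)` contains powers of a regular pair, then `u, v` is a regular pair. -/
lemma IsRegularPair.of_mem_span [IsDomain R] {u v p q : R} (hp : p ≠ 0) (hu : u ≠ 0)
    (h : IsRegularPair p q) (hpI : ∃ b c, p = u * b + v * c) (hqI : ∃ b c, q = u * b + v * c) :
    IsRegularPair u v := by
  rintro r ⟨s, hs⟩
  obtain ⟨b, c, hb⟩ := hpI
  obtain ⟨b', c', hb'⟩ := hqI
  have h1 : p * r = u * (b * r + c * s) := by rw [hb]; linear_combination c * hs
  have h2 : q * r = u * (b' * r + c' * s) := by rw [hb']; linear_combination c' * hs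
  -- Both sides are `p q r / u`. Regularity of `p, q` makes `p` divide `b r + c s`, which is `p r /
  -- u`; so `u` divides `r`.
  have h3 : p * (b' * r + c' * s) = q * (b * r + c * s) :=
    mul_left_cancel₀ hu (by linear_combination q * h1 - p * h2)
  obtain ⟨w, hw⟩ := h _ ⟨_, h3.symm⟩
  exact ⟨w, mul_left_cancel₀ hp (by rw [h1, hw]; ring)⟩

end RegularPairs

/-! ### Homogeneous components in integer degrees and dimension counts -/

section IntGrading

variable {k R : Type*} [Field k] [CommRing R] [Algebra k R]
variable (𝒜 : ℕ → Submodule k R)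

/-- The grading extended by zero to negative degrees. -/
def gr (n : ℤ) : Submodule k R := if 0 ≤ n then 𝒜 n.toNat else ⊥

@[simp] lemma gr_natCast (n : ℕ) : gr 𝒜 n = 𝒜 n := by simp [gr]

lemma gr_of_neg {n : ℤ} (hn : n < 0) : gr 𝒜 n = ⊥ := by simp [gr, hn]

lemma gr_induction {P : ℤ → R → Prop} (h0 : ∀ n, P n 0) (h : ∀ (n : ℕ) r, r ∈ 𝒜 n → P n r)
    {n : ℤ} {r : R} (hr : r ∈ gr 𝒜 n) : P n r := by
  rcases lt_or_ge n 0 with hn | hn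
  · rw [gr_of_neg 𝒜 hn, Submodule.mem_bot] at hr
    exact hr ▸ h0 n
  · lift n to ℕ using hn
    exact h n r (by simpa using hr)

variable [GradedAlgebra 𝒜]

lemma gr_mul {i j : ℤ} {a b : R} (ha : a ∈ gr 𝒜 i) (hb : b ∈ gr 𝒜 j) : a * b ∈ gr 𝒜 (i + j) := by
  refine gr_induction 𝒜 (P := fun i a => a * b ∈ gr 𝒜 (i + j)) (by simp) (fun i a ha => ?_) ha
  refine gr_induction 𝒜 (P := fun j b => a * b ∈ gr 𝒜 (i + j)) (by simp) (fun j b hb => ?_) hb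
  rw [← Nat.cast_add, gr_natCast]
  exact SetLike.mul_mem_graded ha hb

lemma gr_pow {i : ℕ} {a : R} (ha : a ∈ 𝒜 i) (t : ℕ) : a ^ t ∈ gr 𝒜 (t * i) := by
  have := SetLike.pow_mem_graded t ha
  rw [← Nat.cast_mul, gr_natCast]
  simpa using this

/-- The homogeneous component of degree `n ∈ ℤ`. -/
def cmp (n : ℤ) : R →ₗ[k] R :=
  if 0 ≤ n then
    (𝒜 n.toNat).subtype ∘ₗ DirectSum.component k ℕ (fun i => 𝒜 i) n.toNat ∘ₗ
      (DirectSum.decomposeLinearEquiv 𝒜).toLinearMap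
  else 0

lemma cmp_natCast (n : ℕ) (r : R) : cmp 𝒜 n r = DirectSum.decompose 𝒜 r n := by
  simp [cmp]; rfl

lemma cmp_of_neg {n : ℤ} (hn : n < 0) (r : R) : cmp 𝒜 n r = 0 := by
  rw [cmp, if_neg (by omega), LinearMap.zero_apply]

lemma cmp_mem (n : ℤ) (r : R) : cmp 𝒜 n r ∈ gr 𝒜 n := by
  rcases lt_or_ge n 0 with hn | hn
  · rw [cmp_of_neg 𝒜 hn]; exact zero_mem _
  · lift n to ℕ using hn
    rw [cmp_natCast, gr_natCast]; exact SetLike.coe_mem _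

lemma cmp_of_mem {n : ℤ} {r : R} (hr : r ∈ gr 𝒜 n) : cmp 𝒜 n r = r := by
  refine gr_induction 𝒜 (P := fun n r => cmp 𝒜 n r = r) (by simp) (fun n r hr => ?_) hr
  rw [cmp_natCast, DirectSum.decompose_of_mem_same _ hr]

lemma cmp_of_mem_ne {n m : ℤ} {r : R} (hr : r ∈ gr 𝒜 n) (h : m ≠ n) : cmp 𝒜 m r = 0 := by
  revert h
  refine gr_induction 𝒜 (P := fun n r => m ≠ n → cmp 𝒜 m r = 0) (by simp) (fun n r hr h => ?_) hr
  rcases lt_or_ge m 0 with hm | hm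
  · exact cmp_of_neg 𝒜 hm r
  · lift m to ℕ using hm
    rw [cmp_natCast, DirectSum.decompose_of_mem_ne _ hr]
    exact fun h' => h (by rw [h'])

lemma cmp_mul {i : ℤ} {u : R} (hu : u ∈ gr 𝒜 i) (n : ℤ) (r : R) :
    cmp 𝒜 (i + n) (u * r) = u * cmp 𝒜 n r := by
  induction r using DirectSum.Decomposition.inductionOn 𝒜 with
  | zero => simp
  | @homogeneous j r =>
    have hr : (r : R) ∈ gr 𝒜 j := by rw [gr_natCast]; exact r.2
    by_cases h : n = j
    · subst h
      rw [cmp_of_mem 𝒜 hr, cmp_of_mem 𝒜 (gr_mul 𝒜 hu hr)]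
    · rw [cmp_of_mem_ne 𝒜 hr h, cmp_of_mem_ne 𝒜 (gr_mul 𝒜 hu hr) (by omega), mul_zero]
  | add a b ha hb => rw [mul_add, map_add, ha, hb, map_add, mul_add]

lemma sum_cmp (r : R) : ∃ s : Finset ℕ, r = ∑ n ∈ s, cmp 𝒜 n r := by
  classical
  refine ⟨(DirectSum.decompose 𝒜 r).support, ?_⟩
  conv_lhs => rw [← DirectSum.sum_support_decompose 𝒜 r]
  exact Finset.sum_congr rfl fun n _ => (cmp_natCast 𝒜 n r).symm

lemma eq_zero_of_cmp {r : R} (h : ∀ n, cmp 𝒜 n r = 0) : r = 0 := by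
  obtain ⟨s, hs⟩ := sum_cmp 𝒜 r
  rw [hs]
  exact Finset.sum_eq_zero fun n _ => h n

lemma mem_gr_of_cmp {r : R} {n : ℤ} (h : ∀ m, m ≠ n → cmp 𝒜 m r = 0) : r ∈ gr 𝒜 n := by
  have : r = cmp 𝒜 n r := by
    refine sub_eq_zero.mp (eq_zero_of_cmp 𝒜 fun m => ?_)
    rw [map_sub]
    by_cases hm : m = n
    · subst hm; rw [cmp_of_mem 𝒜 (cmp_mem 𝒜 m r), sub_self]
    · rw [h m hm, cmp_of_mem_ne 𝒜 (cmp_mem 𝒜 n r) hm, sub_self]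
  rw [this]; exact cmp_mem 𝒜 n r

lemma mem_gr_of_mul_mem [IsDomain R] {u r : R} {i n : ℤ} (hu0 : u ≠ 0) (hu : u ∈ gr 𝒜 i)
    (h : u * r ∈ gr 𝒜 (i + n)) : r ∈ gr 𝒜 n := by
  refine mem_gr_of_cmp 𝒜 fun m hm => ?_
  have := cmp_mul 𝒜 hu m r
  rw [cmp_of_mem_ne 𝒜 h (by omega)] at this
  exact (mul_eq_zero.mp this.symm).resolve_left hu0

/-- A homogeneous element of an ideal generated by two homogeneous elements has homogeneous
coefficients. -/
lemma exists_homogeneous_coeff {z u v b c : R} {n i j : ℤ} (hz : z ∈ gr 𝒜 n) (hu : u ∈ gr 𝒜 i)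
    (hv : v ∈ gr 𝒜 j) (h : z = u * b + v * c) :
    z = u * cmp 𝒜 (n - i) b + v * cmp 𝒜 (n - j) c := by
  rw [← cmp_mul 𝒜 hu, ← cmp_mul 𝒜 hv, add_sub_cancel, add_sub_cancel, ← map_add, ← h,
    cmp_of_mem 𝒜 hz]

/-- The degree `m + p + q` part of the ideal `(u, v)`, where `u`, `v` have degrees `p`, `q`. -/
def idealPart (u v : R) (p q m : ℤ) : Submodule k R :=
  (gr 𝒜 (m + q)).map (LinearMap.mulLeft k u) ⊔ (gr 𝒜 (m + p)).map (LinearMap.mulLeft k v)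

lemma mem_idealPart {u v : R} {p q m : ℤ} {z : R} :
    z ∈ idealPart 𝒜 u v p q m ↔
      ∃ b ∈ gr 𝒜 (m + q), ∃ c ∈ gr 𝒜 (m + p), u * b + v * c = z := by
  simp [idealPart, Submodule.mem_sup]

lemma idealPart_le {u v : R} {p q : ℤ} (m : ℤ) (hu : u ∈ gr 𝒜 p) (hv : v ∈ gr 𝒜 q) :
    idealPart 𝒜 u v p q m ≤ gr 𝒜 (m + p + q) := by
  intro z hz
  obtain ⟨b, hb, c, hc, rfl⟩ := (mem_idealPart 𝒜).mp hz
  refine add_mem ?_ ?_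
  · convert gr_mul 𝒜 hu hb using 1; ring_nf
  · convert gr_mul 𝒜 hv hc using 1; ring_nf

/-- Cohen-Macaulay domains with symmetric Hilbert function: `h(n) - h(a - n) = n + χ`. -/
structure HasRiemannRoch (a χ : ℤ) : Prop where
  finite : ∀ n, Module.Finite k (𝒜 n)
  riemannRoch : ∀ n : ℤ, (Module.finrank k (gr 𝒜 n) : ℤ) - Module.finrank k (gr 𝒜 (a - n)) = n + χ
  finrank_zero : Module.finrank k (𝒜 0) = 1

variable {𝒜} {a χ : ℤ}

lemma HasRiemannRoch.finite_gr (H : HasRiemannRoch 𝒜 a χ) (n : ℤ) : Module.Finite k (gr 𝒜 n) := by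
  have := H.finite
  rcases lt_or_ge n 0 with hn | hn
  · rw [gr_of_neg 𝒜 hn]; infer_instance
  · lift n to ℕ using hn
    rw [gr_natCast]; infer_instance

lemma HasRiemannRoch.finrank_of_lt (H : HasRiemannRoch 𝒜 a χ) {n : ℤ} (hn : a < n) :
    (Module.finrank k (gr 𝒜 n) : ℤ) = n + χ := by
  have := H.riemannRoch n
  rw [gr_of_neg 𝒜 (show a - n < 0 by omega), finrank_bot] at this
  simpa using this

lemma finrank_map_mulLeft [IsDomain R] {u : R} (hu : u ≠ 0) (N : Submodule k R) :
    Module.finrank k (N.map (LinearMap.mulLeft k u)) = Module.finrank k N :=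
  (Submodule.equivMapOfInjective _ (mul_right_injective₀ hu) N).finrank_eq.symm

/-- Exactness of the Koszul complex in the form `uR ∩ vR = uvR`, combined with the dimension formula
for a sum of subspaces. -/
lemma finrank_idealPart [IsDomain R] (H : HasRiemannRoch 𝒜 a χ) {u v : R} {p q : ℤ} (m : ℤ)
    (hu0 : u ≠ 0) (hv0 : v ≠ 0) (hu : u ∈ gr 𝒜 p) (hv : v ∈ gr 𝒜 q) (h : IsRegularPair u v) :
    Module.finrank k (idealPart 𝒜 u v p q m) + Module.finrank k (gr 𝒜 m) =
      Module.finrank k (gr 𝒜 (m + q)) + Module.finrank k (gr 𝒜 (m + p)) := by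
  have := H.finite_gr
  have hinf : (gr 𝒜 (m + q)).map (LinearMap.mulLeft k u) ⊓
      (gr 𝒜 (m + p)).map (LinearMap.mulLeft k v) = (gr 𝒜 m).map (LinearMap.mulLeft k (u * v)) := by
    ext z
    simp only [Submodule.mem_inf, Submodule.mem_map, LinearMap.mulLeft_apply]
    constructor
    · rintro ⟨⟨b, hb, rfl⟩, c, hc, e⟩
      obtain ⟨r, rfl⟩ := h c ⟨b, e⟩
      refine ⟨r, mem_gr_of_mul_mem 𝒜 hu0 hu (by rwa [add_comm]), ?_⟩
      rw [← e]; ring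
    · rintro ⟨r, hr, rfl⟩
      refine ⟨⟨v * r, ?_, by ring⟩, u * r, ?_, by ring⟩
      · rw [add_comm]; exact gr_mul 𝒜 hv hr
      · rw [add_comm]; exact gr_mul 𝒜 hu hr
  have h2 := Submodule.finrank_sup_add_finrank_inf_eq
    ((gr 𝒜 (m + q)).map (LinearMap.mulLeft k u)) ((gr 𝒜 (m + p)).map (LinearMap.mulLeft k v))
  rwa [hinf, finrank_map_mulLeft (mul_ne_zero hu0 hv0), finrank_map_mulLeft hu0,
    finrank_map_mulLeft hv0] at h2

/-- For `p`, `q` large, the degree `m + p + q` part of `R / (u, v)` has dimension `h(a - m)`. -/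
lemma finrank_gr_eq [IsDomain R] (H : HasRiemannRoch 𝒜 a χ) {u v : R} {p q m : ℤ}
    (hu0 : u ≠ 0) (hv0 : v ≠ 0) (hu : u ∈ gr 𝒜 p) (hv : v ∈ gr 𝒜 q) (h : IsRegularPair u v)
    (hp : a < m + p) (hq : a < m + q) (hpq : a < m + p + q) :
    Module.finrank k (gr 𝒜 (m + p + q)) =
      Module.finrank k (idealPart 𝒜 u v p q m) + Module.finrank k (gr 𝒜 (a - m)) := by
  have h1 := finrank_idealPart H m hu0 hv0 hu hv h
  have h2 := H.riemannRoch m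
  have h3 := H.finrank_of_lt hp
  have h4 := H.finrank_of_lt hq
  -- In the large degrees `h` is linear, so the four equations give `h(m + p + q) - (h(m + p) + h(m
  -- + q) - h(m)) = h(m) - m - χ`, which is `h(a - m)`.
  have h5 := H.finrank_of_lt hpq
  zify at h1 ⊢
  omega

end IntGrading

/-! ### Fractions with independent exponents and divisibility of the cohomology -/

section LinearFractions

variable {k R : Type*} [Field k] [CommRing R] [Algebra k R]

/-- The linear map `s ↦ s / (x₀ x₁)ᵗ` to the top Čech cohomology. -/
def fracₗ (k : Type*) {R : Type*} [Field k] [CommRing R] [Algebra k R] (x : Fin 2 → R) (t : ℕ) :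
    R →ₗ[k] TopLocalCohomology x :=
  ⟨⟨fun s => frac x s t, fun s s' => frac_add x s s' t⟩, fun c s => (smul_frac' x c s t).symm⟩

@[simp] lemma fracₗ_apply (x : Fin 2 → R) (t : ℕ) (s : R) : fracₗ k x t s = frac x s t := rfl

/-- The class of `s / (x₀ⁱ x₁ʲ)`. -/
def frac₂ (x : Fin 2 → R) (s : R) (i j : ℕ) : TopLocalCohomology x :=
  frac x (s * x 0 ^ j * x 1 ^ i) (i + j)

lemma smul_frac₂ (x : Fin 2 → R) (u s : R) (i j : ℕ) :
    u • frac₂ x s i j = frac₂ x (u * s) i j := by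
  rw [frac₂, frac₂, smul_frac]; congr 1; ring

lemma frac₂_cancel_left (x : Fin 2 → R) (s : R) (i j n : ℕ) :
    frac₂ x (x 0 ^ n * s) (i + n) j = frac₂ x s i j := by
  rw [frac₂, frac₂, frac_raise x _ (i + j) n]
  congr 1 <;> ring

lemma frac₂_cancel_right (x : Fin 2 → R) (s : R) (i j n : ℕ) :
    frac₂ x (x 1 ^ n * s) i (j + n) = frac₂ x s i j := by
  rw [frac₂, frac₂, frac_raise x _ (i + j) n]
  congr 1 <;> ring

lemma frac₂_zero_right (x : Fin 2 → R) (s : R) (i : ℕ) : frac₂ x s i 0 = 0 := by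
  rw [frac₂, add_zero, mul_comm]; exact frac_zero_right x _ i

lemma frac_eq_frac₂ (x : Fin 2 → R) (s : R) (t : ℕ) : frac x s t = frac₂ x s t t := by
  rw [frac₂, frac_raise x s t t]; congr 1; ring

/-- The top Čech cohomology is divisible by nonzero homogeneous polynomials in powers of the
parameters. -/
lemma exists_smul_eq_of_polynomial (x : Fin 2 → R) (A B n : ℕ) (hB : 0 < B) (c : ℕ → k)
    (hc : ∃ l ≤ n, c l ≠ 0) (h : TopLocalCohomology x) :
    ∃ h' : TopLocalCohomology x, (∑ l ∈ Finset.range (n + 1),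
      c l • (x 0 ^ (A * l) * x 1 ^ (B * (n - l)))) • h' = h := by
  classical
  set q := ∑ l ∈ Finset.range (n + 1), c l • (x 0 ^ (A * l) * x 1 ^ (B * (n - l))) with hq
  let Q : Submodule R (TopLocalCohomology x) :=
    LinearMap.range (LinearMap.lsmul R (TopLocalCohomology x) q)
  suffices H : ∀ h, h ∈ Q from H h
  have hkQ : ∀ (b : k) z, z ∈ Q → b • z ∈ Q := fun b z hz => by
    rw [← algebraMap_smul R b]; exact Q.smul_mem _ hz
  obtain ⟨L, ⟨hLn, hL⟩, hmax⟩ : ∃ L, (L ≤ n ∧ c L ≠ 0) ∧ ∀ l, L < l → l ≤ n → c l = 0 := by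
    obtain ⟨l, hl, hcl⟩ := hc
    refine ⟨Nat.findGreatest (fun l => c l ≠ 0) n, ⟨Nat.findGreatest_le n,
      Nat.findGreatest_spec (P := fun l => c l ≠ 0) hl hcl⟩, fun l h1 h2 => ?_⟩
    by_contra h3
    exact Nat.findGreatest_is_greatest h1 h2 h3
  have key : ∀ j i s, frac₂ x s i (B * j) ∈ Q := by
    intro j
    induction j using Nat.strong_induction_on with
    | _ j ih =>
    intro i s
    -- The denominator is chosen so that the `L`-th term is exactly `c L` times the target. A term
    -- with `l < L` has `x₁`-exponent `B (j - (L - l))`, covered by induction, or has no `x₁` left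
    -- in its denominator and vanishes.
    have e : q • frac₂ x s (i + A * L) (B * j + B * (n - L)) = ∑ l ∈ Finset.range (n + 1),
        c l • frac₂ x (x 0 ^ (A * l) * (x 1 ^ (B * (n - l)) * s)) (i + A * L)
          (B * j + B * (n - L)) := by
      rw [hq, Finset.sum_smul]
      refine Finset.sum_congr rfl fun l _ => ?_
      rw [smul_assoc, smul_frac₂, mul_assoc]
    rw [← Finset.add_sum_erase _ _ (Finset.mem_range.mpr (Nat.lt_succ_of_le hLn)),
      frac₂_cancel_left, frac₂_cancel_right] at e
    have hmem : c L • frac₂ x s i (B * j) ∈ Q := by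
      rw [eq_sub_of_add_eq e.symm]
      refine Q.sub_mem ⟨_, rfl⟩ (Q.sum_mem fun l hl => ?_)
      rw [Finset.mem_erase, Finset.mem_range] at hl
      rcases lt_or_gt_of_ne hl.1 with h1 | h1
      · refine hkQ _ _ ?_
        obtain ⟨δ, rfl⟩ := Nat.exists_eq_add_of_lt h1
        have e1 : i + A * (l + δ + 1) = i + A * (δ + 1) + A * l := by ring
        have e2 : n - l = n - (l + δ + 1) + (δ + 1) := by omega
        rw [e1, frac₂_cancel_left]
        rcases lt_or_ge j (δ + 1) with h2 | h2
        · have e3 : x 1 ^ (B * (n - l)) * s =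
              x 1 ^ (B * j + B * (n - (l + δ + 1))) * (x 1 ^ (B * (δ + 1 - j)) * s) := by
            rw [← mul_assoc, ← pow_add, ← mul_add, ← mul_add, e2]
            congr 3
            omega
          have e4 := frac₂_cancel_right x (x 1 ^ (B * (δ + 1 - j)) * s) (i + A * (δ + 1)) 0
            (B * j + B * (n - (l + δ + 1)))
          rw [zero_add] at e4
          rw [e3, e4, frac₂_zero_right]
          exact Q.zero_mem
        · have e3 : B * j + B * (n - (l + δ + 1)) = B * (j - (δ + 1)) + B * (n - l) := by
            rw [← mul_add, ← mul_add, e2]; congr 1; omega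
          rw [e3, frac₂_cancel_right]
          exact ih _ (by omega) _ _
      · rw [hmax l h1 (by omega), zero_smul]
        exact Q.zero_mem
    have := hkQ (c L)⁻¹ _ hmem
    rwa [smul_smul, inv_mul_cancel₀ hL, one_smul] at this
  intro h
  obtain ⟨s, t, rfl⟩ := exists_eq_frac x h
  have e1 : B * t = t + (B - 1) * t := by
    obtain ⟨B', rfl⟩ := Nat.exists_eq_succ_of_ne_zero hB.ne'
    simp; ring
  have := key t t (x 1 ^ ((B - 1) * t) * s)
  rwa [e1, frac₂_cancel_right, ← frac_eq_frac₂] at this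

end LinearFractions

/-! ### Graded local duality for a homogeneous regular pair -/

section Duality

variable {k R : Type*} [Field k] [CommRing R] [IsDomain R] [Algebra k R]
variable {𝒜 : ℕ → Submodule k R} [GradedAlgebra 𝒜]

variable (𝒜) in
/-- Two homogeneous elements of positive degrees that form a regular sequence. -/
structure IsHomogeneousPair (x : Fin 2 → R) (e : Fin 2 → ℕ) : Prop where
  mem : ∀ i, x i ∈ 𝒜 (e i)
  pos : ∀ i, 0 < e i
  ne_zero : ∀ i, x i ≠ 0
  regular : IsRegularPair (x 0) (x 1)

variable {x : Fin 2 → R} {e : Fin 2 → ℕ} {a χ : ℤ}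

/-- In general `s` must first be multiplied by a power of `x₀x₁`; for a regular pair this power
cancels, so the maps of the direct system `R / (x₀ᵗ, x₁ᵗ)` are injective. -/
lemma IsHomogeneousPair.frac_eq_zero_iff (P : IsHomogeneousPair 𝒜 x e) {s : R} {t : ℕ} :
    frac x s t = 0 ↔ ∃ b c, s = x 0 ^ t * b + x 1 ^ t * c := by
  constructor
  · intro h
    obtain ⟨u, b, c, h⟩ := exists_of_frac_eq_zero x h
    have h0 : x 0 ^ u ≠ 0 := pow_ne_zero u (P.ne_zero 0)
    have h1 : x 1 ^ u ≠ 0 := pow_ne_zero u (P.ne_zero 1)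
    obtain ⟨c', rfl⟩ := (P.regular.pow (P.ne_zero 0) (P.ne_zero 1) u (t + u)) c
      ⟨x 1 ^ u * s - x 0 ^ t * b, by rw [mul_sub, ← mul_assoc, ← mul_pow, h]; ring⟩
    have h2 : x 1 ^ u * s = x 0 ^ t * b + x 1 ^ (t + u) * c' :=
      mul_left_cancel₀ h0 (by rw [← mul_assoc, ← mul_pow, h]; ring)
    obtain ⟨b', rfl⟩ := ((P.regular.symm (P.ne_zero 0)).pow (P.ne_zero 1) (P.ne_zero 0) u t) b
      ⟨s - x 1 ^ t * c', by rw [mul_sub, h2]; ring⟩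
    exact ⟨b', c', mul_left_cancel₀ h1 (by rw [h2]; ring)⟩
  · rintro ⟨b, c, rfl⟩
    rw [frac_add, frac_zero_left, frac_zero_right, add_zero]

/-- The degree `m + t (e₀ + e₁)` part of the ideal `(x₀ᵗ, x₁ᵗ)`. -/
abbrev levelPart (𝒜 : ℕ → Submodule k R) (x : Fin 2 → R) (e : Fin 2 → ℕ) (m : ℤ) (t : ℕ) :
    Submodule k R :=
  idealPart 𝒜 (x 0 ^ t) (x 1 ^ t) (t * e 0) (t * e 1) m

lemma IsHomogeneousPair.levelPart_le (P : IsHomogeneousPair 𝒜 x e) (m : ℤ) (t : ℕ) :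
    levelPart 𝒜 x e m t ≤ gr 𝒜 (m + t * (e 0 + e 1)) := by
  have := idealPart_le 𝒜 m (gr_pow 𝒜 (P.mem 0) t) (gr_pow 𝒜 (P.mem 1) t)
  rwa [add_assoc, ← mul_add] at this

lemma IsHomogeneousPair.frac_eq_zero_iff_mem (P : IsHomogeneousPair 𝒜 x e) {s : R} {t : ℕ} {m : ℤ}
    (hs : s ∈ gr 𝒜 (m + t * (e 0 + e 1))) : frac x s t = 0 ↔ s ∈ levelPart 𝒜 x e m t := by
  rw [P.frac_eq_zero_iff, mem_idealPart]
  constructor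
  · rintro ⟨b, c, h⟩
    refine ⟨_, ?_, _, ?_, (exists_homogeneous_coeff 𝒜 hs (gr_pow 𝒜 (P.mem 0) t)
      (gr_pow 𝒜 (P.mem 1) t) h).symm⟩
    · convert cmp_mem 𝒜 _ _ using 2; ring_nf
    · convert cmp_mem 𝒜 _ _ using 2; ring_nf
  · rintro ⟨b, -, c, -, h⟩
    exact ⟨b, c, h.symm⟩

lemma IsHomogeneousPair.finrank_gr_eq (P : IsHomogeneousPair 𝒜 x e) (H : HasRiemannRoch 𝒜 a χ)
    (m : ℤ) : ∃ T : ℕ, ∀ t ≥ T, Module.finrank k (gr 𝒜 (m + t * (e 0 + e 1))) =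
      Module.finrank k (levelPart 𝒜 x e m t) + Module.finrank k (gr 𝒜 (a - m)) := by
  refine ⟨(a - m).natAbs + 1, fun t ht => ?_⟩
  have h0 : (1 : ℤ) ≤ e 0 := by exact_mod_cast P.pos 0
  have h1 : (1 : ℤ) ≤ e 1 := by exact_mod_cast P.pos 1
  have ht' : (a - m) < t := by omega
  have hp : (t : ℤ) ≤ t * e 0 := le_mul_of_one_le_right (by positivity) h0
  have hq : (t : ℤ) ≤ t * e 1 := le_mul_of_one_le_right (by positivity) h1
  have := NearlyGor.finrank_gr_eq H (m := m) (pow_ne_zero t (P.ne_zero 0))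
    (pow_ne_zero t (P.ne_zero 1)) (gr_pow 𝒜 (P.mem 0) t) (gr_pow 𝒜 (P.mem 1) t)
    (P.regular.pow (P.ne_zero 0) (P.ne_zero 1) t t) (by omega) (by omega) (by omega)
  rwa [add_assoc, ← mul_add] at this

lemma IsHomogeneousPair.raise_mem (P : IsHomogeneousPair 𝒜 x e) {m : ℤ} {t : ℕ} (u : ℕ) {s : R}
    (hs : s ∈ gr 𝒜 (m + t * (e 0 + e 1))) :
    (x 0 * x 1) ^ u * s ∈ gr 𝒜 (m + (t + u : ℕ) * (e 0 + e 1)) := by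
  have := gr_mul 𝒜 (gr_mul 𝒜 (gr_pow 𝒜 (P.mem 0) u) (gr_pow 𝒜 (P.mem 1) u)) hs
  rw [← mul_pow] at this
  convert this using 2
  push_cast; ring

lemma IsHomogeneousPair.frac_eq_zero_of_lt (P : IsHomogeneousPair 𝒜 x e)
    (H : HasRiemannRoch 𝒜 a χ) {m : ℤ} (hm : a < m) {s : R} {t : ℕ}
    (hs : s ∈ gr 𝒜 (m + t * (e 0 + e 1))) : frac x s t = 0 := by
  have := H.finite_gr
  obtain ⟨T, hT⟩ := P.finrank_gr_eq H m
  have h1 := hT (t + T) (by omega)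
  rw [gr_of_neg 𝒜 (show a - m < 0 by omega), finrank_bot, add_zero] at h1
  have h2 := Submodule.eq_of_le_of_finrank_eq (P.levelPart_le m (t + T)) h1.symm
  rw [frac_raise x s t T, P.frac_eq_zero_iff_mem (P.raise_mem T hs), h2]
  exact P.raise_mem T hs

lemma IsHomogeneousPair.exists_frac_ne_zero (P : IsHomogeneousPair 𝒜 x e)
    (H : HasRiemannRoch 𝒜 a χ) :
    ∃ (t : ℕ) (s : R), s ∈ gr 𝒜 (a + t * (e 0 + e 1)) ∧ frac x s t ≠ 0 := by
  obtain ⟨T, hT⟩ := P.finrank_gr_eq H a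
  have h1 := hT T le_rfl
  rw [sub_self, ← Nat.cast_zero, gr_natCast, H.finrank_zero] at h1
  by_contra! h
  have : gr 𝒜 (a + T * (e 0 + e 1)) ≤ levelPart 𝒜 x e a T := fun s hs =>
    (P.frac_eq_zero_iff_mem hs).mp (h T s hs)
  rw [le_antisymm this (P.levelPart_le a T)] at h1
  omega

/-- A residue functional: a nonzero functional supported in the top degree `a`. -/
lemma IsHomogeneousPair.exists_residue (P : IsHomogeneousPair 𝒜 x e) (H : HasRiemannRoch 𝒜 a χ) :
    ∃ φ : TopLocalCohomology x →ₗ[k] k, (∃ σ, φ σ ≠ 0) ∧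
      ∀ (n : ℤ) (t : ℕ) s, s ∈ gr 𝒜 n → n ≠ a + t * (e 0 + e 1) → φ (frac x s t) = 0 := by
  -- This tower takes values in the cohomology itself and descends to the projection onto its degree
  -- `a` part. Composing with any functional that is nonzero on some class of degree `a` gives a
  -- residue.
  have htow : IsTower x fun t => fracₗ k x t ∘ₗ cmp 𝒜 (a + t * (e 0 + e 1)) := by
    refine ⟨fun t s => ?_, fun t s => ?_, fun t s => ?_⟩
    · have h := gr_mul 𝒜 (gr_pow 𝒜 (P.mem 0) 1) (gr_pow 𝒜 (P.mem 1) 1)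
      have e1 : a + ((t + 1 : ℕ) : ℤ) * (e 0 + e 1) =
        (((1 : ℕ) : ℤ) * e 0 + ((1 : ℕ) : ℤ) * e 1) + (a + t * (e 0 + e 1)) := by push_cast; ring
      rw [LinearMap.comp_apply, LinearMap.comp_apply, e1, ← pow_one (x 0), ← pow_one (x 1),
        cmp_mul 𝒜 h, fracₗ_apply, fracₗ_apply, frac_raise x _ t 1, mul_pow]
    · have e1 : a + (t : ℤ) * (e 0 + e 1) = t * e 0 + (a + t * e 1) := by ring
      rw [LinearMap.comp_apply, e1, cmp_mul 𝒜 (gr_pow 𝒜 (P.mem 0) t), fracₗ_apply, frac_zero_left]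
    · have e1 : a + (t : ℤ) * (e 0 + e 1) = t * e 1 + (a + t * e 0) := by ring
      rw [LinearMap.comp_apply, e1, cmp_mul 𝒜 (gr_pow 𝒜 (P.mem 1) t), fracₗ_apply, frac_zero_right]
  obtain ⟨π, hπ⟩ := htow.exists_linearMap
  obtain ⟨t, s, hs, hne⟩ := P.exists_frac_ne_zero H
  obtain ⟨ψ, hψ⟩ : ∃ ψ : Module.Dual k (TopLocalCohomology x), ψ (frac x s t) ≠ 0 := by
    by_contra! h
    exact hne ((Module.forall_dual_apply_eq_zero_iff k _).mp h)
  refine ⟨ψ ∘ₗ π, ⟨frac x s t, ?_⟩, fun n t s hs hn => ?_⟩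
  · rw [LinearMap.comp_apply, hπ, LinearMap.comp_apply, cmp_of_mem 𝒜 hs]
    exact hψ
  · rw [LinearMap.comp_apply, hπ, LinearMap.comp_apply, cmp_of_mem_ne 𝒜 hs hn.symm, map_zero,
      map_zero]

/-- A nonzero homogeneous element divides a nonzero polynomial in the parameters. -/
lemma IsHomogeneousPair.exists_polynomial_mul (P : IsHomogeneousPair 𝒜 x e)
    (H : HasRiemannRoch 𝒜 a χ) {n : ℕ} {r : R} (hr : r ∈ 𝒜 n) (hr0 : r ≠ 0) :
    ∃ (N : ℕ) (c : ℕ → k) (r' : R), (∃ l ≤ N, c l ≠ 0) ∧ ∑ l ∈ Finset.range (N + 1),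
      c l • (x 0 ^ (e 1 * l) * x 1 ^ (e 0 * (N - l))) = r * r' := by
  have hfin := H.finite_gr
  -- The `N + 1` monomials all have degree `D = e₀e₁N`. Since `D - n > a` and `N + 1 > n`, together
  -- with `r · R_{D - n}` they cannot be independent in `R_D`: the dimensions of `R_D` and `R_{D -
  -- n}` differ by `n`.
  set N := 2 * n + a.natAbs + 1 with hN
  set D : ℤ := e 0 * e 1 * N with hD
  have h0 : (1 : ℤ) ≤ e 0 := by exact_mod_cast P.pos 0
  have h1 : (1 : ℤ) ≤ e 1 := by exact_mod_cast P.pos 1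
  have hDN : (N : ℤ) ≤ D := le_mul_of_one_le_left (by positivity)
    (one_le_mul_of_one_le_of_one_le h0 h1)
  have hmem : ∀ l : Fin (N + 1), x 0 ^ (e 1 * (l : ℕ)) * x 1 ^ (e 0 * (N - l)) ∈ gr 𝒜 D := by
    intro l
    have := gr_mul 𝒜 (gr_pow 𝒜 (P.mem 0) (e 1 * (l : ℕ))) (gr_pow 𝒜 (P.mem 1) (e 0 * (N - l)))
    convert this using 2
    have hl : (l : ℕ) ≤ N := by omega
    push_cast [hl]
    rw [hD]; ring
  let F : (Fin (N + 1) → k) →ₗ[k] gr 𝒜 D :=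
    Fintype.linearCombination k fun l => ⟨_, hmem l⟩
  let G : gr 𝒜 (D - n) →ₗ[k] gr 𝒜 D :=
    (LinearMap.mulLeft k r).restrict fun b hb => by
      have := gr_mul 𝒜 (show r ∈ gr 𝒜 n by simpa using hr) hb
      rwa [add_sub_cancel] at this
  have hker : LinearMap.ker (F.coprod G) ≠ ⊥ := by
    refine LinearMap.ker_ne_bot_of_finrank_lt ?_
    rw [Module.finrank_prod, Module.finrank_fin_fun]
    have h2 := H.finrank_of_lt (n := D) (by omega)
    have h3 := H.finrank_of_lt (n := D - n) (by omega)
    omega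
  obtain ⟨⟨c, b⟩, hcb, hne⟩ := (Submodule.ne_bot_iff _).mp hker
  rw [LinearMap.mem_ker, LinearMap.coprod_apply] at hcb
  have hcb' : (∑ l : Fin (N + 1), c l • (x 0 ^ (e 1 * (l : ℕ)) * x 1 ^ (e 0 * (N - l)))) +
      r * b = 0 := by
    have hF : (F c : R) =
        ∑ l : Fin (N + 1), c l • (x 0 ^ (e 1 * (l : ℕ)) * x 1 ^ (e 0 * (N - l))) := by
      simp [F, Fintype.linearCombination_apply]
    rw [← hF]
    exact congrArg Subtype.val hcb
  refine ⟨N, fun l => if hl : l < N + 1 then c ⟨l, hl⟩ else 0, -b, ?_, ?_⟩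
  -- A relation whose monomial coefficients all vanish would read `r b = 0`, so `b = 0` in the
  -- domain `R` and the relation would be trivial.
  · by_contra! hc
    have hc0 : c = 0 := by
      ext l
      have := hc l (by omega)
      rwa [dif_pos l.2] at this
    rw [hc0] at hcb'
    simp only [Pi.zero_apply, zero_smul, Finset.sum_const_zero, zero_add] at hcb'
    have hb : b = 0 := Subtype.ext ((mul_eq_zero.mp hcb').resolve_left hr0)
    exact hne (by rw [hc0, hb]; rfl)
  · rw [Finset.sum_range]
    simp only [Fin.is_lt, dite_true, Fin.eta]
    linear_combination hcb'

/-- The top Čech cohomology is divisible. -/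
lemma IsHomogeneousPair.exists_smul_eq (P : IsHomogeneousPair 𝒜 x e)
    (H : HasRiemannRoch 𝒜 a χ) {n : ℤ} {r : R} (hr : r ∈ gr 𝒜 n) (hr0 : r ≠ 0)
    (h : TopLocalCohomology x) : ∃ h' : TopLocalCohomology x, r • h' = h := by
  revert hr0
  refine gr_induction 𝒜 (P := fun n r => r ≠ 0 → ∃ h' : TopLocalCohomology x, r • h' = h)
    (fun _ h => absurd rfl h) (fun n r hr hr0 => ?_) hr
  obtain ⟨N, c, r', hc, e1⟩ := P.exists_polynomial_mul H hr hr0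
  obtain ⟨h', hh'⟩ := exists_smul_eq_of_polynomial x (e 1) (e 0) N (P.pos 0) c hc h
  exact ⟨r' • h', by rw [← hh', e1, mul_smul]⟩

variable {φ : TopLocalCohomology x →ₗ[k] k}

/-- By divisibility, a class on which `φ` is nonzero is a multiple `r h'` when `r ≠ 0`. Only the
degree `m` component of `h'` can contribute to `φ (r h')`, so `r` pairs nontrivially with degree
`m`. -/
lemma IsHomogeneousPair.residue_nondegenerate (P : IsHomogeneousPair 𝒜 x e)
    (H : HasRiemannRoch 𝒜 a χ) (hφ : ∃ σ, φ σ ≠ 0)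
    (hφ' : ∀ (n : ℤ) (t : ℕ) s, s ∈ gr 𝒜 n → n ≠ a + t * (e 0 + e 1) → φ (frac x s t) = 0)
    {m : ℤ} {r : R} (hr : r ∈ gr 𝒜 (a - m))
    (h : ∀ (t : ℕ) s, s ∈ gr 𝒜 (m + t * (e 0 + e 1)) → φ (frac x (r * s) t) = 0) : r = 0 := by
  by_contra hr0
  obtain ⟨σ, hσ⟩ := hφ
  obtain ⟨h', rfl⟩ := P.exists_smul_eq H hr hr0 σ
  obtain ⟨s, t, rfl⟩ := exists_eq_frac x h'
  refine hσ ?_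
  obtain ⟨S, hS⟩ := sum_cmp 𝒜 s
  rw [smul_frac, hS, Finset.mul_sum, ← fracₗ_apply (k := k), map_sum, map_sum]
  refine Finset.sum_eq_zero fun n _ => ?_
  rw [fracₗ_apply]
  by_cases hn : (n : ℤ) = m + t * (e 0 + e 1)
  · exact h t _ (hn ▸ cmp_mem 𝒜 _ s)
  · exact hφ' _ t _ (gr_mul 𝒜 hr (cmp_mem 𝒜 _ s)) (by omega)

/-- Graded local duality: compatible families of functionals on the degree `m` part of the top
Čech cohomology are given by multiplication with an element of degree `a - m`. -/
theorem IsHomogeneousPair.exists_eq_residue (P : IsHomogeneousPair 𝒜 x e)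
    (H : HasRiemannRoch 𝒜 a χ) (hφ : ∃ σ, φ σ ≠ 0)
    (hφ' : ∀ (n : ℤ) (t : ℕ) s, s ∈ gr 𝒜 n → n ≠ a + t * (e 0 + e 1) → φ (frac x s t) = 0)
    (m : ℤ) (l : ℕ → R →ₗ[k] k)
    (hl : ∀ (t : ℕ) s, s ∈ gr 𝒜 (m + t * (e 0 + e 1)) → l (t + 1) (x 0 * x 1 * s) = l t s)
    (hl0 : ∀ (t : ℕ) s, s ∈ gr 𝒜 (m + t * e 1) → l t (x 0 ^ t * s) = 0)
    (hl1 : ∀ (t : ℕ) s, s ∈ gr 𝒜 (m + t * e 0) → l t (x 1 ^ t * s) = 0) :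
    ∃ r ∈ gr 𝒜 (a - m), ∀ (t : ℕ) s, s ∈ gr 𝒜 (m + t * (e 0 + e 1)) →
      l t s = φ (frac x (r * s) t) := by
  have hfin := H.finite_gr
  have hraise : ∀ (t u : ℕ) s, s ∈ gr 𝒜 (m + t * (e 0 + e 1)) →
      l (t + u) ((x 0 * x 1) ^ u * s) = l t s := by
    intro t u s hs
    induction u with
    | zero => simp
    | succ u ih => rw [← ih, ← add_assoc, pow_succ', mul_assoc, hl _ _ (P.raise_mem u hs)]
  let B (t : ℕ) : gr 𝒜 (a - m) →ₗ[k] Module.Dual k (gr 𝒜 (m + t * (e 0 + e 1))) :=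
    LinearMap.mk₂ k (fun r s => φ (fracₗ k x t ((r : R) * s)))
      (fun r r' s => by simp only [Submodule.coe_add, add_mul, map_add])
      (fun c r s => by simp only [Submodule.coe_smul, smul_mul_assoc, map_smul])
      (fun r s s' => by simp only [Submodule.coe_add, mul_add, map_add])
      (fun c r s => by simp only [Submodule.coe_smul, mul_smul_comm, map_smul])
  have hB : ∀ t r s, B t r s = φ (frac x ((r : R) * s) t) := fun _ _ _ => rfl
  have hanti : ∀ t u, LinearMap.ker (B (t + u)) ≤ LinearMap.ker (B t) := by
    intro t u r hr
    rw [LinearMap.mem_ker] at hr ⊢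
    ext s
    have := LinearMap.congr_fun hr ⟨_, P.raise_mem u s.2⟩
    rw [hB, LinearMap.zero_apply] at this
    rw [hB, LinearMap.zero_apply, frac_raise x _ t u, ← this]
    congr 2
    ring
  -- The left kernels of the pairings decrease with the level `t` inside a finite-dimensional space,
  -- so they stabilize at their intersection, which is zero by nondegeneracy.
  let K : ℕ →o (Submodule k (gr 𝒜 (a - m)))ᵒᵈ :=
    ⟨fun t => OrderDual.toDual (LinearMap.ker (B t)), fun t t' htt' => by
      obtain ⟨u, rfl⟩ := Nat.exists_eq_add_of_le htt'
      exact hanti t u⟩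
  obtain ⟨T, hT⟩ := IsArtinian.monotone_stabilizes K
  have hinj : ∀ t ≥ T, LinearMap.ker (B t) = ⊥ := by
    intro t ht
    rw [eq_bot_iff]
    intro r hr
    have hall : ∀ t', r ∈ LinearMap.ker (B t') := by
      intro t'
      have e1 : LinearMap.ker (B t) = LinearMap.ker (B (t + t')) :=
        (hT t ht).symm.trans (hT (t + t') (by omega))
      rw [e1] at hr
      exact hanti t' t (add_comm t t' ▸ hr)
    refine Subtype.ext (P.residue_nondegenerate H hφ hφ' r.2 fun t' s hs => ?_)
    have := LinearMap.congr_fun (LinearMap.mem_ker.mp (hall t')) ⟨s, hs⟩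
    rwa [hB] at this
  obtain ⟨T', hT'⟩ := P.finrank_gr_eq H m
  have hsurj : ∀ t ≥ T + T', ∃ r : gr 𝒜 (a - m), ∀ s, s ∈ gr 𝒜 (m + t * (e 0 + e 1)) →
      l t s = φ (frac x (r * s) t) := by
    intro t ht
    let I := (levelPart 𝒜 x e m t).comap (gr 𝒜 (m + t * (e 0 + e 1))).subtype
    have hI : Module.finrank k I = Module.finrank k (levelPart 𝒜 x e m t) :=
      (Submodule.comapSubtypeEquivOfLe (P.levelPart_le m t)).finrank_eq
    have h1 := hT' t (by omega)
    have h2 := Subspace.finrank_add_finrank_dualAnnihilator_eq I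
    have h3 : LinearMap.range (B t) ≤ I.dualAnnihilator := by
      rintro _ ⟨r, rfl⟩
      rw [Submodule.mem_dualAnnihilator]
      intro s hs
      rw [hB, ← smul_frac, (P.frac_eq_zero_iff_mem s.2).mpr hs, smul_zero, map_zero]
    -- Both sides have dimension `h(a - m)`: the left because the pairing is injective at this
    -- level, the right because this is the codimension of the ideal part.
    have h4 : LinearMap.range (B t) = I.dualAnnihilator := by
      refine Submodule.eq_of_le_of_finrank_eq h3 ?_
      rw [LinearMap.finrank_range_of_inj (LinearMap.ker_eq_bot.mp (hinj t (by omega)))]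
      omega
    have h5 : (l t).domRestrict (gr 𝒜 (m + t * (e 0 + e 1))) ∈ I.dualAnnihilator := by
      rw [Submodule.mem_dualAnnihilator]
      rintro ⟨s, hs⟩ hsI
      obtain ⟨b, hb, c, hc, rfl⟩ := (mem_idealPart 𝒜).mp hsI
      rw [LinearMap.domRestrict_apply, map_add, hl0 t b hb, hl1 t c hc, add_zero]
    rw [← h4] at h5
    obtain ⟨r, hr⟩ := h5
    refine ⟨r, fun s hs => ?_⟩
    have := LinearMap.congr_fun hr ⟨s, hs⟩
    rw [hB] at this
    exact this.symm
  have hdown : ∀ (t u : ℕ) (r : gr 𝒜 (a - m)),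
      (∀ s, s ∈ gr 𝒜 (m + (t + u : ℕ) * (e 0 + e 1)) → l (t + u) s = φ (frac x (r * s) (t + u))) →
      ∀ s, s ∈ gr 𝒜 (m + t * (e 0 + e 1)) → l t s = φ (frac x (r * s) t) := by
    intro t u r h s hs
    rw [← hraise t u s hs, h _ (P.raise_mem u hs), frac_raise x _ t u]
    congr 2
    ring
  obtain ⟨r, hr⟩ := hsurj (T + T') le_rfl
  refine ⟨r, r.2, fun t => ?_⟩
  obtain ⟨r', hr'⟩ := hsurj (T + T' + t) (by omega)
  -- The elements found at two large levels represent the same functional at the lower one, so they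
  -- agree by injectivity; one `r` therefore serves all levels.
  have hrr' : r' = r := by
    rw [← sub_eq_zero, ← Submodule.mem_bot k, ← hinj (T + T') (by omega), LinearMap.mem_ker]
    ext s
    rw [map_sub, LinearMap.sub_apply, hB, hB, ← hr s s.2, ← hdown _ t r' hr' s s.2, sub_self]
    rfl
  rw [hrr', add_comm (T + T') t] at hr'
  exact hdown t (T + T') r hr'

end Duality

/-! ### Elements with degrees in a fixed residue class modulo `d` -/

section Classes

variable {k R : Type*} [Field k] [CommRing R] [Algebra k R]
variable (𝒜 : ℕ → Submodule k R) [GradedAlgebra 𝒜] (d : ℕ)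

lemma finite_cmp_ne_zero (r : R) : {n : ℤ | cmp 𝒜 n r ≠ 0}.Finite := by
  obtain ⟨s, hs⟩ := sum_cmp 𝒜 r
  refine (s.finite_toSet.image (fun n : ℕ => (n : ℤ))).subset fun n hn => ?_
  by_contra hns
  refine hn ?_
  rw [hs, map_sum]
  refine Finset.sum_eq_zero fun i hi => cmp_of_mem_ne 𝒜 (cmp_mem 𝒜 i r) ?_
  rintro rfl
  exact hns ⟨i, hi, rfl⟩

/-- The elements of `R` whose homogeneous components have degrees congruent to `b` modulo `d`. -/
def cls (b : ℤ) : Submodule k R where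
  carrier := {r | ∀ n : ℤ, ¬ (d : ℤ) ∣ n - b → cmp 𝒜 n r = 0}
  zero_mem' := by simp
  add_mem' := fun h h' n hn => by rw [map_add, h n hn, h' n hn, add_zero]
  smul_mem' := fun c r h n hn => by rw [map_smul, h n hn, smul_zero]

variable {𝒜 d}

lemma gr_le_cls {b n : ℤ} (h : (d : ℤ) ∣ n - b) : gr 𝒜 n ≤ cls 𝒜 d b := by
  intro r hr m hm
  exact cmp_of_mem_ne 𝒜 hr fun h' => hm (h' ▸ h)

lemma cls_le {b : ℤ} {N : Submodule k R} (h : ∀ n : ℤ, (d : ℤ) ∣ n - b → gr 𝒜 n ≤ N) :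
    cls 𝒜 d b ≤ N := by
  intro r hr
  obtain ⟨s, hs⟩ := sum_cmp 𝒜 r
  rw [hs]
  refine N.sum_mem fun n _ => ?_
  by_cases hn : (d : ℤ) ∣ n - b
  · exact h n hn (cmp_mem 𝒜 n r)
  · rw [hr n hn]; exact N.zero_mem

lemma cls_mul {b c : ℤ} {r s : R} (hr : r ∈ cls 𝒜 d b) (hs : s ∈ cls 𝒜 d c) :
    r * s ∈ cls 𝒜 d (b + c) := by
  have h1 : cls 𝒜 d b ≤ (cls 𝒜 d (b + c)).comap (LinearMap.mulRight k s) := by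
    refine cls_le fun n hn r hr => ?_
    have h2 : cls 𝒜 d c ≤ (cls 𝒜 d (b + c)).comap (LinearMap.mulLeft k r) := by
      refine cls_le fun m hm s hs => gr_le_cls ?_ (gr_mul 𝒜 hr hs)
      have := dvd_add hn hm
      rwa [show n - b + (m - c) = n + m - (b + c) by ring] at this
    exact h2 hs
  exact h1 hr

lemma mem_veronese_iff {r : R} : r ∈ veronese 𝒜 d ↔ r ∈ cls 𝒜 d 0 := by
  change r ∈ (⨆ n, 𝒜 (d * n)) ↔ _
  constructor
  · intro h
    refine (iSup_le fun n => ?_ : (⨆ n, 𝒜 (d * n)) ≤ cls 𝒜 d 0) h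
    rw [← gr_natCast 𝒜]
    exact gr_le_cls (by simp)
  · intro h
    refine (cls_le fun n hn => ?_ : cls 𝒜 d 0 ≤ ⨆ n, 𝒜 (d * n)) h
    intro r hr
    refine gr_induction 𝒜 (P := fun n r => (d : ℤ) ∣ n - 0 → r ∈ ⨆ n, 𝒜 (d * n))
      (fun _ _ => zero_mem _) (fun n r hr hn => ?_) hr hn
    rw [sub_zero, Int.natCast_dvd_natCast] at hn
    obtain ⟨m, rfl⟩ := hn
    exact Submodule.mem_iSup_of_mem m hr

variable (𝒜 d) in
/-- The `R^{(d)}`-module of elements whose components have degrees congruent to `b` modulo `d`. -/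
def clsModule (b : ℤ) : Submodule (veronese 𝒜 d) R where
  carrier := cls 𝒜 d b
  zero_mem' := zero_mem _
  add_mem' := add_mem
  smul_mem' := fun s r hr => by
    have := cls_mul (mem_veronese_iff.mp s.2) hr
    rwa [zero_add] at this

@[simp] lemma mem_clsModule {b : ℤ} {r : R} : r ∈ clsModule 𝒜 d b ↔ r ∈ cls 𝒜 d b := Iff.rfl

lemma mem_veronese_of_mem_gr {n : ℤ} (h : (d : ℤ) ∣ n) {r : R} (hr : r ∈ gr 𝒜 n) :
    r ∈ veronese 𝒜 d :=
  mem_veronese_iff.mpr (gr_le_cls (by simpa using h) hr)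

end Classes

/-! ### The canonical module of a Veronese subring -/

section CanonicalModule

lemma ext_frac_homogeneous {k S V : Type*} [Field k] [CommRing S] [Algebra k S] [AddCommGroup V]
    [Module k V] (𝒜 : ℕ → Submodule k S) [GradedAlgebra 𝒜] {x : Fin 2 → S}
    (φ ψ : TopLocalCohomology x →ₗ[k] V)
    (H : ∀ (i t : ℕ) s, s ∈ 𝒜 i → φ (frac x s t) = ψ (frac x s t)) (h : TopLocalCohomology x) :
    φ h = ψ h := by
  obtain ⟨s, t, rfl⟩ := exists_eq_frac x h
  obtain ⟨S, hS⟩ := sum_cmp 𝒜 s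
  rw [hS, ← fracₗ_apply (k := k), map_sum, map_sum, map_sum]
  exact Finset.sum_congr rfl fun n _ => H n t _ (by simpa using cmp_mem 𝒜 n s)

variable {k R : Type*} [Field k] [CommRing R] [IsDomain R] [Algebra k R]
variable {𝒜 : ℕ → Submodule k R} [GradedAlgebra 𝒜] {d : ℕ}
variable {x : Fin 2 → veronese 𝒜 d} {e : Fin 2 → ℕ} {a χ : ℤ}

/-- The map of top Čech cohomology modules induced by the inclusion of a Veronese subring. -/
lemma exists_cech_inclusion (x : Fin 2 → veronese 𝒜 d) :
    ∃ ι : TopLocalCohomology x →ₗ[k] TopLocalCohomology (fun i => (x i : R)),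
      (∀ s t, ι (frac x s t) = frac _ (s : R) t) ∧ ∀ (s : veronese 𝒜 d) h, ι (s • h) = (s : R) • ι h := by
  have htow : IsTower x fun t => fracₗ k (fun i => (x i : R)) t ∘ₗ
      (veronese 𝒜 d).val.toLinearMap := by
    refine ⟨fun t s => ?_, fun t s => ?_, fun t s => ?_⟩
    · change frac _ ((x 0 * x 1 * s : veronese 𝒜 d) : R) (t + 1) = frac _ (s : R) t
      rw [frac_raise _ (s : R) t 1, pow_one]
      rfl
    · change frac _ ((x 0 ^ t * s : veronese 𝒜 d) : R) t = 0
      exact frac_zero_left (fun i => (x i : R)) s t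
    · change frac _ ((x 1 ^ t * s : veronese 𝒜 d) : R) t = 0
      exact frac_zero_right (fun i => (x i : R)) s t
  obtain ⟨ι, hι⟩ := htow.exists_linearMap
  refine ⟨ι, hι, fun s h => ?_⟩
  obtain ⟨s', t, rfl⟩ := exists_eq_frac x h
  rw [smul_frac, hι, hι]
  exact (smul_frac _ (s : R) (s' : R) t).symm

/-- Since `φ` lives in degree `a`, a class of degree `m` pairs only with the component of `r` of
degree `a - m`. -/
lemma residue_eq_cmp {y : Fin 2 → R} {f : Fin 2 → ℕ} {φ : TopLocalCohomology y →ₗ[k] k}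
    (hφ' : ∀ (n : ℤ) (t : ℕ) s, s ∈ gr 𝒜 n → n ≠ a + t * (f 0 + f 1) → φ (frac y s t) = 0)
    {m : ℤ} {t : ℕ} {s : R} (hs : s ∈ gr 𝒜 (m + t * (f 0 + f 1))) (r : R) :
    φ (frac y (r * s) t) = φ (frac y (cmp 𝒜 (a - m) r * s) t) := by
  rw [← sub_eq_zero, ← fracₗ_apply (k := k), ← fracₗ_apply (k := k), ← map_sub, ← map_sub, ← sub_mul]
  obtain ⟨S, hS⟩ := sum_cmp 𝒜 (r - cmp 𝒜 (a - m) r)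
  rw [hS, Finset.sum_mul, map_sum, map_sum]
  refine Finset.sum_eq_zero fun n _ => ?_
  rw [fracₗ_apply]
  by_cases hn : (n : ℤ) = a - m
  · rw [hn, map_sub, cmp_of_mem 𝒜 (cmp_mem 𝒜 _ r), sub_self, zero_mul, ← fracₗ_apply (k := k),
      map_zero, map_zero]
  · exact hφ' _ t _ (gr_mul 𝒜 (cmp_mem 𝒜 n _) hs) (by omega)

set_option maxHeartbeats 400000 in
/-- The canonical module of the Veronese subring `R^{(d)}` is the module of elements of `R` of
degrees congruent to `a(R)` modulo `d`. -/
theorem nonempty_canonicalModule_equiv [NeZero d] (H : HasRiemannRoch 𝒜 a χ)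
    (P : IsHomogeneousPair 𝒜 (fun i => (x i : R)) (fun i => d * e i)) :
    Nonempty (CanonicalModule (veroneseGrading 𝒜 d) x e ≃ₗ[veronese 𝒜 d] clsModule 𝒜 d a) := by
  have hd : (d : ℤ) ≠ 0 := by exact_mod_cast NeZero.ne d
  obtain ⟨φ, hφ, hφ'⟩ := P.exists_residue H
  obtain ⟨ι, hι, hιs⟩ := exists_cech_inclusion x
  have hdeg : ∀ (m : ℤ) (t : ℕ), (d : ℤ) * (m + t * (e 0 + e 1)) =
      d * m + t * ((d * e 0 : ℕ) + (d * e 1 : ℕ)) := by intros; push_cast; ring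
  have hcmp : ∀ (r : R) (m : ℤ) (t : ℕ) (s : veronese 𝒜 d),
      (s : R) ∈ gr 𝒜 (d * (m + t * (e 0 + e 1))) →
      φ (r • ι (frac x s t)) = φ (cmp 𝒜 (a - d * m) r • ι (frac x s t)) := by
    intro r m t s hs
    rw [hdeg] at hs
    rw [hι, smul_frac, smul_frac]
    exact residue_eq_cmp (y := fun i => (x i : R)) (f := fun i => d * e i) hφ' hs r
  have hfin : ∀ r : R, (φ ∘ₗ (LinearMap.lsmul R (TopLocalCohomology fun i => (x i : R)) r).restrictScalars k ∘ₗ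
      ι) ∈
      gradedDual (veroneseGrading 𝒜 d) x e := by
    intro r
    have hinj : Set.InjOn (fun m : ℤ => a - d * m)
        ((fun m : ℤ => a - d * m) ⁻¹' {n : ℤ | cmp 𝒜 n r ≠ 0}) :=
      fun m _ m' _ h => mul_left_cancel₀ hd (by simpa using h)
    refine (Set.Finite.preimage hinj (finite_cmp_ne_zero 𝒜 r)).subset ?_
    rintro m ⟨h, hh, hne⟩ hzero
    refine hne ?_
    have hle := grading_le (veroneseGrading 𝒜 d) x e m (LinearMap.ker (φ ∘ₗ
      (LinearMap.lsmul R (TopLocalCohomology fun i => (x i : R)) r).restrictScalars k ∘ₗ ι)) ?_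
    · exact hle hh
    · intro s l t hs hl
      change φ (r • ι (frac x s t)) = 0
      have hs' : (s : R) ∈ 𝒜 (d * l) := hs
      rw [hcmp r m t s (by rw [← hl, ← Nat.cast_mul, gr_natCast]; exact hs'), hzero, zero_smul,
        map_zero]
  -- An element `r` acts as multiplication by `r` in the cohomology over `R`, followed by the
  -- residue. Classes coming from `S` have degrees `dm`, so only the components of `r` in degrees `a
  -- - dm` matter.
  let Θ : clsModule 𝒜 d a →ₗ[veronese 𝒜 d] CanonicalModule (veroneseGrading 𝒜 d) x e :=
    { toFun := fun r => ⟨_, hfin (r : R)⟩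
      map_add' := fun r r' => Subtype.ext (LinearMap.ext fun h => by
        change φ (((r : R) + r') • ι h) = φ ((r : R) • ι h) + φ ((r' : R) • ι h)
        rw [add_smul, map_add])
      map_smul' := fun s r => Subtype.ext (LinearMap.ext fun h => by
        change φ (((s : R) * r) • ι h) = φ ((r : R) • ι (s • h))
        rw [hιs, mul_comm, mul_smul]) }
  have hΘ : ∀ r h, (Θ r).1 h = φ ((r : R) • ι h) := fun _ _ => rfl
  refine ⟨(LinearEquiv.ofBijective Θ ⟨?_, ?_⟩).symm⟩
  · rw [← LinearMap.ker_eq_bot, eq_bot_iff]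
    rintro ⟨r, hr⟩ hr0
    rw [LinearMap.mem_ker] at hr0
    refine Subtype.ext (eq_zero_of_cmp 𝒜 fun n => ?_)
    by_cases hn : (d : ℤ) ∣ n - a
    · obtain ⟨m, hm⟩ := hn
      obtain rfl : n = a - d * (-m) := by rw [mul_neg]; omega
      refine P.residue_nondegenerate H hφ hφ' (m := d * (-m)) (cmp_mem 𝒜 _ r) fun t s hs => ?_
      rw [← hdeg] at hs
      have hsS := mem_veronese_of_mem_gr (dvd_mul_right _ _) hs
      have h1 := hcmp r (-m) t ⟨s, hsS⟩ hs
      rw [← hΘ ⟨r, hr⟩, hr0, hι, smul_frac] at h1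
      exact h1.symm
    · exact hr n hn
  · intro ψ
    have hext : ∀ m : ℤ, ∃ r ∈ gr 𝒜 (a - d * m), ∀ (t : ℕ) (s : veronese 𝒜 d),
        (s : R) ∈ gr 𝒜 (d * (m + t * (e 0 + e 1))) →
        ψ.1 (frac x s t) = φ (r • ι (frac x s t)) := by
      intro m
      obtain ⟨l, hl, hlψ⟩ := isTower_frac x ψ.1
      -- The extension from `S` to `R` is arbitrary. Duality over `R` only asks for compatibility in
      -- the degrees attached to `dm`; these are multiples of `d`, where the extension is
      -- determined.
      have hE : ∀ t, ∃ L : R →ₗ[k] k, ∀ s : veronese 𝒜 d, L s = l t s := fun t => by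
        obtain ⟨L, hL⟩ := LinearMap.exists_extend (p := (veronese 𝒜 d).toSubmodule) (l t)
        exact ⟨L, fun s => LinearMap.congr_fun hL s⟩
      choose L hL using hE
      have h0 : ∀ (t : ℕ) s, s ∈ gr 𝒜 (d * m + t * ((d * e 0 : ℕ) + (d * e 1 : ℕ))) →
          L (t + 1) (x 0 * x 1 * s) = L t s := by
        intro t s hs
        rw [← hdeg] at hs
        have := hl.raise t ⟨s, mem_veronese_of_mem_gr (dvd_mul_right _ _) hs⟩
        rwa [← hL, ← hL] at this
      have h1 : ∀ (t : ℕ) s, s ∈ gr 𝒜 (d * m + t * (d * e 1 : ℕ)) → L t (x 0 ^ t * s) = 0 := by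
        intro t s hs
        have := hl.left t ⟨s, mem_veronese_of_mem_gr (n := d * (m + t * e 1)) (dvd_mul_right _ _)
            (by convert hs using 2; push_cast; ring)⟩
        rwa [← hL] at this
      have h2 : ∀ (t : ℕ) s, s ∈ gr 𝒜 (d * m + t * (d * e 0 : ℕ)) → L t (x 1 ^ t * s) = 0 := by
        intro t s hs
        have := hl.right t ⟨s, mem_veronese_of_mem_gr (n := d * (m + t * e 0)) (dvd_mul_right _ _)
            (by convert hs using 2; push_cast; ring)⟩
        rwa [← hL] at this
      obtain ⟨r, hr, hr'⟩ := P.exists_eq_residue H hφ hφ' (d * m) L h0 h1 h2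
      refine ⟨r, hr, fun t s hs => ?_⟩
      rw [hdeg] at hs
      rw [← hlψ, ← hL, hr' t s hs, hι, smul_frac]
    choose r hr hrψ using hext
    have hF := ψ.2
    change Set.Finite _ at hF
    -- Membership in the graded dual leaves finitely many degrees in which `ψ` is nonzero, so the
    -- representing elements of the separate degrees can be added up.
    have hrcls : ∑ m ∈ hF.toFinset, r m ∈ clsModule 𝒜 d a :=
      mem_clsModule.mpr ((cls 𝒜 d a).sum_mem fun m _ => by
        have hdvd : (d : ℤ) ∣ a - d * m - a := ⟨-m, by ring⟩
        exact gr_le_cls hdvd (hr m))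
    suffices hψ : (Θ ⟨_, hrcls⟩).1 = ψ.1 from ⟨_, Subtype.ext hψ⟩
    refine LinearMap.ext fun h => ?_
    refine ext_frac_homogeneous (veroneseGrading 𝒜 d) (φ ∘ₗ (LinearMap.lsmul R
      (TopLocalCohomology fun i => (x i : R)) _).restrictScalars k ∘ₗ ι) ψ.1 ?_ h
    · intro i t s hs1
      change φ ((∑ m ∈ hF.toFinset, r m) • ι (frac x s t)) = _
      obtain ⟨m, hm⟩ : ∃ m : ℤ, (i : ℤ) = m + t * (e 0 + e 1) := ⟨i - t * (e 0 + e 1), by ring⟩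
      have hs0 : (s : R) ∈ 𝒜 (d * i) := hs1
      have hs2 : (s : R) ∈ gr 𝒜 (d * (m + t * (e 0 + e 1))) := by
        rw [← hm, ← Nat.cast_mul, gr_natCast]; exact hs0
      have hsum : cmp 𝒜 (a - d * m) (∑ m ∈ hF.toFinset, r m) =
          ∑ m' ∈ hF.toFinset, if m' = m then r m else 0 := by
        rw [map_sum]
        refine Finset.sum_congr rfl fun m' _ => ?_
        split_ifs with h
        · subst h; exact cmp_of_mem 𝒜 (hr m')
        · exact cmp_of_mem_ne 𝒜 (hr m') fun h' => h (mul_left_cancel₀ hd (by omega))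
      rw [hcmp _ m t s hs2, hsum, Finset.sum_ite_eq']
      split_ifs with h
      · exact (hrψ m t s hs2).symm
      · rw [zero_smul, map_zero]
        by_contra hne
        refine h (hF.mem_toFinset.mpr ⟨_, frac_mem_grading _ x e hs1 hm, fun h' => hne h'.symm⟩)

end CanonicalModule

/-! ### Krull dimension of integral extensions -/

section Dimension

/-- Incomparability keeps chains of primes strict under contraction; lying over and going up lift
chains with their length. -/
theorem ringKrullDim_eq_of_isIntegral_of_injective {A B : Type*} [CommRing A] [CommRing B]
    [Algebra A B] [Algebra.IsIntegral A B] (hinj : Function.Injective (algebraMap A B)) :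
    ringKrullDim B = ringKrullDim A := by
  refine le_antisymm (Order.krullDim_le_of_strictMono (PrimeSpectrum.comap (algebraMap A B)) ?_)
    (iSup_le fun l => ?_)
  · intro p q hpq
    exact Ideal.IsIntegral.comap_lt_comap (show p.asIdeal < q.asIdeal from hpq)
  · obtain ⟨Q, -, hQ, hQ'⟩ := Ideal.exists_ideal_over_prime_of_isIntegral l.head.asIdeal
      (⊥ : Ideal B) (by
        rw [← RingHom.ker_eq_comap_bot, (RingHom.injective_iff_ker_eq_bot _).mp hinj]
        exact bot_le)
    have : Q.LiesOver l.head.asIdeal := ⟨hQ'.symm⟩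
    obtain ⟨L, hL, -⟩ := Ideal.exists_ltSeries_of_hasGoingUp l Q
    rw [← hL]
    exact le_iSup (fun p : LTSeries (PrimeSpectrum B) => (p.length : WithBot ℕ∞)) L

end Dimension

/-! ### Regular pairs as regular sequences -/

section RegularSequence

lemma isRegular_ofFn_two {S : Type*} [CommRing S] [IsDomain S] (x : Fin 2 → S) (h0 : x 0 ≠ 0)
    (h : IsRegularPair (x 0) (x 1)) (htop : Ideal.span (Set.range x) ≠ ⊤) :
    RingTheory.Sequence.IsRegular S (List.ofFn x) := by
  refine ⟨?_, fun h' => htop ?_⟩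
  · rw [List.ofFn_succ, List.ofFn_succ, List.ofFn_zero,
      RingTheory.Sequence.isWeaklyRegular_cons_iff, RingTheory.Sequence.isWeaklyRegular_cons_iff]
    refine ⟨fun a b hab => mul_left_cancel₀ h0 hab, ?_, RingTheory.Sequence.IsWeaklyRegular.nil _ _⟩
    refine (isSMulRegular_quotient_iff_mem_of_smul_mem _ _).mpr ?_
    intro r hr
    rw [Submodule.mem_smul_pointwise_iff_exists] at hr ⊢
    obtain ⟨b, -, hb⟩ := hr
    obtain ⟨c, hc⟩ := h r ⟨b, hb.symm⟩
    exact ⟨c, trivial, hc.symm⟩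
  · rw [smul_eq_mul, Ideal.mul_top] at h'
    rw [h', Ideal.ofList]
    congr 1
    ext z
    simp [eq_comm]

end RegularSequence

/-! ### Integrality, dimension and radicals in the hyperelliptic cone -/

section Cone

variable {k R : Type*} [Field k] [CommRing R] [Algebra k R]

/-- The properties of the hyperelliptic cone `k[X, Y, Z] / (Z² + f(X², Y))` that determine its
Veronese subrings. -/
structure IsHyperellipticCone (𝒜 : ℕ → Submodule k R) [GradedAlgebra 𝒜] (g : ℕ) (X Y Z : R) :
    Prop where
  hasRiemannRoch : HasRiemannRoch 𝒜 (2 * g - 2) (1 - g)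
  X_mem : X ∈ 𝒜 1
  Y_mem : Y ∈ 𝒜 2
  Z_mem : Z ∈ 𝒜 (2 * g + 1)
  X_ne_zero : X ≠ 0
  Y_ne_zero : Y ≠ 0
  Z_ne_zero : Z ≠ 0
  regular_XY : IsRegularPair X Y
  regular_XZ : IsRegularPair X Z
  le_span : ∀ n, 𝒜 n ≤ Submodule.span k ({r | ∃ i j, i + 2 * j = n ∧ r = X ^ i * Y ^ j} ∪
    {r | ∃ i j, i + 2 * j + (2 * g + 1) = n ∧ r = X ^ i * Y ^ j * Z})
  Z_sq_mem : Z ^ 2 ∈ Algebra.adjoin k {X, Y}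
  mul_Z_notMem : ∀ n, X ^ n * Z ∉ Algebra.adjoin k {X, Y}
  algebraicIndependent : AlgebraicIndependent k ![X, Y]

variable {𝒜 : ℕ → Submodule k R} [GradedAlgebra 𝒜] {g : ℕ} {X Y Z : R}

namespace IsHyperellipticCone

lemma X_pow_mem (C : IsHyperellipticCone 𝒜 g X Y Z) (n : ℕ) : X ^ n ∈ 𝒜 n := by
  simpa using SetLike.pow_mem_graded n C.X_mem

lemma Y_pow_mem (C : IsHyperellipticCone 𝒜 g X Y Z) (n : ℕ) : Y ^ n ∈ 𝒜 (2 * n) := by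
  simpa [mul_comm] using SetLike.pow_mem_graded n C.Y_mem

lemma monomial_mem (C : IsHyperellipticCone 𝒜 g X Y Z) (i j : ℕ) :
    X ^ i * Y ^ j ∈ 𝒜 (i + 2 * j) :=
  SetLike.mul_mem_graded (C.X_pow_mem i) (C.Y_pow_mem j)

lemma monomial_mul_Z_mem (C : IsHyperellipticCone 𝒜 g X Y Z) (i j : ℕ) :
    X ^ i * Y ^ j * Z ∈ 𝒜 (i + 2 * j + (2 * g + 1)) :=
  SetLike.mul_mem_graded (C.monomial_mem i j) C.Z_mem

lemma mem_of_pos (C : IsHyperellipticCone 𝒜 g X Y Z) {n : ℕ} (hn : 0 < n) {J : Ideal R}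
    (hX : X ∈ J) (hY : Y ∈ J) (hZ : n = 2 * g + 1 → Z ∈ J) {r : R} (hr : r ∈ 𝒜 n) : r ∈ J := by
  have key : ∀ i j, 0 < i + 2 * j → X ^ i * Y ^ j ∈ J := by
    intro i j hij
    rcases Nat.eq_zero_or_pos i with h | h
    · exact J.mul_mem_left _ (J.pow_mem_of_mem hY j (by omega))
    · exact J.mul_mem_right _ (J.pow_mem_of_mem hX i h)
  have hle : Submodule.span k ({r | ∃ i j, i + 2 * j = n ∧ r = X ^ i * Y ^ j} ∪
    {r | ∃ i j, i + 2 * j + (2 * g + 1) = n ∧ r = X ^ i * Y ^ j * Z}) ≤ J.restrictScalars k := by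
    refine Submodule.span_le.mpr ?_
    rintro _ (⟨i, j, h, rfl⟩ | ⟨i, j, h, rfl⟩)
    · exact key i j (by omega)
    · rcases Nat.eq_zero_or_pos (i + 2 * j) with h' | h'
      · exact J.mul_mem_left _ (hZ (by omega))
      · exact J.mul_mem_right _ (key i j h')
  exact hle (C.le_span n hr)

/-- Only the multiples of `Z` itself are in question. But `Z²` has degree `4g + 2 ≠ 2g + 1`, so
every spanning monomial in its degree is divisible by `X` or `Y`. -/
lemma mem_radical (C : IsHyperellipticCone 𝒜 g X Y Z) {J : Ideal R} {a b : ℕ} (hX : X ^ a ∈ J)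
    (hY : Y ^ b ∈ J) {n : ℕ} (hn : 0 < n) {r : R} (hr : r ∈ 𝒜 n) : r ∈ J.radical := by
  have hX' : X ∈ J.radical := ⟨a, hX⟩
  have hY' : Y ∈ J.radical := ⟨b, hY⟩
  refine C.mem_of_pos hn hX' hY' (fun _ => ?_) hr
  refine J.radical_isRadical ⟨2, ?_⟩
  refine C.mem_of_pos (n := 2 • (2 * g + 1)) (by positivity) hX' hY' (fun h => ?_)
    (SetLike.pow_mem_graded 2 C.Z_mem)
  rw [smul_eq_mul] at h
  omega

/-- `R` is integral over the polynomial ring in `Xᵈ` and `Yᵈ`. -/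
lemma isIntegral (C : IsHyperellipticCone 𝒜 g X Y Z) {d : ℕ} (hd : 0 < d) (r : R) :
    (MvPolynomial.aeval ![X ^ d, Y ^ d] : MvPolynomial (Fin 2) k →ₐ[k] R).toRingHom.IsIntegralElem
      r := by
  let φ : MvPolynomial (Fin 2) k →ₐ[k] R := MvPolynomial.aeval ![X ^ d, Y ^ d]
  let _ : Algebra (MvPolynomial (Fin 2) k) R := φ.toRingHom.toAlgebra
  have : IsScalarTower k (MvPolynomial (Fin 2) k) R := IsScalarTower.of_algHom φ
  change IsIntegral (MvPolynomial (Fin 2) k) r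
  have hX : X ∈ integralClosure (MvPolynomial (Fin 2) k) R := by
    refine IsIntegral.of_pow hd ?_
    have : X ^ d = algebraMap (MvPolynomial (Fin 2) k) R (MvPolynomial.X 0) := by
      change _ = φ (MvPolynomial.X 0)
      simp [φ]
    rw [this]; exact isIntegral_algebraMap
  have hY : Y ∈ integralClosure (MvPolynomial (Fin 2) k) R := by
    refine IsIntegral.of_pow hd ?_
    have : Y ^ d = algebraMap (MvPolynomial (Fin 2) k) R (MvPolynomial.X 1) := by
      change _ = φ (MvPolynomial.X 1)
      simp [φ]
    rw [this]; exact isIntegral_algebraMap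
  let T : Subalgebra k R := (integralClosure (MvPolynomial (Fin 2) k) R).restrictScalars k
  have hT : Algebra.adjoin k {X, Y} ≤ T := by
    refine Algebra.adjoin_le ?_
    rintro z (rfl | rfl)
    · exact hX
    · exact hY
  have hZ : Z ∈ integralClosure (MvPolynomial (Fin 2) k) R :=
    IsIntegral.of_pow (n := 2) (by norm_num) (hT C.Z_sq_mem)
  change r ∈ T
  obtain ⟨s, hs⟩ := sum_cmp 𝒜 r
  rw [hs]
  refine T.sum_mem fun n _ => ?_
  have hle : Submodule.span k ({r | ∃ i j, i + 2 * j = n ∧ r = X ^ i * Y ^ j} ∪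
    {r | ∃ i j, i + 2 * j + (2 * g + 1) = n ∧ r = X ^ i * Y ^ j * Z}) ≤
      Subalgebra.toSubmodule T := by
    refine Submodule.span_le.mpr ?_
    rintro _ (⟨i, j, h, rfl⟩ | ⟨i, j, h, rfl⟩)
    · exact T.mul_mem (T.pow_mem hX i) (T.pow_mem hY j)
    · exact T.mul_mem (T.mul_mem (T.pow_mem hX i) (T.pow_mem hY j)) hZ
  exact hle (C.le_span n (by simpa using cmp_mem 𝒜 n r))

lemma aeval_pow_injective (C : IsHyperellipticCone 𝒜 g X Y Z) {d : ℕ} (hd : 0 < d) :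
    Function.Injective (MvPolynomial.aeval ![X ^ d, Y ^ d] : MvPolynomial (Fin 2) k →ₐ[k] R) := by
  have e : (MvPolynomial.aeval ![X ^ d, Y ^ d] : MvPolynomial (Fin 2) k →ₐ[k] R) =
      (MvPolynomial.aeval ![X, Y]).comp (MvPolynomial.expand d) := by
    refine MvPolynomial.algHom_ext fun i => ?_
    fin_cases i <;> simp
  rw [e]
  rw [AlgHom.coe_comp]
  exact Function.Injective.comp C.algebraicIndependent (MvPolynomial.expand_injective hd)

theorem ringKrullDim_eq (C : IsHyperellipticCone 𝒜 g X Y Z) : ringKrullDim R = 2 := by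
  let φ : MvPolynomial (Fin 2) k →ₐ[k] R := MvPolynomial.aeval ![X ^ 1, Y ^ 1]
  let _ : Algebra (MvPolynomial (Fin 2) k) R := φ.toRingHom.toAlgebra
  have : Algebra.IsIntegral (MvPolynomial (Fin 2) k) R := ⟨fun r => C.isIntegral one_pos r⟩
  rw [ringKrullDim_eq_of_isIntegral_of_injective (A := MvPolynomial (Fin 2) k)
    (C.aeval_pow_injective one_pos), MvPolynomial.ringKrullDim_of_isNoetherianRing]
  simp

variable {d : ℕ}

lemma X_pow_mem_veronese (C : IsHyperellipticCone 𝒜 g X Y Z) {n : ℕ} (h : d ∣ n) :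
    X ^ n ∈ veronese 𝒜 d :=
  mem_veronese_of_mem_gr (Int.natCast_dvd_natCast.mpr h) (by simpa using C.X_pow_mem n)

lemma Y_pow_mem_veronese (C : IsHyperellipticCone 𝒜 g X Y Z) {n : ℕ} (h : d ∣ n) :
    Y ^ n ∈ veronese 𝒜 d :=
  mem_veronese_of_mem_gr (Int.natCast_dvd_natCast.mpr (h.mul_left 2))
    (by rw [gr_natCast]; exact C.Y_pow_mem n)

theorem ringKrullDim_veronese (C : IsHyperellipticCone 𝒜 g X Y Z) (hd : 0 < d) :
    ringKrullDim (veronese 𝒜 d) = 2 := by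
  let φ : MvPolynomial (Fin 2) k →ₐ[k] R := MvPolynomial.aeval ![X ^ d, Y ^ d]
  let ψ : MvPolynomial (Fin 2) k →ₐ[k] veronese 𝒜 d :=
    MvPolynomial.aeval ![⟨X ^ d, C.X_pow_mem_veronese dvd_rfl⟩, ⟨Y ^ d, C.Y_pow_mem_veronese dvd_rfl⟩]
  have hφψ : φ = (veronese 𝒜 d).val.comp ψ := by
    refine MvPolynomial.algHom_ext fun i => ?_
    fin_cases i <;> simp [φ, ψ]
  let _ : Algebra (MvPolynomial (Fin 2) k) (veronese 𝒜 d) := ψ.toRingHom.toAlgebra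
  have : Algebra.IsIntegral (MvPolynomial (Fin 2) k) (veronese 𝒜 d) := by
    refine ⟨fun r => ?_⟩
    obtain ⟨p, hp, hpr⟩ := C.isIntegral hd (r : R)
    refine ⟨p, hp, Subtype.val_injective ?_⟩
    have e : φ.toRingHom = (veronese 𝒜 d).val.toRingHom.comp ψ.toRingHom := by
      rw [hφψ]; rfl
    change (veronese 𝒜 d).val.toRingHom (Polynomial.eval₂ ψ.toRingHom r p) = 0
    rw [Polynomial.hom_eval₂, ← e]
    exact hpr
  have hinj : Function.Injective ψ := by
    have := C.aeval_pow_injective hd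
    change Function.Injective φ at this
    rw [hφψ, AlgHom.coe_comp] at this
    exact Function.Injective.of_comp this
  rw [ringKrullDim_eq_of_isIntegral_of_injective (A := MvPolynomial (Fin 2) k) hinj,
    MvPolynomial.ringKrullDim_of_isNoetherianRing]
  simp

end IsHyperellipticCone

/-- The irrelevant ideal is the kernel of the projection to degree zero, a ring homomorphism into a
domain, hence prime. -/
lemma irrelevant_isRadical {k S : Type*} [Field k] [CommRing S] [IsDomain S] [Algebra k S]
    (𝒜 : ℕ → Submodule k S) [GradedAlgebra 𝒜] :
    (HomogeneousIdeal.irrelevant 𝒜).toIdeal.IsRadical :=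
  (RingHom.ker_isPrime (GradedRing.projZeroRingHom 𝒜)).isRadical

lemma irrelevant_ne_top {k S : Type*} [Field k] [CommRing S] [IsDomain S] [Algebra k S]
    (𝒜 : ℕ → Submodule k S) [GradedAlgebra 𝒜] :
    (HomogeneousIdeal.irrelevant 𝒜).toIdeal ≠ ⊤ :=
  (RingHom.ker_isPrime (GradedRing.projZeroRingHom 𝒜)).ne_top

lemma radical_span_eq_irrelevant {k S : Type*} [Field k] [CommRing S] [IsDomain S] [Algebra k S]
    (𝒜 : ℕ → Submodule k S) [GradedAlgebra 𝒜] {n : ℕ} {x : Fin n → S} {e : Fin n → ℕ}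
    (hpos : ∀ i, 0 < e i) (hx : ∀ i, x i ∈ 𝒜 (e i))
    (h : ∀ m r, 0 < m → r ∈ 𝒜 m → r ∈ (Ideal.span (Set.range x)).radical) :
    (Ideal.span (Set.range x)).radical = (HomogeneousIdeal.irrelevant 𝒜).toIdeal := by
  refine le_antisymm ((irrelevant_isRadical 𝒜).radical_le_iff.mpr (Ideal.span_le.mpr ?_)) ?_
  · rintro _ ⟨i, rfl⟩
    exact HomogeneousIdeal.mem_irrelevant_of_mem 𝒜 (hpos i) (hx i)
  · rw [HomogeneousIdeal.irrelevant_eq_span, Ideal.span_le]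
    intro r hr
    simp only [Set.mem_iUnion] at hr
    obtain ⟨m, hm, hr⟩ := hr
    exact h m r hm hr

end Cone

/-! ### Systems of parameters of `R` and of its Veronese subrings -/

section Parameters

variable {k R : Type*} [Field k] [CommRing R] [IsDomain R] [Algebra k R]
variable {𝒜 : ℕ → Submodule k R} [GradedAlgebra 𝒜] {g : ℕ} {X Y Z : R} {d : ℕ}

namespace IsHyperellipticCone

theorem isHomogeneousSOP (C : IsHyperellipticCone 𝒜 g X Y Z) :
    IsHomogeneousSOP 𝒜 ![X, Y] ![1, 2] := by
  have hpos : ∀ i : Fin 2, 0 < (![1, 2] : Fin 2 → ℕ) i := by decide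
  have hmem : ∀ i : Fin 2, (![X, Y] : Fin 2 → R) i ∈ 𝒜 ((![1, 2] : Fin 2 → ℕ) i) := by
    intro i
    fin_cases i
    · exact C.X_mem
    · exact C.Y_mem
  refine ⟨hpos, hmem, by rw [C.ringKrullDim_eq]; rfl,
    radical_span_eq_irrelevant 𝒜 hpos hmem fun m r hm hr => ?_⟩
  refine C.mem_radical (a := 1) (b := 1) ?_ ?_ hm hr
  · rw [pow_one]; exact Ideal.subset_span ⟨0, rfl⟩
  · rw [pow_one]; exact Ideal.subset_span ⟨1, rfl⟩

theorem isHomogeneousPair (C : IsHyperellipticCone 𝒜 g X Y Z) :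
    IsHomogeneousPair 𝒜 ![X, Y] ![1, 2] := by
  have h := C.isHomogeneousSOP
  refine ⟨h.mem, h.degree_pos, fun i => ?_, C.regular_XY⟩
  fin_cases i
  · exact C.X_ne_zero
  · exact C.Y_ne_zero

theorem hasAInvariant (C : IsHyperellipticCone 𝒜 g X Y Z) : HasAInvariant 𝒜 (2 * (g : ℤ) - 2) := by
  have P := C.isHomogeneousPair
  refine ⟨2, _, _, C.isHomogeneousSOP, ?_, fun m hm => ?_⟩
  · obtain ⟨t, s, hs, hne⟩ := P.exists_frac_ne_zero C.hasRiemannRoch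
    refine fun hbot => hne ?_
    rw [← Submodule.mem_bot k, ← hbot]
    have h0 : 0 ≤ 2 * (g : ℤ) - 2 + t * ((![1, 2] : Fin 2 → ℕ) 0 + (![1, 2] : Fin 2 → ℕ) 1) := by
      by_contra! hneg
      rw [gr_of_neg 𝒜 hneg, Submodule.mem_bot] at hs
      exact hne (by rw [hs, ← fracₗ_apply (k := k), map_zero])
    obtain ⟨l, hl⟩ := Int.eq_ofNat_of_zero_le h0
    rw [hl, gr_natCast] at hs
    exact frac_mem_grading 𝒜 _ _ hs hl.symm
  · by_contra! hlt
    refine hm (le_bot_iff.mp (grading_le 𝒜 _ _ m ⊥ fun s l t hs hl => ?_))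
    exact P.frac_eq_zero_of_lt C.hasRiemannRoch hlt (by rw [← hl, gr_natCast]; exact hs)

/-- The homogeneous system of parameters `Xᵈ, Yᵈ` of the Veronese subring. -/
theorem exists_isHomogeneousSOP_veronese [NeZero d] (C : IsHyperellipticCone 𝒜 g X Y Z) :
    ∃ x : Fin 2 → veronese 𝒜 d, IsHomogeneousSOP (veroneseGrading 𝒜 d) x ![1, 2] ∧
      RingTheory.Sequence.IsRegular (veronese 𝒜 d) (List.ofFn x) := by
  have hd : 0 < d := NeZero.pos d
  let x : Fin 2 → veronese 𝒜 d :=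
    ![⟨X ^ d, C.X_pow_mem_veronese dvd_rfl⟩, ⟨Y ^ d, C.Y_pow_mem_veronese dvd_rfl⟩]
  have hpos : ∀ i : Fin 2, 0 < (![1, 2] : Fin 2 → ℕ) i := by decide
  have hmem : ∀ i : Fin 2, x i ∈ veroneseGrading 𝒜 d ((![1, 2] : Fin 2 → ℕ) i) := by
    intro i
    fin_cases i
    · change X ^ d ∈ 𝒜 (d * 1)
      rw [mul_one]; exact C.X_pow_mem d
    · change Y ^ d ∈ 𝒜 (d * 2)
      rw [mul_comm]; exact C.Y_pow_mem d
  have hXd : X ^ d ∈ gr 𝒜 d := by rw [gr_natCast]; exact C.X_pow_mem d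
  have hYd : Y ^ d ∈ gr 𝒜 (2 * d : ℕ) := by rw [gr_natCast]; exact C.Y_pow_mem d
  have hrad : (Ideal.span (Set.range x)).radical =
      (HomogeneousIdeal.irrelevant (veroneseGrading 𝒜 d)).toIdeal := by
    refine radical_span_eq_irrelevant _ hpos hmem fun m r hm hr => ?_
    have hr' : (r : R) ∈ 𝒜 (d * m) := hr
    obtain ⟨N, hN⟩ := C.mem_radical (J := Ideal.span {X ^ d, Y ^ d}) (a := d) (b := d)
      (Ideal.subset_span (by simp)) (Ideal.subset_span (by simp)) (Nat.mul_pos hd hm) hr'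
    obtain ⟨b, c, hbc⟩ := Ideal.mem_span_pair.mp hN
    have hrN : (r : R) ^ N ∈ gr 𝒜 (N * (d * m : ℕ)) := gr_pow 𝒜 hr' N
    have h2 := exists_homogeneous_coeff 𝒜 hrN hXd hYd
      (show (r : R) ^ N = X ^ d * b + Y ^ d * c by rw [← hbc]; ring)
    refine ⟨N, ?_⟩
    have e : r ^ N =
        x 0 * ⟨_, mem_veronese_of_mem_gr ⟨(N * m - 1 : ℤ), by push_cast; ring⟩
          (cmp_mem 𝒜 (N * (d * m : ℕ) - d) b)⟩ +
        x 1 * ⟨_, mem_veronese_of_mem_gr ⟨(N * m - 2 : ℤ), by push_cast; ring⟩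
          (cmp_mem 𝒜 (N * (d * m : ℕ) - (2 * d : ℕ)) c)⟩ := Subtype.ext h2
    rw [e]
    exact Ideal.add_mem _ (Ideal.mul_mem_right _ _ (Ideal.subset_span ⟨0, rfl⟩))
      (Ideal.mul_mem_right _ _ (Ideal.subset_span ⟨1, rfl⟩))
  refine ⟨x, ⟨hpos, hmem, by rw [C.ringKrullDim_veronese hd]; rfl, hrad⟩,
    isRegular_ofFn_two x ?_ ?_ ?_⟩
  · exact fun h => pow_ne_zero d C.X_ne_zero (congrArg Subtype.val h)
  · rintro r ⟨s, hs⟩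
    obtain ⟨w, hw⟩ := (C.regular_XY.pow C.X_ne_zero C.Y_ne_zero d d) r
      ⟨s, congrArg Subtype.val hs⟩
    -- The quotient `w` exists in `R`. As `Xᵈ` is homogeneous of degree `d`, a component of `w` in a
    -- degree not divisible by `d` would produce one of `r`.
    have hwS : w ∈ veronese 𝒜 d := by
      rw [mem_veronese_iff]
      intro n hn
      have h1 := cmp_mul 𝒜 hXd n w
      rw [← hw, mem_veronese_iff.mp r.2 _ (by
        rwa [sub_zero, dvd_add_right (dvd_refl _), ← sub_zero n])] at h1
      exact (mul_eq_zero.mp h1.symm).resolve_left (pow_ne_zero d C.X_ne_zero)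
    exact ⟨⟨w, hwS⟩, Subtype.ext hw⟩
  · intro htop
    rw [htop, Ideal.radical_top] at hrad
    exact irrelevant_ne_top _ hrad.symm

/-- No homogeneous element of positive degree divides both a power of `X` and a power of `Y`. -/
lemma not_dvd_pow (C : IsHyperellipticCone 𝒜 g X Y Z) {i : ℕ} (hi : 0 < i) {u : R} (hu : u ∈ 𝒜 i)
    {m n : ℕ} (hX : u ∣ X ^ m) (hY : u ∣ Y ^ n) : False := by
  obtain ⟨b, hb⟩ := hX
  obtain ⟨c, hc⟩ := hY
  have hXm := pow_ne_zero m C.X_ne_zero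
  obtain ⟨w, hw⟩ := (C.regular_XY.pow C.X_ne_zero C.Y_ne_zero m n) b ⟨c, by rw [hb, hc]; ring⟩
  have h1 : u * w = 1 := mul_left_cancel₀ hXm (by rw [mul_one]; nth_rw 2 [hb]; rw [hw]; ring)
  have h2 := cmp_mul 𝒜 (show u ∈ gr 𝒜 i by simpa using hu) (-i) w
  rw [h1, add_neg_cancel, cmp_of_neg 𝒜 (n := -(i : ℤ)) (by omega), mul_zero, ← Nat.cast_zero, cmp_of_mem] at h2
  · exact one_ne_zero h2
  · rw [gr_natCast]; exact SetLike.one_mem_graded 𝒜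

/-- Powers of `X` and `Y` lie in the ideal of the parameters, so regularity passes from `X, Y` to
them; a zero parameter would leave the other dividing powers of both `X` and `Y`. Arbitrary
parameters must be treated because the negative results start from an unspecified system. -/
lemma isHomogeneousPair_of_isHomogeneousSOP [NeZero d] (C : IsHyperellipticCone 𝒜 g X Y Z)
    {x : Fin 2 → veronese 𝒜 d} {e : Fin 2 → ℕ}
    (hx : IsHomogeneousSOP (veroneseGrading 𝒜 d) x e) :
    IsHomogeneousPair 𝒜 (fun i => (x i : R)) (fun i => d * e i) := by
  have hd : 0 < d := NeZero.pos d
  have hpos : ∀ i, 0 < d * e i := fun i => Nat.mul_pos hd (hx.degree_pos i)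
  have hmem : ∀ i, (x i : R) ∈ 𝒜 (d * e i) := fun i => hx.mem i
  have hspan : ∀ (m : ℕ) (r : veronese 𝒜 d), 0 < m → r ∈ veroneseGrading 𝒜 d m →
      ∃ N b c, (r : R) ^ N = x 0 * b + x 1 * c := by
    intro m r hm hr
    have h1 : r ∈ (HomogeneousIdeal.irrelevant (veroneseGrading 𝒜 d)).toIdeal :=
      HomogeneousIdeal.mem_irrelevant_of_mem (veroneseGrading 𝒜 d) hm hr
    rw [← hx.radical_eq] at h1
    obtain ⟨N, hN⟩ := h1
    obtain ⟨c, hc⟩ := Ideal.mem_span_range_iff_exists_fun.mp hN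
    rw [Fin.sum_univ_two] at hc
    refine ⟨N, c 0, c 1, ?_⟩
    rw [← SubmonoidClass.coe_pow, ← hc]
    push_cast
    ring
  obtain ⟨M, b, c, hX⟩ := hspan 1 ⟨X ^ d, C.X_pow_mem_veronese dvd_rfl⟩ one_pos (by
    change X ^ d ∈ 𝒜 (d * 1)
    rw [mul_one]; exact C.X_pow_mem d)
  obtain ⟨N, b', c', hY⟩ := hspan 2 ⟨Y ^ d, C.Y_pow_mem_veronese dvd_rfl⟩ two_pos (by
    change Y ^ d ∈ 𝒜 (d * 2)
    rw [mul_comm]; exact C.Y_pow_mem d)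
  simp only [← pow_mul] at hX hY
  have hne : ∀ i, (x i : R) ≠ 0 := by
    intro i hi
    fin_cases i
    · simp only [Fin.zero_eta] at hi
      rw [hi, zero_mul, zero_add] at hX hY
      exact C.not_dvd_pow (hpos 1) (hmem 1) ⟨_, hX⟩ ⟨_, hY⟩
    · simp only [Fin.mk_one] at hi
      rw [hi, zero_mul, add_zero] at hX hY
      exact C.not_dvd_pow (hpos 0) (hmem 0) ⟨_, hX⟩ ⟨_, hY⟩
  exact ⟨hmem, hpos, hne, IsRegularPair.of_mem_span (pow_ne_zero _ C.X_ne_zero) (hne 0)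
    (C.regular_XY.pow C.X_ne_zero C.Y_ne_zero _ _) ⟨b, c, hX⟩ ⟨b', c', hY⟩⟩

/-- For every homogeneous system of parameters, the canonical module of `R^{(d)}` is isomorphic to
the module of elements of degrees congruent to `2g - 2`. -/
theorem nonempty_canonicalModule_equiv [NeZero d] (C : IsHyperellipticCone 𝒜 g X Y Z) {n : ℕ}
    {x : Fin n → veronese 𝒜 d} {e : Fin n → ℕ}
    (hx : IsHomogeneousSOP (veroneseGrading 𝒜 d) x e) :
    Nonempty (CanonicalModule (veroneseGrading 𝒜 d) x e ≃ₗ[veronese 𝒜 d]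
      clsModule 𝒜 d (2 * g - 2)) := by
  obtain rfl : n = 2 := by
    have := hx.card_eq
    rw [C.ringKrullDim_veronese (NeZero.pos d)] at this
    exact_mod_cast this.symm
  exact NearlyGor.nonempty_canonicalModule_equiv C.hasRiemannRoch
    (C.isHomogeneousPair_of_isHomogeneousSOP hx)

end IsHyperellipticCone

end Parameters

/-! ### The trace ideal and criteria for Veronese subrings -/

section Trace

lemma traceIdeal_le_of_linearEquiv {S M N : Type*} [CommRing S] [AddCommGroup M] [Module S M]
    [AddCommGroup N] [Module S N] (e : M ≃ₗ[S] N) : traceIdeal S M ≤ traceIdeal S N := by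
  refine Ideal.span_mono ?_
  rintro _ ⟨f, m, rfl⟩
  exact ⟨f ∘ₗ e.symm.toLinearMap, e m, by simp⟩

lemma traceIdeal_self (S : Type*) [CommRing S] : traceIdeal S S = ⊤ :=
  (Ideal.eq_top_iff_one _).mpr (Ideal.subset_span ⟨LinearMap.id, 1, rfl⟩)

variable {k R : Type*} [Field k] [CommRing R] [IsDomain R] [Algebra k R]
variable {𝒜 : ℕ → Submodule k R} [GradedAlgebra 𝒜] {g : ℕ} {X Y Z : R} {d : ℕ}

lemma mul_mem_traceIdeal {b : ℤ} {m q : R} (hm : m ∈ cls 𝒜 d b) (hq : q ∈ cls 𝒜 d (-b))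
    (h : m * q ∈ veronese 𝒜 d) :
    (⟨m * q, h⟩ : veronese 𝒜 d) ∈ traceIdeal (veronese 𝒜 d) (clsModule 𝒜 d b) := by
  have hmem : ∀ r : clsModule 𝒜 d b, (r : R) * q ∈ veronese 𝒜 d := fun r => by
    rw [mem_veronese_iff, ← add_neg_cancel b]
    exact cls_mul r.2 hq
  exact Ideal.subset_span ⟨
    { toFun := fun r => ⟨r * q, hmem r⟩
      map_add' := fun r r' => Subtype.ext (add_mul _ _ _)
      map_smul' := fun s r => Subtype.ext (mul_assoc _ _ _) }, ⟨m, hm⟩, rfl⟩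

namespace IsHyperellipticCone

/-- Homomorphisms between class modules are multiplications. -/
lemma exists_eq_mul (C : IsHyperellipticCone 𝒜 g X Y Z) (hd : 0 < d) {b : ℤ}
    (f : clsModule 𝒜 d b →ₗ[veronese 𝒜 d] veronese 𝒜 d) :
    ∃ q ∈ cls 𝒜 d (-b), ∀ m, (f m : R) = m * q := by
  have hd' : (d : ℤ) ≠ 0 := by exact_mod_cast hd.ne'
  have hres : ∀ c : ℤ, ∃ N : ℕ, (d : ℤ) ∣ N - c := fun c =>
    ⟨(c % d).toNat, by
      rw [Int.toNat_of_nonneg (Int.emod_nonneg c hd')]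
      exact ⟨-(c / d), by rw [Int.emod_def]; ring⟩⟩
  have hXcls : ∀ (N : ℕ) (c : ℤ), (d : ℤ) ∣ N - c → X ^ N ∈ cls 𝒜 d c := fun N c h =>
    gr_le_cls h (by rw [gr_natCast]; exact C.X_pow_mem N)
  -- This says that the fraction `f m / m` is independent of `m`. A power of `X` in class `-b` moves
  -- `m` and `m'` into `S`, where linearity of `f` applies.
  have hcomm : ∀ m m' : clsModule 𝒜 d b, (f m : R) * m' = f m' * m := by
    intro m m'
    obtain ⟨j, hj⟩ := hres (-b)
    have hS : ∀ r : clsModule 𝒜 d b, X ^ j * r ∈ veronese 𝒜 d := fun r => by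
      rw [mem_veronese_iff, ← neg_add_cancel b]
      exact cls_mul (hXcls j _ hj) r.2
    have h1 : (⟨_, hS m⟩ : veronese 𝒜 d) • m' = (⟨_, hS m'⟩ : veronese 𝒜 d) • m :=
      Subtype.ext (show X ^ j * m * m' = X ^ j * m' * (m : R) by ring)
    have h2 := congrArg (fun z => (f z : R)) h1
    simp only [map_smul] at h2
    have h3 : X ^ j * (m : R) * f m' = X ^ j * m' * f m := h2
    exact mul_left_cancel₀ (pow_ne_zero j C.X_ne_zero) (by linear_combination -h3)
  obtain ⟨N, hN⟩ := hres b
  -- The common fraction has denominators `X^N` and `W`; since they form a regular pair, it lies in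
  -- `R`. Powers of `Y` only reach even degrees, so for odd `b` a factor `Z` is needed.
  obtain ⟨W, hW, hreg⟩ : ∃ W ∈ cls 𝒜 d b, IsRegularPair (X ^ N) W := by
    rcases Int.even_or_odd' b with ⟨c, rfl | rfl⟩
    · obtain ⟨M, hM⟩ := hres c
      refine ⟨Y ^ M, gr_le_cls ?_ (by rw [gr_natCast]; exact C.Y_pow_mem M),
        C.regular_XY.pow C.X_ne_zero C.Y_ne_zero N M⟩
      push_cast
      rw [← mul_sub]
      exact hM.mul_left 2
    · obtain ⟨M, hM⟩ := hres (c - g)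
      refine ⟨Y ^ M * Z, gr_le_cls (n := (2 * M + (2 * g + 1) : ℕ)) ?_ ?_,
        (C.regular_XY.pow C.X_ne_zero C.Y_ne_zero N M).mul_right ?_⟩
      · obtain ⟨l, hl⟩ := hM
        refine ⟨2 * l, ?_⟩
        push_cast
        linear_combination 2 * hl
      · rw [gr_natCast]; exact SetLike.mul_mem_graded (C.Y_pow_mem M) C.Z_mem
      · simpa using C.regular_XZ.pow C.X_ne_zero C.Z_ne_zero N 1
  obtain ⟨q, hq⟩ := hreg (f ⟨X ^ N, hXcls N b hN⟩)
    ⟨f ⟨W, hW⟩, by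
      have := hcomm ⟨X ^ N, hXcls N b hN⟩ ⟨W, hW⟩
      simp only at this
      rw [mul_comm, this, mul_comm]⟩
  refine ⟨q, fun n hn => ?_, fun m => ?_⟩
  · have h1 := cmp_mul 𝒜 (show X ^ N ∈ gr 𝒜 N by rw [gr_natCast]; exact C.X_pow_mem N) n q
    rw [← hq, mem_veronese_iff.mp (f _).2 _ (fun h => hn ?_)] at h1
    · exact (mul_eq_zero.mp h1.symm).resolve_left (pow_ne_zero N C.X_ne_zero)
    · have := dvd_sub h hN
      rwa [show (N : ℤ) + n - 0 - (N - b) = n - -b by ring] at this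
  · have h1 := hcomm ⟨X ^ N, hXcls N b hN⟩ m
    rw [hq] at h1
    exact mul_left_cancel₀ (pow_ne_zero N C.X_ne_zero) (by linear_combination -h1)

/-- Tests trace elements against products of homogeneous elements. Since `N` is only a `k`-subspace,
the proof carries along all `S`-multiples of the trace element, absorbing the multiplier into the
second factor. -/
lemma traceIdeal_induction (C : IsHyperellipticCone 𝒜 g X Y Z) (hd : 0 < d) {b : ℤ}
    {N : Submodule k R}
    (h : ∀ (s t : ℕ) (m q : R), (d : ℤ) ∣ s - b → m ∈ 𝒜 s → q ∈ 𝒜 t → m * q ∈ N)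
    {z : veronese 𝒜 d} (hz : z ∈ traceIdeal (veronese 𝒜 d) (clsModule 𝒜 d b)) : (z : R) ∈ N := by
  have hmul : ∀ m q : R, m ∈ cls 𝒜 d b → m * q ∈ N := by
    intro m q hm
    have h1 : cls 𝒜 d b ≤ N.comap (LinearMap.mulRight k q) := by
      refine cls_le fun s hs m hm => ?_
      obtain ⟨S, hS⟩ := sum_cmp 𝒜 q
      change m * q ∈ N
      rw [hS, Finset.mul_sum]
      refine N.sum_mem fun t _ => ?_
      refine gr_induction 𝒜 (P := fun s m => (d : ℤ) ∣ s - b → m * cmp 𝒜 t q ∈ N)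
        (fun _ _ => by rw [zero_mul]; exact N.zero_mem) (fun s m hm hs => ?_) hm hs
      exact h s t m _ hs hm (by simpa using cmp_mem 𝒜 t q)
    exact h1 hm
  suffices H : ∀ z : veronese 𝒜 d, z ∈ traceIdeal (veronese 𝒜 d) (clsModule 𝒜 d b) →
      ∀ s : veronese 𝒜 d, ((s * z : veronese 𝒜 d) : R) ∈ N by
    simpa using H z hz 1
  intro z hz
  induction hz using Submodule.span_induction with
  | zero => intro s; rw [mul_zero]; exact N.zero_mem
  | add z w _ _ hz hw => intro s; rw [mul_add]; exact N.add_mem (hz s) (hw s)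
  | smul r z _ hz => intro s; rw [smul_eq_mul, ← mul_assoc]; exact hz (s * r)
  | mem z hz =>
    obtain ⟨f, m, rfl⟩ := hz
    intro s
    obtain ⟨q, -, hq⟩ := C.exists_eq_mul hd f
    have e : ((s * f m : veronese 𝒜 d) : R) = m * (s * q) := by
      change (s : R) * f m = _
      rw [hq]; ring
    rw [e]
    exact hmul _ _ m.2

variable [NeZero d]

theorem isGradedGorenstein_veronese_iff (C : IsHyperellipticCone 𝒜 g X Y Z) :
    IsGradedGorenstein (veroneseGrading 𝒜 d) ↔ (d : ℤ) ∣ 2 * g - 2 := by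
  constructor
  · rintro ⟨-, n, x, e, hx, ⟨φ⟩⟩
    by_contra hda
    obtain ⟨ψ⟩ := C.nonempty_canonicalModule_equiv hx
    have h1 := traceIdeal_le_of_linearEquiv (φ.symm.trans ψ)
    rw [traceIdeal_self, top_le_iff] at h1
    have h2 : (1 : veronese 𝒜 d) ∈ traceIdeal (veronese 𝒜 d) (clsModule 𝒜 d (2 * g - 2)) := by
      rw [h1]; trivial
    -- A product with a nonzero degree `0` component would have `s = t = 0`, which puts `0` in the
    -- class of `2g - 2`, contrary to `hda`. So `1` could not lie in the trace.
    have h3 := C.traceIdeal_induction (NeZero.pos d) (N := LinearMap.ker (cmp 𝒜 0)) ?_ h2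
    · have h4 : (1 : R) ∈ gr 𝒜 ((0 : ℕ) : ℤ) := by rw [gr_natCast]; exact SetLike.one_mem_graded 𝒜
      change cmp 𝒜 ((0 : ℕ) : ℤ) (1 : R) = 0 at h3
      rw [cmp_of_mem 𝒜 h4] at h3
      exact one_ne_zero h3
    · intro s t m q hs hm hq
      have hmq : m * q ∈ gr 𝒜 (s + t : ℕ) := by
        rw [gr_natCast]; exact SetLike.mul_mem_graded hm hq
      refine cmp_of_mem_ne 𝒜 hmq fun h => hda ?_
      have hs0 : s = 0 := by omega
      rw [hs0, Nat.cast_zero, zero_sub, dvd_neg] at hs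
      exact hs
  · intro hda
    obtain ⟨x, hx, hreg⟩ := C.exists_isHomogeneousSOP_veronese (d := d)
    obtain ⟨ψ⟩ := C.nonempty_canonicalModule_equiv hx
    have hcls : ∀ r : R, r ∈ clsModule 𝒜 d (2 * g - 2) ↔ r ∈ veronese 𝒜 d := by
      intro r
      rw [mem_veronese_iff, mem_clsModule]
      change (∀ n : ℤ, _) ↔ ∀ n : ℤ, _
      refine forall_congr' fun n => ?_
      rw [sub_zero, dvd_sub_left hda]
    exact ⟨⟨2, x, _, hx, hreg⟩, 2, x, _, hx, ⟨ψ.trans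
      { toFun := fun r => ⟨r, (hcls r).mp r.2⟩
        map_add' := fun r r' => rfl
        map_smul' := fun s r => rfl
        invFun := fun r => ⟨r, (hcls r).mpr r.2⟩
        left_inv := fun r => rfl
        right_inv := fun r => rfl }⟩⟩

/-- A necessary condition for nearly Gorenstein Veronese subrings: `X ^ i * Z` must be a product. -/
theorem exists_of_isNearlyGorenstein (C : IsHyperellipticCone 𝒜 g X Y Z)
    (h : IsNearlyGorenstein (veroneseGrading 𝒜 d)) {m : ℕ} (hm : 0 < m)
    (hdm : 2 * g + 1 ≤ d * m) : ∃ s t : ℕ, s + t = d * m ∧ (d : ℤ) ∣ s - (2 * g - 2) ∧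
      (2 * g + 1 ≤ s ∨ 2 * g + 1 ≤ t) := by
  obtain ⟨-, n, x, e, hx, hle⟩ := h
  obtain ⟨ψ⟩ := C.nonempty_canonicalModule_equiv hx
  by_contra! hno
  obtain ⟨i, hi⟩ := Nat.exists_eq_add_of_le hdm
  have hmem : X ^ i * Z ∈ 𝒜 (d * m) := by
    have := C.monomial_mul_Z_mem i 0
    rwa [pow_zero, mul_one, mul_zero, add_zero, add_comm, ← hi] at this
  have hS : X ^ i * Z ∈ veronese 𝒜 d :=
    mem_veronese_of_mem_gr (n := (d * m : ℕ)) (by push_cast; exact dvd_mul_right _ _)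
      (by rw [gr_natCast]; exact hmem)
  have h1 : (⟨_, hS⟩ : veronese 𝒜 d) ∈
      (HomogeneousIdeal.irrelevant (veroneseGrading 𝒜 d)).toIdeal :=
    HomogeneousIdeal.mem_irrelevant_of_mem (veroneseGrading 𝒜 d) hm hmem
  have h2 := traceIdeal_le_of_linearEquiv ψ (hle h1)
  have hlow : ∀ s, s < 2 * g + 1 → 𝒜 s ≤ Subalgebra.toSubmodule (Algebra.adjoin k {X, Y}) := by
    intro s hs
    refine (C.le_span s).trans (Submodule.span_le.mpr ?_)
    rintro _ (⟨i, j, h, rfl⟩ | ⟨i, j, h, rfl⟩)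
    · exact (Algebra.adjoin k {X, Y}).mul_mem
        ((Algebra.adjoin k {X, Y}).pow_mem (Algebra.subset_adjoin (by simp)) i)
        ((Algebra.adjoin k {X, Y}).pow_mem (Algebra.subset_adjoin (by simp)) j)
    · omega
  -- If no admissible splitting has a factor of degree at least `2g + 1`, the degree `dm` part of
  -- the trace lies in `k[X, Y]`, which does not contain `X^i Z`.
  have h3 := C.traceIdeal_induction (NeZero.pos d)
    (N := (Subalgebra.toSubmodule (Algebra.adjoin k {X, Y})).comap (cmp 𝒜 (d * m : ℕ))) ?_ h2
  · change cmp 𝒜 (d * m : ℕ) (X ^ i * Z) ∈ Algebra.adjoin k {X, Y} at h3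
    rw [cmp_of_mem 𝒜 (by rw [gr_natCast]; exact hmem)] at h3
    exact C.mul_Z_notMem i h3
  · intro s t r q hs hr hq
    have hrq : r * q ∈ gr 𝒜 (s + t : ℕ) := by
      rw [gr_natCast]; exact SetLike.mul_mem_graded hr hq
    change cmp 𝒜 (d * m : ℕ) (r * q) ∈ Algebra.adjoin k {X, Y}
    by_cases hst : s + t = d * m
    · rw [← hst, cmp_of_mem 𝒜 hrq]
      obtain ⟨h1, h2⟩ := hno s t hst hs
      exact mul_mem (hlow s h1 hr) (hlow t h2 hq)
    · rw [cmp_of_mem_ne 𝒜 hrq (by omega)]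
      exact zero_mem _

/-- The factor of even degree takes as many `Y` as fit and is filled up with `X`. Some parity
condition is necessary, since a power of `Y` has no factor of odd degree among monomials. -/
lemma exists_split {i j s t : ℕ} (h : i + 2 * j = s + t) (hs : 2 ∣ s ∨ 2 ∣ t) :
    ∃ i₁ j₁ i₂ j₂, i₁ + i₂ = i ∧ j₁ + j₂ = j ∧ i₁ + 2 * j₁ = s ∧ i₂ + 2 * j₂ = t := by
  rcases hs with ⟨c, rfl⟩ | ⟨c, rfl⟩
  · rcases le_total c j with hc | hc
    · exact ⟨0, c, i, j - c, by omega, by omega, by omega, by omega⟩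
    · exact ⟨2 * (c - j), j, i - 2 * (c - j), 0, by omega, by omega, by omega, by omega⟩
  · rcases le_total c j with hc | hc
    · exact ⟨i, j - c, 0, c, by omega, by omega, by omega, by omega⟩
    · exact ⟨i - 2 * (c - j), 0, 2 * (c - j), j, by omega, by omega, by omega, by omega⟩

/-- A sufficient condition for nearly Gorenstein Veronese subrings: the monomials of positive
degree split as products. -/
theorem isNearlyGorenstein_veronese (C : IsHyperellipticCone 𝒜 g X Y Z)
    (h₁ : ∀ m, 0 < m → ∃ s t : ℕ, s + t = d * m ∧ (d : ℤ) ∣ s - (2 * g - 2) ∧ (2 ∣ s ∨ 2 ∣ t))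
    (h₂ : ∀ m, 0 < m → 2 * g + 1 ≤ d * m → ∃ s t : ℕ, s + t = d * m ∧
      ((d : ℤ) ∣ s - (2 * g - 2) ∨ (d : ℤ) ∣ t - (2 * g - 2)) ∧ 2 * g + 1 ≤ t ∧
      (2 ∣ s ∨ ¬ 2 ∣ t)) :
    IsNearlyGorenstein (veroneseGrading 𝒜 d) := by
  obtain ⟨x, hx, hreg⟩ := C.exists_isHomogeneousSOP_veronese (d := d)
  obtain ⟨ψ⟩ := C.nonempty_canonicalModule_equiv hx
  refine ⟨⟨2, x, _, hx, hreg⟩, 2, x, _, hx, ?_⟩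
  refine le_trans ?_ (traceIdeal_le_of_linearEquiv ψ.symm)
  set T := traceIdeal (veronese 𝒜 d) (clsModule 𝒜 d (2 * g - 2)) with hT
  have hprod : ∀ (s t m : ℕ) (r q z : R) (hz : z ∈ veronese 𝒜 d), s + t = d * m →
      ((d : ℤ) ∣ s - (2 * g - 2) ∨ (d : ℤ) ∣ t - (2 * g - 2)) → r ∈ 𝒜 s → q ∈ 𝒜 t → z = r * q →
      (⟨z, hz⟩ : veronese 𝒜 d) ∈ T := by
    intro s t m r q z hz hst hs hr hq hzrq
    subst hzrq
    have hst' : (s : ℤ) + t = d * m := by exact_mod_cast hst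
    have hr' : ∀ (u : ℕ) (p : R), p ∈ 𝒜 u → p ∈ gr 𝒜 u := fun u p hp => by simpa using hp
    rcases hs with hs | hs
    · refine mul_mem_traceIdeal (gr_le_cls hs (hr' s r hr)) (gr_le_cls ?_ (hr' t q hq)) hz
      rw [show (t : ℤ) - -(2 * g - 2) = d * m - (s - (2 * g - 2)) by rw [← hst']; ring]
      exact dvd_sub (dvd_mul_right _ _) hs
    · have hz' : q * r ∈ veronese 𝒜 d := by rwa [mul_comm]
      have := mul_mem_traceIdeal (gr_le_cls hs (hr' t q hq))
        (gr_le_cls (n := s) (d := d) (b := -(2 * g - 2)) ?_ (hr' s r hr)) hz'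
      · convert this using 2
        exact mul_comm _ _
      · rw [show (s : ℤ) - -(2 * g - 2) = d * m - (t - (2 * g - 2)) by rw [← hst']; ring]
        exact dvd_sub (dvd_mul_right _ _) hs
  rw [HomogeneousIdeal.irrelevant_eq_span, Ideal.span_le]
  intro z hz
  simp only [Set.mem_iUnion] at hz
  obtain ⟨m, hm, hz⟩ := hz
  have hz' : (z : R) ∈ 𝒜 (d * m) := hz
  have hVgr : ∀ r ∈ 𝒜 (d * m), r ∈ veronese 𝒜 d := fun r hr =>
    mem_veronese_of_mem_gr (n := (d * m : ℕ)) (by push_cast; exact dvd_mul_right _ _)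
      (by rw [gr_natCast]; exact hr)
  let TR : Submodule k R := (T.restrictScalars k).map (veronese 𝒜 d).val.toLinearMap
  suffices H : (z : R) ∈ TR by
    obtain ⟨w, hw, hwz⟩ := H
    have : w = z := Subtype.ext hwz
    exact this ▸ hw
  refine (Submodule.span_le.mpr ?_ : _ ≤ TR) (C.le_span _ hz')
  rintro _ (⟨i, j, hij, rfl⟩ | ⟨i, j, hij, rfl⟩)
  · obtain ⟨s, t, hst, hs, hpar⟩ := h₁ m hm
    obtain ⟨i₁, j₁, i₂, j₂, rfl, rfl, rfl, rfl⟩ := exists_split (hij.trans hst.symm) hpar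
    have e : X ^ (i₁ + i₂) * Y ^ (j₁ + j₂) = X ^ i₁ * Y ^ j₁ * (X ^ i₂ * Y ^ j₂) := by ring
    exact ⟨⟨_, hVgr _ (hij ▸ C.monomial_mem _ _)⟩, hprod _ _ m _ _ _ _ hst (Or.inl hs)
      (C.monomial_mem i₁ j₁) (C.monomial_mem i₂ j₂) e, rfl⟩
  · obtain ⟨s, t, hst, hs, hwt, hpar⟩ := h₂ m hm (by omega)
    obtain ⟨t', rfl⟩ := Nat.exists_eq_add_of_le' hwt
    obtain ⟨i₁, j₁, i₂, j₂, rfl, rfl, rfl, rfl⟩ :=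
      exists_split (i := i) (j := j) (s := s) (t := t') (by omega) (by omega)
    have e : X ^ (i₁ + i₂) * Y ^ (j₁ + j₂) * Z = X ^ i₁ * Y ^ j₁ * (X ^ i₂ * Y ^ j₂ * Z) := by ring
    exact ⟨⟨_, hVgr _ (hij ▸ C.monomial_mul_Z_mem _ _)⟩, hprod _ _ m _ _ _ _ hst hs
      (C.monomial_mem i₁ j₁) (C.monomial_mul_Z_mem i₂ j₂) e, rfl⟩

end IsHyperellipticCone

end Trace

/-! ### The ring `k[X, Y, Z] / (Z² + f(X², Y))` as a free module over `k[X, Y]` -/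

lemma eq_zero_of_X_sq_add_C_dvd {A : Type*} [CommRing A] [Nontrivial A] {a p q : A}
    (h : Polynomial.X ^ 2 + Polynomial.C a ∣ Polynomial.C q * Polynomial.X + Polynomial.C p) :
    p = 0 ∧ q = 0 := by
  have h0 : Polynomial.C q * Polynomial.X + Polynomial.C p = 0 := by
    by_contra hne
    have hdeg : (Polynomial.C q * Polynomial.X + Polynomial.C p).degree <
        (Polynomial.X ^ 2 + Polynomial.C a).degree := by
      rw [Polynomial.degree_X_pow_add_C (by norm_num)]
      exact lt_of_le_of_lt Polynomial.degree_linear_le (by norm_num)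
    exact (Polynomial.monic_X_pow_add_C a two_ne_zero).not_dvd_of_degree_lt hne hdeg h
  constructor
  · simpa using congrArg (fun P => Polynomial.coeff P 0) h0
  · simpa using congrArg (fun P => Polynomial.coeff P 1) h0

section Concrete

open MvPolynomial

variable {k : Type*} [Field k]

/-- `f(X², Y) = X² q + c Y ^ n` for a binary form `f` of degree `n`. -/
lemma exists_substSq_eq {n : ℕ} {f : MvPolynomial (Fin 2) k} (hf : f.IsHomogeneous n) :
    ∃ (q : MvPolynomial (Fin 2) k) (c : k), substSq f = X 0 ^ 2 * q + C c * X 1 ^ n := by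
  have hdvd : (X 0 : MvPolynomial (Fin 2) k) ∣
      f - C (coeff (Finsupp.single 1 n) f) * X 1 ^ n := by
    rw [X_dvd_iff_modMonomial_eq_zero]
    ext m
    rw [coeff_zero]
    by_cases hm : Finsupp.single 0 1 ≤ m
    · exact coeff_modMonomial_of_le _ hm
    · rw [coeff_modMonomial_of_not_le _ hm, coeff_sub, coeff_C_mul, coeff_X_pow]
      have hm0 : m 0 = 0 := by
        by_contra h
        exact hm (Finsupp.single_le_iff.mpr (Nat.one_le_iff_ne_zero.mpr h))
      by_cases hmn : Finsupp.single 1 n = m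
      · simp [hmn]
      · rw [if_neg hmn, mul_zero, sub_zero]
        by_contra hc
        have hdeg := hf hc
        rw [Finsupp.weight_apply, Finsupp.sum_fintype _ _ (by simp), Fin.sum_univ_two, hm0] at hdeg
        refine hmn (Finsupp.ext fun i => ?_)
        fin_cases i
        · simp [hm0]
        · simpa using hdeg.symm
  obtain ⟨q, hq⟩ := hdvd
  refine ⟨substSq q, coeff (Finsupp.single 1 n) f, ?_⟩
  have h1 := congrArg (aeval ![X 0 ^ 2, X 1] : MvPolynomial (Fin 2) k → MvPolynomial (Fin 2) k)
    (sub_eq_iff_eq_add.mp hq)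
  simpa [substSq, algHom_C] using h1

lemma degreeOf_substSq_le {n : ℕ} {f : MvPolynomial (Fin 2) k} (hf : f.IsHomogeneous n) :
    degreeOf 1 (substSq f) ≤ n := by
  rw [substSq, aeval_def, eval₂_eq']
  refine (degreeOf_sum_le _ _ _).trans (Finset.sup_le fun m hm => ?_)
  have hdeg := hf (mem_support_iff.mp hm)
  rw [Finsupp.weight_apply, Finsupp.sum_fintype _ _ (by simp), Fin.sum_univ_two] at hdeg
  simp only [Pi.one_apply, smul_eq_mul, mul_one] at hdeg
  rw [Fin.prod_univ_two, algebraMap_eq]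
  refine (degreeOf_C_mul_le _ _ _).trans ((degreeOf_mul_le _ _ _).trans ?_)
  have h0 : degreeOf 1 ((![X 0 ^ 2, X 1] : Fin 2 → MvPolynomial (Fin 2) k) 0 ^ m 0) = 0 := by
    have h1 := degreeOf_pow_le (1 : Fin 2) (X 0 : MvPolynomial (Fin 2) k) (2 * m 0)
    rw [degreeOf_X, if_neg (by decide), mul_zero] at h1
    simp only [Matrix.cons_val_zero, ← pow_mul]
    omega
  have h1 : degreeOf 1 ((![X 0 ^ 2, X 1] : Fin 2 → MvPolynomial (Fin 2) k) 1 ^ m 1) ≤ m 1 := by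
    have h1 := degreeOf_pow_le (1 : Fin 2) (X 1 : MvPolynomial (Fin 2) k) (m 1)
    rw [degreeOf_X, if_pos rfl, mul_one] at h1
    simp only [Matrix.cons_val_one, Matrix.cons_val_fin_one]
    exact h1
  omega

/-- The form `f(X², Y)` is not divisible by `X` and has odd degree in `Y`. -/
lemma substSq_properties {g : ℕ} {f : MvPolynomial (Fin 2) k} (hf : f.IsHomogeneous (2 * g + 1))
    (hsq : Squarefree (substSq f)) :
    ¬ X 0 ∣ substSq f ∧ degreeOf 1 (substSq f) = 2 * g + 1 := by
  obtain ⟨q, c, h⟩ := exists_substSq_eq hf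
  have hX : Prime (X 0 : MvPolynomial (Fin 2) k) := X_prime
  -- Without the term in `Y ^ (2g + 1)` the form would be divisible by `X²`, against squarefreeness.
  have hc : c ≠ 0 := by
    rintro rfl
    refine hX.not_isUnit (hsq _ ⟨q, ?_⟩)
    rw [h, C_0, zero_mul, add_zero, sq]
  have hnd : ¬ X 0 ∣ substSq f := by
    intro hd
    rw [h, dvd_add_right ⟨X 0 * q, by ring⟩] at hd
    rcases hX.dvd_or_dvd hd with h1 | h1
    · exact hX.not_isUnit (isUnit_of_dvd_unit h1 ((isUnit_iff_ne_zero.mpr hc).map C))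
    · exact absurd (X_dvd_X.mp (hX.dvd_of_dvd_pow h1)) (by decide)
  refine ⟨hnd, le_antisymm (degreeOf_substSq_le hf) ?_⟩
  have hcoeff : coeff (Finsupp.single 1 (2 * g + 1)) (substSq f) ≠ 0 := by
    rw [h, coeff_add, coeff_C_mul, coeff_X_pow, if_pos rfl, mul_one, sq, mul_assoc, coeff_X_mul',
      if_neg (by simp), zero_add]
    exact hc
  have := monomial_le_degreeOf 1 (mem_support_iff.mpr hcoeff)
  simpa using this

variable (f : MvPolynomial (Fin 2) k)

/-- The map `k[X, Y] → R`. -/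
def baseMap : MvPolynomial (Fin 2) k →ₐ[k] HyperellipticRing f :=
  (Ideal.Quotient.mkₐ k (Ideal.span {hyperellipticEquation f})).comp (aeval ![X 0, X 1])

/-- The class of the variable number `i`. -/
def gen (i : Fin 3) : HyperellipticRing f := Ideal.Quotient.mkₐ k _ (X i)

@[simp] lemma baseMap_X_zero : baseMap f (X 0) = gen f 0 := by simp [baseMap, gen]

@[simp] lemma baseMap_X_one : baseMap f (X 1) = gen f 1 := by simp [baseMap, gen]

lemma aeval_substSq : (aeval ![X 0, X 1] : MvPolynomial (Fin 2) k →ₐ[k] MvPolynomial (Fin 3) k)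
    (substSq f) = aeval ![X 0 ^ 2, X 1] f := by
  rw [substSq, ← AlgHom.comp_apply]
  congr 1
  refine algHom_ext fun i => ?_
  fin_cases i <;> simp

lemma gen_two_sq : gen f 2 ^ 2 = - baseMap f (substSq f) := by
  rw [eq_neg_iff_add_eq_zero]
  rw [baseMap, AlgHom.comp_apply, aeval_substSq, gen, ← map_pow, ← map_add]
  exact Ideal.Quotient.eq_zero_iff_mem.mpr (Ideal.mem_span_singleton_self _)

lemma exists_eq_baseMap_add (r : HyperellipticRing f) :
    ∃ p q, r = baseMap f p + baseMap f q * gen f 2 := by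
  obtain ⟨P, rfl⟩ := Ideal.Quotient.mk_surjective r
  induction P using MvPolynomial.induction_on with
  | C a =>
    refine ⟨C a, 0, ?_⟩
    rw [map_zero, zero_mul, add_zero]
    exact ((baseMap f).commutes a).symm
  | add P Q hP hQ =>
    obtain ⟨p, q, h⟩ := hP
    obtain ⟨p', q', h'⟩ := hQ
    exact ⟨p + p', q + q', by rw [map_add, h, h', map_add, map_add]; ring⟩
  | mul_X P i hP =>
    obtain ⟨p, q, h⟩ := hP
    have hi : Ideal.Quotient.mk (Ideal.span {hyperellipticEquation f}) (X i) = gen f i := rfl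
    rw [map_mul, h, hi]
    fin_cases i
    · refine ⟨p * X 0, q * X 0, ?_⟩
      rw [map_mul, map_mul, baseMap_X_zero]
      simp only [Fin.zero_eta]
      ring
    · refine ⟨p * X 1, q * X 1, ?_⟩
      rw [map_mul, map_mul, baseMap_X_one]
      simp only [Fin.mk_one]
      ring
    · refine ⟨-(q * substSq f), p, ?_⟩
      rw [map_neg, map_mul]
      simp only [Fin.reduceFinMk]
      linear_combination baseMap f q * gen_two_sq f

variable (k) in
lemma exists_algHom_polynomial :
    ∃ Φ : MvPolynomial (Fin 3) k →ₐ[k] Polynomial (MvPolynomial (Fin 2) k),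
      (∀ p : MvPolynomial (Fin 2) k, Φ (aeval ![X 0, X 1] p) = Polynomial.C p) ∧
      Φ (X 2) = Polynomial.X := by
  let Φ : MvPolynomial (Fin 3) k →ₐ[k] Polynomial (MvPolynomial (Fin 2) k) :=
    aeval ![Polynomial.C (X 0), Polynomial.C (X 1), Polynomial.X]
  have h : Φ.comp (aeval ![X 0, X 1]) = Polynomial.CAlgHom := by
    refine algHom_ext fun i => ?_
    fin_cases i <;> simp [Φ]
  exact ⟨Φ, AlgHom.congr_fun h, by simp [Φ]⟩

lemma eq_zero_of_baseMap_add {p q : MvPolynomial (Fin 2) k}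
    (h : baseMap f p + baseMap f q * gen f 2 = 0) : p = 0 ∧ q = 0 := by
  obtain ⟨Φ, hΦ, hX2⟩ := exists_algHom_polynomial k
  obtain ⟨c, hc⟩ : hyperellipticEquation f ∣ aeval ![X 0, X 1] p + aeval ![X 0, X 1] q * X 2 := by
    refine Ideal.mem_span_singleton.mp (Ideal.Quotient.eq_zero_iff_mem.mp ?_)
    rw [map_add, map_mul]
    exact h
  have hE : Φ (hyperellipticEquation f) = Polynomial.X ^ 2 + Polynomial.C (substSq f) := by
    rw [hyperellipticEquation, ← aeval_substSq, map_add, map_pow, hΦ, hX2]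
  have e : Φ (aeval ![X 0, X 1] p + aeval ![X 0, X 1] q * X 2) =
      Polynomial.C q * Polynomial.X + Polynomial.C p := by
    rw [map_add, map_mul, hΦ, hΦ, hX2, add_comm]
  exact eq_zero_of_X_sq_add_C_dvd (a := substSq f) ⟨Φ c, by rw [← hE, ← map_mul, ← hc, e]⟩

/-- `R` is free over `k[X, Y]` with basis `1, Z`. -/
def freeEquiv : (MvPolynomial (Fin 2) k × MvPolynomial (Fin 2) k) ≃ₗ[k] HyperellipticRing f :=
  LinearEquiv.ofBijective
    ((baseMap f).toLinearMap.coprod (LinearMap.mulRight k (gen f 2) ∘ₗ (baseMap f).toLinearMap)) <| by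
    constructor
    · rw [← LinearMap.ker_eq_bot, eq_bot_iff]
      rintro ⟨p, q⟩ h
      obtain ⟨rfl, rfl⟩ := eq_zero_of_baseMap_add f (p := p) (q := q) h
      rfl
    · intro r
      obtain ⟨p, q, rfl⟩ := exists_eq_baseMap_add f r
      exact ⟨(p, q), rfl⟩

lemma freeEquiv_apply (p q : MvPolynomial (Fin 2) k) :
    freeEquiv f (p, q) = baseMap f p + baseMap f q * gen f 2 := rfl

lemma baseMap_add_inj {p q p' q' : MvPolynomial (Fin 2) k}
    (h : baseMap f p + baseMap f q * gen f 2 = baseMap f p' + baseMap f q' * gen f 2) :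
    p = p' ∧ q = q' := by
  have := (freeEquiv f).injective (a₁ := (p, q)) (a₂ := (p', q')) h
  simpa using this

lemma baseMap_injective : Function.Injective (baseMap f) := fun p p' h =>
  (baseMap_add_inj f (q := 0) (q' := 0) (by rw [h])).1

variable {f}

/-- Compare degrees in `Y`: a nonzero `p²` has even degree, while `f(X², Y) q²` has odd degree. -/
lemma eq_zero_of_norm_eq_zero {g : ℕ} (hF : degreeOf 1 (substSq f) = 2 * g + 1)
    {p q : MvPolynomial (Fin 2) k} (h : p ^ 2 + substSq f * q ^ 2 = 0) : p = 0 ∧ q = 0 := by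
  have hF0 : substSq f ≠ 0 := by
    intro h0
    rw [h0, degreeOf_zero] at hF
    omega
  by_cases hq : q = 0
  · subst hq
    simpa using h
  · exfalso
    have hp : p ≠ 0 := by
      rintro rfl
      simp [hF0, hq] at h
    have h1 : p ^ 2 = -(substSq f * q ^ 2) := eq_neg_of_add_eq_zero_left h
    have h2 := congrArg (degreeOf 1) h1
    rw [degreeOf_neg, degreeOf_mul_eq hF0 (pow_ne_zero 2 hq), degreeOf_pow_eq _ _ _ hp,
      degreeOf_pow_eq _ _ _ hq, hF] at h2
    omega

lemma isDomain_hyperellipticRing {g : ℕ} (hF : degreeOf 1 (substSq f) = 2 * g + 1) :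
    IsDomain (HyperellipticRing f) := by
  have : Nontrivial (HyperellipticRing f) := (baseMap_injective f).nontrivial
  have : NoZeroDivisors (HyperellipticRing f) := by
    refine ⟨fun {r s} hrs => ?_⟩
    by_contra! hne
    obtain ⟨hr, hs⟩ := hne
    obtain ⟨p, q, rfl⟩ := exists_eq_baseMap_add f r
    obtain ⟨p', q', rfl⟩ := exists_eq_baseMap_add f s
    -- Multiplying `r s = 0` by the conjugate `p - q Z` turns the first factor into its norm, which
    -- lies in `k[X, Y]`.
    have h1 : baseMap f ((p ^ 2 + substSq f * q ^ 2) * p') +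
        baseMap f ((p ^ 2 + substSq f * q ^ 2) * q') * gen f 2 = 0 := by
      simp only [map_mul, map_add, map_pow]
      linear_combination (baseMap f p - baseMap f q * gen f 2) * hrs +
        (baseMap f q ^ 2 * baseMap f p' + baseMap f q ^ 2 * baseMap f q' * gen f 2) * gen_two_sq f
    obtain ⟨h2, h3⟩ := eq_zero_of_baseMap_add f h1
    have hN : p ^ 2 + substSq f * q ^ 2 ≠ 0 := by
      intro hN
      obtain ⟨rfl, rfl⟩ := eq_zero_of_norm_eq_zero hF hN
      simp at hr
    rw [(mul_eq_zero.mp h2).resolve_left hN, (mul_eq_zero.mp h3).resolve_left hN] at hs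
    simp at hs
  exact NoZeroDivisors.to_isDomain _

lemma regular_X_Y : IsRegularPair (gen f 0) (gen f 1) := by
  have hX : Prime (X 0 : MvPolynomial (Fin 2) k) := X_prime
  have hXY : ¬ (X 0 : MvPolynomial (Fin 2) k) ∣ X 1 := fun h => absurd (X_dvd_X.mp h) (by decide)
  rintro r ⟨s, hs⟩
  obtain ⟨p, q, rfl⟩ := exists_eq_baseMap_add f r
  obtain ⟨p', q', rfl⟩ := exists_eq_baseMap_add f s
  obtain ⟨h1, h2⟩ := baseMap_add_inj f (p := X 1 * p) (q := X 1 * q) (p' := X 0 * p')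
    (q' := X 0 * q') (by
      simp only [map_mul, baseMap_X_zero, baseMap_X_one]
      linear_combination hs)
  obtain ⟨u, rfl⟩ := (hX.dvd_or_dvd ⟨p', h1⟩).resolve_left hXY
  obtain ⟨v, rfl⟩ := (hX.dvd_or_dvd ⟨q', h2⟩).resolve_left hXY
  exact ⟨baseMap f u + baseMap f v * gen f 2, by simp only [map_mul, baseMap_X_zero]; ring⟩

lemma regular_X_Z (hF : ¬ X 0 ∣ substSq f) : IsRegularPair (gen f 0) (gen f 2) := by
  have hX : Prime (X 0 : MvPolynomial (Fin 2) k) := X_prime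
  rintro r ⟨s, hs⟩
  obtain ⟨p, q, rfl⟩ := exists_eq_baseMap_add f r
  obtain ⟨p', q', rfl⟩ := exists_eq_baseMap_add f s
  obtain ⟨h1, rfl⟩ := baseMap_add_inj f (p := -(substSq f * q)) (q := p) (p' := X 0 * p')
    (q' := X 0 * q') (by
      simp only [map_mul, map_neg, baseMap_X_zero]
      linear_combination hs - baseMap f q * gen_two_sq f)
  obtain ⟨v, rfl⟩ := (hX.dvd_or_dvd (dvd_neg.mp ⟨p', h1⟩)).resolve_left hF
  exact ⟨baseMap f q' + baseMap f v * gen f 2, by simp only [map_mul, baseMap_X_zero]; ring⟩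

lemma baseMap_monomial (m : Fin 2 →₀ ℕ) (a : k) :
    baseMap f (monomial m a) = a • (gen f 0 ^ m 0 * gen f 1 ^ m 1) := by
  rw [monomial_eq, Finsupp.prod_fintype _ _ (by simp), Fin.prod_univ_two, map_mul, map_mul,
    map_pow, map_pow, baseMap_X_zero, baseMap_X_one, ← algebraMap_eq, AlgHom.commutes]
  exact (Algebra.smul_def _ _).symm

end Concrete

/-! ### Monomial bases and the Hilbert function -/

section ConcreteGrading

open MvPolynomial

variable {k : Type*} [Field k] {g : ℕ} {f : homogeneousSubmodule (Fin 2) k (2 * g + 1)}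

lemma gen_mem (i : Fin 3) : gen f.1 i ∈ hyperellipticGrading g f (hyperellipticWeight g i) :=
  ⟨X i, isWeightedHomogeneous_X k _ i, rfl⟩

lemma gen_monomial_mem (i j : ℕ) :
    gen f.1 0 ^ i * gen f.1 1 ^ j ∈ hyperellipticGrading g f (i + 2 * j) := by
  have h := SetLike.mul_mem_graded (SetLike.pow_mem_graded i (gen_mem (f := f) 0))
    (SetLike.pow_mem_graded j (gen_mem (f := f) 1))
  have e : i • hyperellipticWeight g 0 + j • hyperellipticWeight g 1 = i + 2 * j := by
    simp [hyperellipticWeight, mul_comm]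
  rwa [e] at h

lemma gen_monomial_mul_mem (i j : ℕ) :
    gen f.1 0 ^ i * gen f.1 1 ^ j * gen f.1 2 ∈
      hyperellipticGrading g f (i + 2 * j + (2 * g + 1)) :=
  SetLike.mul_mem_graded (gen_monomial_mem i j) (gen_mem 2)

lemma hyperellipticGrading_le_span (n : ℕ) : hyperellipticGrading g f n ≤ Submodule.span k
    ({r | ∃ i j, i + 2 * j = n ∧ r = gen f.1 0 ^ i * gen f.1 1 ^ j} ∪
    {r | ∃ i j, i + 2 * j + (2 * g + 1) = n ∧ r = gen f.1 0 ^ i * gen f.1 1 ^ j * gen f.1 2}) := by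
  intro r hr
  set N := Submodule.span k
    ({r | ∃ i j, i + 2 * j = n ∧ r = gen f.1 0 ^ i * gen f.1 1 ^ j} ∪
    {r | ∃ i j, i + 2 * j + (2 * g + 1) = n ∧ r = gen f.1 0 ^ i * gen f.1 1 ^ j * gen f.1 2})
  have hcmp : ∀ r : HyperellipticRing f.1, cmp (hyperellipticGrading g f) n r ∈ N := by
    intro r
    obtain ⟨p, q, rfl⟩ := exists_eq_baseMap_add f.1 r
    rw [map_add]
    refine N.add_mem ?_ ?_
    · induction p using MvPolynomial.induction_on' with
      | add p p' hp hp' => rw [map_add, map_add]; exact N.add_mem hp hp'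
      | monomial m a =>
        rw [baseMap_monomial, map_smul]
        refine N.smul_mem _ ?_
        have hm := gen_monomial_mem (f := f) (m 0) (m 1)
        rw [← gr_natCast (hyperellipticGrading g f)] at hm
        by_cases h : m 0 + 2 * m 1 = n
        · rw [← h, cmp_of_mem _ hm]
          exact Submodule.subset_span (Or.inl ⟨_, _, h, rfl⟩)
        · rw [cmp_of_mem_ne _ hm (by omega)]
          exact N.zero_mem
    · induction q using MvPolynomial.induction_on' with
      | add p p' hp hp' => rw [map_add, add_mul, map_add]; exact N.add_mem hp hp'
      | monomial m a =>
        rw [baseMap_monomial, smul_mul_assoc, map_smul]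
        refine N.smul_mem _ ?_
        have hm := gen_monomial_mul_mem (f := f) (m 0) (m 1)
        rw [← gr_natCast (hyperellipticGrading g f)] at hm
        by_cases h : m 0 + 2 * m 1 + (2 * g + 1) = n
        · rw [← h, cmp_of_mem _ hm]
          exact Submodule.subset_span (Or.inr ⟨_, _, h, rfl⟩)
        · rw [cmp_of_mem_ne _ hm (by omega)]
          exact N.zero_mem
  have := hcmp r
  rwa [cmp_of_mem _ (by rw [gr_natCast]; exact hr)] at this

/-- The monomial basis of the degree `n` part. -/
def monomialFamily (g : ℕ) (f : homogeneousSubmodule (Fin 2) k (2 * g + 1)) (n : ℕ) :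
    Fin (n / 2 + 1) ⊕ Fin ((n + 2 - (2 * g + 1)) / 2) → HyperellipticRing f.1 :=
  Sum.elim (fun j => gen f.1 0 ^ (n - 2 * j) * gen f.1 1 ^ (j : ℕ))
    (fun j => gen f.1 0 ^ (n - (2 * g + 1) - 2 * j) * gen f.1 1 ^ (j : ℕ) * gen f.1 2)

lemma linearIndependent_monomialFamily (n : ℕ) : LinearIndependent k (monomialFamily g f n) := by
  let B := ((basisMonomials (Fin 2) k).prod (basisMonomials (Fin 2) k)).map (freeEquiv f.1)
  let mon (i j : ℕ) : Fin 2 →₀ ℕ := Finsupp.single 0 i + Finsupp.single 1 j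
  have hmon : ∀ i j, mon i j 0 = i ∧ mon i j 1 = j := fun i j => by simp [mon]
  let c : Fin (n / 2 + 1) ⊕ Fin ((n + 2 - (2 * g + 1)) / 2) → (Fin 2 →₀ ℕ) ⊕ (Fin 2 →₀ ℕ) :=
    Sum.map (fun j => mon (n - 2 * j) j) (fun j => mon (n - (2 * g + 1) - 2 * j) j)
  have hc : Function.Injective c := by
    refine Function.Injective.sumMap ?_ ?_ <;>
    · intro j j' h
      have := DFunLike.congr_fun h 1
      simp only [(hmon _ _).2] at this
      exact Fin.ext this
  have e : monomialFamily g f n = B ∘ c := by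
    funext i
    rcases i with j | j
    · have : B (c (Sum.inl j)) = baseMap f.1 (monomial (mon (n - 2 * j) j) 1) +
          baseMap f.1 0 * gen f.1 2 := by
        simp [B, c, freeEquiv_apply]
      rw [Function.comp_apply, this, map_zero, zero_mul, add_zero, baseMap_monomial, (hmon _ _).1,
        (hmon _ _).2, one_smul]
      rfl
    · have : B (c (Sum.inr j)) = baseMap f.1 0 +
          baseMap f.1 (monomial (mon (n - (2 * g + 1) - 2 * j) j) 1) * gen f.1 2 := by
        simp [B, c, freeEquiv_apply]
      rw [Function.comp_apply, this, map_zero, zero_add, baseMap_monomial, (hmon _ _).1,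
        (hmon _ _).2, one_smul]
      rfl
  rw [e]
  exact B.linearIndependent.comp c hc

lemma span_monomialFamily (n : ℕ) :
    Submodule.span k (Set.range (monomialFamily g f n)) = hyperellipticGrading g f n := by
  refine le_antisymm (Submodule.span_le.mpr ?_) ((hyperellipticGrading_le_span n).trans
    (Submodule.span_mono ?_))
  · rintro _ ⟨j | j, rfl⟩
    · have := gen_monomial_mem (f := f) (n - 2 * j) j
      rwa [show n - 2 * (j : ℕ) + 2 * j = n by omega] at this
    · have := gen_monomial_mul_mem (f := f) (n - (2 * g + 1) - 2 * j) j
      rwa [show n - (2 * g + 1) - 2 * (j : ℕ) + 2 * j + (2 * g + 1) = n by omega] at this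
  · rintro _ (⟨i, j, h, rfl⟩ | ⟨i, j, h, rfl⟩)
    · refine ⟨Sum.inl ⟨j, by omega⟩, ?_⟩
      simp only [monomialFamily, Sum.elim_inl]
      rw [show n - 2 * j = i by omega]
    · refine ⟨Sum.inr ⟨j, by omega⟩, ?_⟩
      simp only [monomialFamily, Sum.elim_inr]
      rw [show n - (2 * g + 1) - 2 * j = i by omega]

/-- The last summand counts the monomials with a factor `Z`. For `n ≤ 2g` the truncated numerator is
at most `1`, so it correctly gives zero. -/
lemma finrank_hyperellipticGrading (n : ℕ) : Module.finrank k (hyperellipticGrading g f n) =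
    n / 2 + 1 + (n + 2 - (2 * g + 1)) / 2 := by
  rw [← span_monomialFamily, finrank_span_eq_card (linearIndependent_monomialFamily n)]
  simp

lemma hasRiemannRoch_hyperelliptic (hg : 2 ≤ g) :
    HasRiemannRoch (hyperellipticGrading g f) (2 * g - 2) (1 - g) := by
  refine ⟨fun n => ?_, fun n => ?_, ?_⟩
  · rw [← span_monomialFamily]
    exact Module.Finite.span_of_finite k (Set.finite_range _)
  · have hpos : ∀ n : ℤ, 0 ≤ n → (Module.finrank k (gr (hyperellipticGrading g f) n) : ℤ) =
        ((n.toNat / 2 + 1 + (n.toNat + 2 - (2 * g + 1)) / 2 : ℕ) : ℤ) := by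
      intro n hn
      rw [gr, if_pos hn, finrank_hyperellipticGrading]
    have hneg : ∀ n : ℤ, n < 0 → (Module.finrank k (gr (hyperellipticGrading g f) n) : ℤ) = 0 := by
      intro n hn
      rw [gr_of_neg _ hn, finrank_bot, Nat.cast_zero]
    rcases lt_or_ge n 0 with h | h <;> rcases lt_or_ge (2 * (g : ℤ) - 2 - n) 0 with h' | h'
    · omega
    · rw [hneg n h, hpos _ h']; omega
    · rw [hpos n h, hneg _ h']; omega
    · rw [hpos n h, hpos _ h']; omega
  · rw [finrank_hyperellipticGrading]; omega

theorem isHyperellipticCone (hg : 2 ≤ g) (hsq : Squarefree (substSq f.1)) :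
    IsHyperellipticCone (hyperellipticGrading g f) g (gen f.1 0) (gen f.1 1) (gen f.1 2) := by
  obtain ⟨hX, -⟩ := substSq_properties ((mem_homogeneousSubmodule _ _).mp f.2) hsq
  have hadj : Algebra.adjoin k {gen f.1 0, gen f.1 1} = (baseMap f.1).range := by
    have e : (baseMap f.1).range = Algebra.adjoin k (Set.range ![gen f.1 0, gen f.1 1]) := by
      rw [Algebra.adjoin_range_eq_range_aeval]
      congr 1
      refine algHom_ext fun i => ?_
      fin_cases i <;> simp
    rw [e]
    simp [Set.pair_comm]
  refine
    { hasRiemannRoch := hasRiemannRoch_hyperelliptic hg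
      X_mem := gen_mem 0
      Y_mem := gen_mem 1
      Z_mem := gen_mem 2
      X_ne_zero := ?_
      Y_ne_zero := ?_
      Z_ne_zero := ?_
      regular_XY := regular_X_Y
      regular_XZ := regular_X_Z hX
      le_span := hyperellipticGrading_le_span
      Z_sq_mem := ?_
      mul_Z_notMem := ?_
      algebraicIndependent := ?_ }
  · rw [← baseMap_X_zero, ← map_zero (baseMap f.1)]
    exact (baseMap_injective f.1).ne (X_ne_zero 0)
  · rw [← baseMap_X_one, ← map_zero (baseMap f.1)]
    exact (baseMap_injective f.1).ne (X_ne_zero 1)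
  · intro h
    have := (eq_zero_of_baseMap_add f.1 (p := 0) (q := 1) (by simp [h])).2
    exact one_ne_zero this
  · rw [gen_two_sq, hadj]
    exact neg_mem ⟨_, rfl⟩
  · intro n h
    rw [hadj] at h
    obtain ⟨p, hp⟩ := h
    have := (baseMap_add_inj f.1 (p := p) (q := 0) (p' := 0) (q' := X 0 ^ n) (by
      rw [map_zero, zero_mul, zero_add, add_zero, map_pow, baseMap_X_zero]; exact hp)).2
    exact pow_ne_zero n (X_ne_zero 0) this.symm
  · have e : (aeval ![gen f.1 0, gen f.1 1] : MvPolynomial (Fin 2) k →ₐ[k] _) = baseMap f.1 := by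
      refine algHom_ext fun i => ?_
      fin_cases i <;> simp
    rw [AlgebraicIndependent, e]
    exact baseMap_injective f.1

end ConcreteGrading

/-! ### Arithmetic of `g` and `d` -/

section Numerical

variable {k R : Type*} [Field k] [CommRing R] [IsDomain R] [Algebra k R]
variable {𝒜 : ℕ → Submodule k R} [GradedAlgebra 𝒜] {g : ℕ} {X Y Z : R} {d : ℕ} [NeZero d]

namespace IsHyperellipticCone

/-- `R^{(d)}` is nearly Gorenstein if every relevant multiple of `d` splits as `s + t` with `s` a
fixed even number, or `s = 1` and `t` odd, where `s` or `t` is congruent to `2g - 2`. -/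
lemma isNearlyGorenstein_veronese_of_even (C : IsHyperellipticCone 𝒜 g X Y Z) (s : ℕ)
    (hs : 2 ∣ s) (hsd : s ≤ d)
    (hdvd : (d : ℤ) ∣ s - (2 * g - 2) ∨ (d : ℤ) ∣ s + (2 * g - 2))
    (h : ∀ m, 0 < m → 2 * g + 1 ≤ d * m → 2 * g + 1 + s ≤ d * m ∨
      (2 ∣ d * m ∧ ((d : ℤ) ∣ 1 - (2 * g - 2) ∨ (d : ℤ) ∣ 1 + (2 * g - 2)))) :
    IsNearlyGorenstein (veroneseGrading 𝒜 d) := by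
  have hle : ∀ m, 0 < m → s ≤ d * m := fun m hm => hsd.trans (Nat.le_mul_of_pos_right d hm)
  have hcompl : ∀ m r : ℕ, r ≤ d * m → (d : ℤ) ∣ r + (2 * g - 2) →
      (d : ℤ) ∣ (d * m - r : ℕ) - (2 * g - 2) := by
    intro m r hr h
    rw [Nat.cast_sub hr, Nat.cast_mul, sub_sub]
    exact (dvd_mul_right _ _).sub h
  refine C.isNearlyGorenstein_veronese (fun m hm => ?_) (fun m hm hdm => ?_)
  · rcases hdvd with hd | hd
    · exact ⟨s, d * m - s, Nat.add_sub_of_le (hle m hm), hd, Or.inl hs⟩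
    · exact ⟨d * m - s, s, Nat.sub_add_cancel (hle m hm), hcompl m s (hle m hm) hd, Or.inr hs⟩
  · rcases h m hm hdm with hsm | ⟨heven, hone⟩
    · exact ⟨s, d * m - s, Nat.add_sub_of_le (hle m hm), hdvd.imp_right (hcompl m s (hle m hm)),
        by omega, Or.inl hs⟩
    -- Here `dm` is even and at least `2g + 1`, hence at least `2g + 2`; splitting off degree `1`
    -- leaves an odd degree with room for `Z`.
    · refine ⟨1, d * m - 1, by omega, ?_, by omega, Or.inr (by omega)⟩
      have := hcompl m 1 (by omega)
      exact hone.imp (by simp) (by simpa using this)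

lemma isNearlyGorenstein_veronese_of_dvd (C : IsHyperellipticCone 𝒜 g X Y Z)
    (hd : (d : ℤ) ∣ 2 * g - 2) : IsNearlyGorenstein (veroneseGrading 𝒜 d) :=
  C.isNearlyGorenstein_veronese_of_even 0 (dvd_zero 2) (Nat.zero_le d) (Or.inr (by simpa using hd))
    fun _ _ h => Or.inl h

/-- The bound is `4g - 1 = (2g - 2) + (2g + 1)`: a factor in the canonical degree `2g - 2` leaves
room for `Z`. -/
lemma isNearlyGorenstein_veronese_of_le (C : IsHyperellipticCone 𝒜 g X Y Z) (hg : 2 ≤ g)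
    (hd : 4 * g - 1 ≤ d) : IsNearlyGorenstein (veroneseGrading 𝒜 d) := by
  refine C.isNearlyGorenstein_veronese_of_even (2 * g - 2) (by omega) (by omega)
    (Or.inl ⟨0, by omega⟩) fun m hm _ => Or.inl ?_
  have := Nat.le_mul_of_pos_right d hm
  omega

/-- In degree `d` itself the congruence forces `s = 2g - 2`, so `t = d - (2g - 2) ≤ 2g`, and neither
factor can involve `Z`. -/
lemma not_isNearlyGorenstein_veronese (C : IsHyperellipticCone 𝒜 g X Y Z) (hg : 2 ≤ g)
    (hd : ¬ d ∣ 2 * g - 2) (h₁ : 2 * g + 1 ≤ d) (h₂ : d ≤ 4 * g - 2) :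
    ¬ IsNearlyGorenstein (veroneseGrading 𝒜 d) := by
  intro h
  obtain ⟨s, t, hst, ⟨c, hc⟩, hlarge⟩ := C.exists_of_isNearlyGorenstein h one_pos (by omega)
  rw [mul_one] at hst
  have hdpos : (0 : ℤ) < d := by omega
  have hc_lt : c < 2 := by
    by_contra! hc'
    nlinarith
  have hc_gt : -1 < c := by
    by_contra! hc'
    nlinarith
  obtain rfl | rfl : c = 0 ∨ c = 1 := by omega
  · omega
  · obtain rfl : g = 1 := by omega
    omega

lemma isNearlyGorenstein_veronese_three (C : IsHyperellipticCone 𝒜 g X Y Z) :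
    IsNearlyGorenstein (veroneseGrading 𝒜 3) := by
  rcases (by omega : g % 3 = 1 ∨ g % 3 = 0 ∨ g % 3 = 2) with h | h | h
  · exact C.isNearlyGorenstein_veronese_of_dvd (by omega)
  all_goals
    exact C.isNearlyGorenstein_veronese_of_even 2 (by norm_num) (by norm_num) (by omega)
      fun m hm hdm => by omega

lemma isNearlyGorenstein_veronese_four (C : IsHyperellipticCone 𝒜 g X Y Z) :
    IsNearlyGorenstein (veroneseGrading 𝒜 4) := by
  rcases Nat.even_or_odd g with ⟨r, hr⟩ | ⟨r, hr⟩
  · exact C.isNearlyGorenstein_veronese_of_even 2 (by norm_num) (by norm_num) (by omega)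
      fun m hm hdm => by omega
  · exact C.isNearlyGorenstein_veronese_of_dvd (by omega)

lemma isNearlyGorenstein_veronese_six_iff (C : IsHyperellipticCone 𝒜 g X Y Z) (hg : 2 ≤ g)
    (h : ¬ 6 ∣ 2 * g - 2) : IsNearlyGorenstein (veroneseGrading 𝒜 6) ↔ ¬ g ≡ 2 [MOD 3] := by
  rw [Nat.ModEq]
  constructor
  · intro hG hmod
    -- For `g ≡ 2` modulo `3` this is degree `6m = 2g + 2`. There `s ≡ 2` and `t ≡ 4` modulo `6`, so
    -- `s ≤ 2g - 2` and `t ≤ 2g`.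
    obtain ⟨s, t, hst, hs, hlarge⟩ := C.exists_of_isNearlyGorenstein hG (m := (g + 1) / 3)
      (by omega) (by omega)
    omega
  · intro hmod
    exact C.isNearlyGorenstein_veronese_of_even 2 (by norm_num) (by norm_num) (by omega)
      fun m hm hdm => by omega

lemma isNearlyGorenstein_veronese_small (C : IsHyperellipticCone 𝒜 g X Y Z)
    (h : (g = 3 ∧ d = 5) ∨ (g = 3 ∧ d = 6) ∨ (g = 4 ∧ d = 5) ∨ (g = 4 ∧ d = 7) ∨ (g = 4 ∧ d = 8) ∨
      (g = 5 ∧ d = 5) ∨ (g = 5 ∧ d = 7) ∨ (g = 5 ∧ d = 9) ∨ (g = 5 ∧ d = 10)) :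
    IsNearlyGorenstein (veroneseGrading 𝒜 d) := by
  -- In each case `s` is an even number at most `d` congruent to `2g - 2` or to its negative modulo
  -- `d`.
  obtain ⟨s, h⟩ : ∃ s, (g = 3 ∧ d = 5 ∧ s = 4) ∨ (g = 3 ∧ d = 6 ∧ s = 2) ∨
      (g = 4 ∧ d = 5 ∧ s = 4) ∨ (g = 4 ∧ d = 7 ∧ s = 6) ∨ (g = 4 ∧ d = 8 ∧ s = 2) ∨
      (g = 5 ∧ d = 5 ∧ s = 2) ∨ (g = 5 ∧ d = 7 ∧ s = 6) ∨ (g = 5 ∧ d = 9 ∧ s = 8) ∨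
      (g = 5 ∧ d = 10 ∧ s = 2) := by
    simp only [exists_or, exists_and_left, exists_eq, and_true]
    exact h
  rcases h with ⟨rfl, rfl, hs⟩ | ⟨rfl, rfl, hs⟩ | ⟨rfl, rfl, hs⟩ | ⟨rfl, rfl, hs⟩ |
    ⟨rfl, rfl, hs⟩ | ⟨rfl, rfl, hs⟩ | ⟨rfl, rfl, hs⟩ | ⟨rfl, rfl, hs⟩ | ⟨rfl, rfl, hs⟩ <;>
  exact C.isNearlyGorenstein_veronese_of_even s (by omega) (by omega) (by omega)
    fun m hm hdm => by omega

end IsHyperellipticCone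

end Numerical

end NearlyGor

end

open NearlyGor in
theorem proposition5p6 {k : Type*} [Field k] [IsAlgClosed k] (g : ℕ) (hg : 2 ≤ g)
    (f : MvPolynomial.homogeneousSubmodule (Fin 2) k (2 * g + 1))
    (hf : Squarefree (substSq f.1)) :
    HasAInvariant (hyperellipticGrading g f) (2 * (g : ℤ) - 2) ∧
    (∀ (d : ℕ) [NeZero d],
      IsGradedGorenstein (veroneseGrading (hyperellipticGrading g f) d) ↔ d ∣ 2 * g - 2) ∧
    IsNearlyGorenstein (veroneseGrading (hyperellipticGrading g f) 3) ∧
    IsNearlyGorenstein (veroneseGrading (hyperellipticGrading g f) 4) ∧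
    (¬ 6 ∣ 2 * g - 2 →
      (IsNearlyGorenstein (veroneseGrading (hyperellipticGrading g f) 6) ↔ ¬ g ≡ 2 [MOD 3])) ∧
    (∀ (d : ℕ) [NeZero d], ¬ d ∣ 2 * g - 2 → 4 * g - 1 ≤ d →
      IsNearlyGorenstein (veroneseGrading (hyperellipticGrading g f) d)) ∧
    (∀ (d : ℕ) [NeZero d], ¬ d ∣ 2 * g - 2 → 5 ≤ d →
      (g = 2 → (IsNearlyGorenstein (veroneseGrading (hyperellipticGrading g f) d) ↔ 7 ≤ d)) ∧
      (g = 3 → (IsNearlyGorenstein (veroneseGrading (hyperellipticGrading g f) d) ↔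
        d = 5 ∨ d = 6 ∨ 11 ≤ d)) ∧
      (g = 4 → (IsNearlyGorenstein (veroneseGrading (hyperellipticGrading g f) d) ↔
        d = 5 ∨ d = 7 ∨ d = 8 ∨ 15 ≤ d)) ∧
      (g = 5 → (IsNearlyGorenstein (veroneseGrading (hyperellipticGrading g f) d) ↔
        (d ≤ 10 ∧ d ≠ 6) ∨ 19 ≤ d))) := by
  have : IsDomain (HyperellipticRing f.1) := isDomain_hyperellipticRing
    (substSq_properties ((MvPolynomial.mem_homogeneousSubmodule _ _).mp f.2) hf).2
  have C := isHyperellipticCone hg hf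
  -- The range `2g < d < 4g - 1` is excluded for every `g`. For `g ≤ 5` this leaves only `5 ≤ d ≤
  -- 2g` to be settled case by case, where `d = 6`, `g = 5` falls to the criterion for `R^{(6)}`.
  have hnot (d : ℕ) [NeZero d] (hd : ¬ d ∣ 2 * g - 2)
      (hG : IsNearlyGorenstein (veroneseGrading (hyperellipticGrading g f) d)) :
      d ≤ 2 * g ∨ 4 * g - 1 ≤ d := by
    by_contra! h
    exact C.not_isNearlyGorenstein_veronese hg hd (by omega) (by omega) hG
  refine ⟨C.hasAInvariant, fun d _ => ?_, C.isNearlyGorenstein_veronese_three,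
    C.isNearlyGorenstein_veronese_four, C.isNearlyGorenstein_veronese_six_iff hg,
    fun d _ _ h => C.isNearlyGorenstein_veronese_of_le hg h, fun d _ hd h5 => ?_⟩
  · rw [C.isGradedGorenstein_veronese_iff, ← Int.natCast_dvd_natCast,
      show ((2 * g - 2 : ℕ) : ℤ) = 2 * g - 2 by omega]
  · have hle := C.isNearlyGorenstein_veronese_of_le (d := d) hg
    have hsmall := C.isNearlyGorenstein_veronese_small (d := d)
    refine ⟨fun hg' => ⟨fun hG => ?_, fun h => hle (by omega)⟩,
      fun hg' => ⟨fun hG => ?_, fun h => ?_⟩, fun hg' => ⟨fun hG => ?_, fun h => ?_⟩,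
      fun hg' => ⟨fun hG => ?_, fun h => ?_⟩⟩
    · have := hnot d hd hG
      omega
    · have := hnot d hd hG
      omega
    · rcases lt_or_ge d 11 with h' | h'
      · exact hsmall (by omega)
      · exact hle (by omega)
    · have := hnot d hd hG
      have h6 : d ≠ 6 := by
        rintro rfl
        exact hd (by rw [hg'])
      omega
    · rcases lt_or_ge d 15 with h' | h'
      · exact hsmall (by omega)
      · exact hle (by omega)
    · have := hnot d hd hG
      have h6 : d ≠ 6 := by
        rintro rfl
        have := (C.isNearlyGorenstein_veronese_six_iff hg hd).mp hG
        exact this (by rw [hg']; rfl)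
      omega
    · rcases lt_or_ge d 19 with h' | h'
      · have h8 : d ≠ 8 := by
          rintro rfl
          exact hd (by rw [hg'])
        exact hsmall (by omega)
      · exact hle (by omega)
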